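/- **Setting.** A client and a server hold labels $\alpha,\alpha'\in\{1,\dots,m\}$ (the value $m+1$ means that a party has no secrets left) and share a privacy amplification seed $R$, a hash key $K^h$, masks $K_i$, basis seeds ($\tilde\theta_i$ at the client, $\tilde\theta'_i$ at the server), check values $\tilde T_i$ (client) and server tags $T_i$, $1\le i\le m$. Let $h_1(K^h,\cdot)$ be an $\varepsilon_{\rm MAC,1}$-almost XOR 2-universal hash function with values in $\mathcal T_{\rm CV}=\{0,1\}^{l_{\rm CV}}$, and $h_{\rm PA}(R,\cdot)$ a function with values in $\mathcal T_{\rm SV}\times\{0,1\}^{l_\theta}$, $\mathcal T_{\rm SV}=\{0,1\}^{l_{\rm SV}}$, whose first component is uniformly distributed, for every input, when $R$ is uniform. Let $g:\{0,1\}^{l_\theta}\to\{0,1\}^n$, a syndrome map $f_{\rm syn}$, a decoder $f_{\rm dec}$, a distribution $p_v$ on $\{0,1,2\}$, a test fraction $f\in[0,1]$, tolerances and decoy-state estimators be arbitrary. The source is an arbitrary family of states $\rho_Q^{\theta,x,v}$ ($\theta,x\in\{0,1\}^n$, $v\in\{0,1,2\}^n$), for instance phase-randomised coherent BB84 states, and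 the receiver an arbitrary measurement for each $\theta$ with outcomes in $\{0,1,\perp\}^n$. Hilbert spaces may be infinite-dimensional. **One round of the protocol $\mathcal P$.** 1. The server sends $T_{\alpha'},\alpha'$ and the state $\rho_Q^{g(\tilde\theta'_{\alpha'}),x,v}$ with $x$ uniform and $v$ i.i.d. from $p_v$. 2. The client receives $\alpha'_{\rm r}$, $T_{\rm r}$ and a quantum system. If $\alpha'_{\rm r}>\alpha$, it sets $\alpha=\alpha'_{\rm r}$, $D_C=1$; if $\alpha'_{\rm r}=\alpha$, then $D_C=1$ iff $\tilde T_\alpha=T_{\rm r}$; otherwise $D_C=0$. It measures the system in the basis $g(\tilde\theta_\alpha)$ with outcome $x'$, chooses a uniformly random $P_1\subseteq P=\{i:x'_i\ne\perp\}$ with $|P_1|=\lceil f|P|\rceil$, puts $P_2=P\setminus P_1$, $s=f_{\rm syn}(x'_{P_2})$, and sends $D_C,\alpha,P_1,P_2,x'_{P_1},s$ and $t=h_1(K^h,x'_{P_1}\|P_1\|P_2\|x'_{P_2}\|s)\oplus K_\alpha$; if $D_C=0$, everything after $D_C,\alpha$ is replaced by a uniformly random string. If $D_C=1$ it sets $\tilde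 T_\alpha\|\tilde\theta_\alpha=h_{\rm PA}(R,x'_{P_2})$; if $D_C=0$ it sets $\alpha=\alpha+1$. 3. The server receives such a message (subscript r), decodes $\hat x=f_{\rm dec}(x_{P_{2,\rm r}},s_{\rm r})$, lets $D_{\rm CV}=1$ iff $t_{\rm r}=h_1(K^h,x'_{P_1,\rm r}\|P_{1,\rm r}\|P_{2,\rm r}\|\hat x\|s_{\rm r})\oplus K_{\alpha'}$, and $D_{\rm PE}=1$ iff $|P_{1,\rm r}|=\lceil f|P_{1,\rm r}\cup P_{2,\rm r}|\rceil\ge P_{1,\rm tol}$, the bit error rate in $P_{1,\rm r}$ is at most $e_{\rm bit,tol}$, and the decoy-state bounds on the vacuum and single-photon counts in $P_{2,\rm r}$ and on the single-photon error rate in $P_{1,\rm r}$ meet their tolerances. It adds $1$ to $\alpha_{\rm r}$ if the received $D_C$ is $0$; if now $\alpha_{\rm r}>\alpha'$, it sets $\alpha'=\alpha_{\rm r}-1$, $D_{\rm SA}=0$, else $D_{\rm SA}=1$. Then $F_S=D_{\rm PE}\wedge D_{\rm CV}\wedge D_{\rm SA}$. If $F_S=1$ it sets $T_{\alpha'}\|\tilde\theta'_{\alpha'}=h_{\rm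 PA}(R,\hat x)$, else $\alpha'=\alpha'+1$. At the end of the round, masks with index below $\min\{\alpha,\alpha'\}$ and each party's seeds and tags with index below its own label are discarded. An adversarial strategy $\mathcal E$ consists of arbitrary quantum instruments: it decides whether the server takes part ($F_S=\phi$ if not); having received step 1 (if any), it chooses what the client receives, or, if the server takes part, may leave the client out ($D_C=\phi$); finally it chooses what the server receives. An index $\alpha^U$ is updated as follows: it is unchanged if $D_C=\phi$; it becomes $\max\{\alpha^U,\alpha\}$ with the new $\alpha$ if $D_C=0$; and if $D_C=1$ it becomes $\max\{\alpha^U,\alpha'_{\rm r}\}$, plus $1$ if $F_S\ne1$. **States.** $\rho_{LSE}^{j,j^U,j'}$ with $j^U\in\{j,j+1\}$ denotes any state with $(\alpha,\alpha^U,\alpha')=(j,j^U,j')$ of the following form. $R$, $K^h$, all masks not discarded, and the seeds $\tilde\theta_i=\tilde\theta'_i$ with $i\ge\max\{j^U,j'\}$ are uniform and independent. The adversary's system $E$ depends on these only through one query to each oracle $M\mapsto h_1(K^h,M)\oplus K_i$ with $j'\le i\le j-1$, and $i=j$ if $j^U=j+1$; conditioning on events observed by the adversary is allowed, so that for queries $M$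 with replies $t$ the unnormalised state of $E$ may be any positive trace-class operator depending on $M$ and $t$. All $T_i,\tilde T_i$ and the other seeds have arbitrary values, arbitrarily correlated with $E$; except that, if $j^U=j+1$, the client's pair $\tilde T_j\|\tilde\theta_j$ equals $h_{\rm PA}(R,M')$ for a message $M'$ chosen by the adversary, who does not see this value. An *ideal output state* for input labels $(j,j^U,j')$ is a normalised mixture of states with the following classical values of $(D_C,F_S)$ and form of the rest: $(\phi,0)$ with $\rho_{LSE}^{j,j^U,\tilde j'}$; $(0,\phi)$ with $\rho_{LSE}^{j+1,j+1,j'}$; $(1,\phi)$ with $\rho_{LSE}^{\tilde j,\tilde j+1,j'}$; $(0,0)$ with $\rho_{LSE}^{j+1,j+1,\tilde j'}$; $(1,0)$ with $\rho_{LSE}^{\tilde j,\tilde j+1,\tilde j'}$; $(1,1)$ with $\rho_{LSE}^{j',j',j'}$; where $j\le\tilde j\le m$ and $j'+1\le\tilde j'\le m+1$. Let $\Delta(\rho,\sigma)=\frac12\|\rho-\sigma\|_1$ and $\varepsilon_{\rm match}=2^{-P_{1,\rm tol}[1-h_{\rm bin}(e_{\rm bit,tol})]}$, where $h_{\rm bin}$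 is the binary entropy. **Theorem.** Let $1\le j<m$, $1\le j'\le m$, $\varepsilon_{\rm sec}\ge0$. Suppose that for every valid input state $\rho_{LSE}^{j+1,j+1,j'}$ and every adversarial strategy $\mathcal E$ there is an ideal output state $\rho^{\rm out}$ for the labels $(j+1,j+1,j')$ with $\Delta(\mathcal P_{\mathcal E}(\rho_{LSE}^{j+1,j+1,j'}),\rho^{\rm out})\le\varepsilon_{\rm sec}$. Then for every valid input state $\rho_{LSE}^{j,j+1,j'}$ and every adversarial strategy $\mathcal E$ there is an ideal output state $\rho^{\rm out}$ for the labels $(j,j+1,j')$ with $$\Delta(\mathcal P_{\mathcal E}(\rho_{LSE}^{j,j+1,j'}),\rho^{\rm out})\le\varepsilon_{\rm sec}+\frac{2}{|\mathcal T_{\rm CV}|}+\frac1{|\mathcal T_{\rm SV}|}+2\varepsilon_{\rm MAC,1}+2\varepsilon_{\rm match}.$$ -/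

import Mathlib

open scoped ComplexOrder ENNReal Kronecker

noncomputable section

namespace ClientAuth

/-! ### Quantum systems

A quantum system with Hilbert space `ℓ²(ι)` is described by its index type `ι` (of any size);
an operator on it is described by its matrix. -/

section Quantum

variable {ι κ X : Type}

/-- The trace of a positive operator, in `[0, ∞]`. -/
def tr (ρ : Matrix ι ι ℂ) : ℝ≥0∞ := ∑' i, ENNReal.ofReal (ρ i i).re

/-- `ρ` is (the matrix of) a positive trace-class operator on `ℓ²(ι)`. -/
def IsPos (ρ : Matrix ι ι ℂ) : Prop := ρ.PosSemidef ∧ tr ρ ≠ ∞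

/-- `ρ` is a density operator. -/
def IsState (ρ : Matrix ι ι ℂ) : Prop := ρ.PosSemidef ∧ tr ρ = 1

/-- Linear maps on operators. Only the values on trace-class operators carry meaning: every linear
map on the trace-class operators is the restriction of such a map. -/
abbrev Op (ι κ : Type) := Matrix ι ι ℂ →ₗ[ℂ] Matrix κ κ ℂ

/-- The map `id ⊗ L`, where the first factor is `k`-dimensional. -/
def amplify (k : ℕ) (L : Op ι κ) (ρ : Matrix (Fin k × ι) (Fin k × ι) ℂ) :
    Matrix (Fin k × κ) (Fin k × κ) ℂ :=
  fun a b => L (fun i i' => ρ (a.1, i) (b.1, i')) a.2 b.2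

/-- Complete positivity, as a map between spaces of trace-class operators. -/
def IsCP (L : Op ι κ) : Prop :=
  ∀ (k : ℕ) (ρ : Matrix (Fin k × ι) (Fin k × ι) ℂ), IsPos ρ → IsPos (amplify k L ρ)

/-- A classical-quantum operator `∑ₓ |x⟩⟨x| ⊗ Ω x` is given by the family `Ω`;
this is its trace. -/
def cqTr (Ω : X → Matrix ι ι ℂ) : ℝ≥0∞ := ∑' x, tr (Ω x)

/-- The trace distance `½ ‖Ω - Ω'‖₁`. The trace norm of a Hermitian operator is the least value of
`tr P + tr N` among its decompositions `P - N` into positive operators. -/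
def traceDist (Ω Ω' : X → Matrix ι ι ℂ) : ℝ≥0∞ :=
  (⨅ (P : X → Matrix ι ι ℂ) (N : X → Matrix ι ι ℂ) (_ : ∀ x, (P x).PosSemidef)
    (_ : ∀ x, (N x).PosSemidef) (_ : ∀ x, Ω x - Ω' x = P x - N x), (cqTr P + cqTr N)) / 2

end Quantum

/-! ### Classical data of the protocol -/

/-- Bit strings of length `l`; addition is bitwise XOR. -/
abbrev Bits (l : ℕ) := Fin l → ZMod 2

/-- The messages `x_{P₁} ‖ P₁ ‖ P₂ ‖ x_{P₂} ‖ s` that are authenticated,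
as tuples `⟨P₁, P₂, x_{P₁}, x_{P₂}, s⟩`. -/
abbrev HashMsg (n : ℕ) (Syn : Type) :=
  (P₁ : Finset (Fin n)) × (P₂ : Finset (Fin n)) × (P₁ → ZMod 2) × (P₂ → ZMod 2) × Syn

/-- The strings `x_{P₂}` (with their index set) that enter privacy amplification. -/
abbrev PAMsg (n : ℕ) := (P₂ : Finset (Fin n)) × (P₂ → ZMod 2)

/-- What the client announces after its label: `⟨P₁, P₂, x_{P₁}, s, t_CV⟩`. -/
abbrev Body (n lCV : ℕ) (Syn : Type) :=
  (P₁ : Finset (Fin n)) × Finset (Fin n) × (P₁ → ZMod 2) × Syn × Bits lCV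

/-- The public parameters of the protocol. Labels run over `Fin m`
(label `i` here is the label `i + 1` of a numbering that starts at `1`). -/
structure Params where
  /-- number of signals -/
  n : ℕ
  /-- maximum number of rounds -/
  m : ℕ
  /-- length of the client validation tags, of the server tags, of the basis seeds -/
  lCV : ℕ
  lSV : ℕ
  lSeed : ℕ
  /-- authentication keys `K₁ʰ`, privacy amplification seeds `R`, syndromes -/
  Key : Type
  PASeed : Type
  Syn : Type
  [fintypeKey : Fintype Key]
  [nonemptyKey : Nonempty Key]
  [fintypePASeed : Fintype PASeed]
  [nonemptyPASeed : Nonempty PASeed]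
  [fintypeSyn : Fintype Syn]
  /-- the hash function `h₁` (without its mask) -/
  h₁ : Key → HashMsg n Syn → Bits lCV
  /-- the privacy amplification function `h_PA`, with output `T_SV ‖ θ̃` -/
  hPA : PASeed → PAMsg n → Bits lSV × Bits lSeed
  /-- the generator of the basis string -/
  g : Bits lSeed → Bits n
  /-- syndrome and decoder of the error correction -/
  fsyn : (P₂ : Finset (Fin n)) → (P₂ → ZMod 2) → Syn
  fdec : (P₂ : Finset (Fin n)) → (P₂ → ZMod 2) → Syn → (P₂ → ZMod 2)
  /-- probabilities of the intensities -/
  pv : Fin 3 → ℝ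
  pv_nonneg : ∀ i, 0 ≤ pv i
  pv_sum : ∑ i, pv i = 1
  /-- fraction of the detected rounds that are test rounds -/
  fP₁ : ℝ
  fP₁_nonneg : 0 ≤ fP₁
  fP₁_le_one : fP₁ ≤ 1
  /-- decoy-state estimators: lower bounds on the numbers of vacuum and single-photon events in
  `P₂`, upper bound on the single-photon bit error rate in `P₁`; they may use all data of the
  server, i.e. `x`, `v`, `P₁`, `P₂` and the announced `x'_{P₁}` -/
  N₀LB : Bits n → (Fin n → Fin 3) → (P₁ : Finset (Fin n)) → Finset (Fin n) → (P₁ → ZMod 2) → ℝ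
  N₁LB : Bits n → (Fin n → Fin 3) → (P₁ : Finset (Fin n)) → Finset (Fin n) → (P₁ → ZMod 2) → ℝ
  e₁UB : Bits n → (Fin n → Fin 3) → (P₁ : Finset (Fin n)) → Finset (Fin n) → (P₁ → ZMod 2) → ℝ
  /-- tolerances of the parameter estimation -/
  N₀tol : ℝ
  N₁tol : ℝ
  e₁tol : ℝ
  etol : ℝ
  P₁tol : ℕ
  /-- the server's source: the `n`-signal state prepared for basis string `θ`, bit string `x` and
  intensity choices `v`, on `ℓ²(Sig)` -/
  Sig : Type
  source : Bits n → Bits n → (Fin n → Fin 3) → Matrix Sig Sig ℂ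
  source_isState : ∀ θ x v, IsState (source θ x v)
  /-- the client's receiver, on `ℓ²(Rcv)`: `effect θ y ρ` is the probability of the outcome string
  `y` (`none` standing for no detection) when the system in state `ρ` is measured with basis
  string `θ` -/
  Rcv : Type
  effect : Bits n → (Fin n → Option (ZMod 2)) → (Matrix Rcv Rcv ℂ →ₗ[ℂ] ℂ)
  effect_nonneg : ∀ θ y ρ, IsPos ρ → 0 ≤ effect θ y ρ
  effect_sum : ∀ θ ρ, IsPos ρ → ∑ y, effect θ y ρ = ((tr ρ).toReal : ℂ)

attribute [instance] Params.fintypeKey Params.nonemptyKey Params.fintypePASeed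
  Params.nonemptyPASeed Params.fintypeSyn

/-- `h` is `ε`-almost XOR 2-universal. -/
def IsAlmostXORUniversal {K M : Type} [Fintype K] {l : ℕ} (ε : ℝ) (h : K → M → Bits l) : Prop :=
  ∀ x₁ x₂, x₁ ≠ x₂ → ∀ t, (Nat.card {k // h k x₁ + h k x₂ = t} : ℝ) / Fintype.card K ≤ ε

/-- Every hash value is uniformly distributed when the seed is. -/
def IsUniformHash {K M : Type} [Fintype K] {l : ℕ} (h : K → M → Bits l) : Prop :=
  ∀ x t, (Nat.card {k // h k x = t} : ℝ) / Fintype.card K = 1 / 2 ^ l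

/-- The binary entropy, in bits. -/
def hbin (p : ℝ) : ℝ := Real.binEntropy p / Real.log 2

namespace Params

variable (C : Params)

/-- The matching probability `2^(-P₁tol (1 - h_bin(etol)))`. -/
def εmatch : ℝ := 2 ^ (-(C.P₁tol * (1 - hbin C.etol)) : ℝ)

/-- The classical memory of the two honest parties: the shared secrets `R`, `K₁ʰ`, `K₁ᵐᵃˢᵏ`, the
client's basis seeds `θ̃ᵢ` and check values `T̃_SV,ᵢ`, and the server's basis seeds `θ̃'ᵢ` and
tags `T_SV,ᵢ`. -/
@[ext] structure Mem where
  R : C.PASeed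
  Kh : C.Key
  mask : Fin C.m → Bits C.lCV
  cSeed : Fin C.m → Bits C.lSeed
  cTag : Fin C.m → Bits C.lSV
  sSeed : Fin C.m → Bits C.lSeed
  sTag : Fin C.m → Bits C.lSV

instance : Finite C.Mem :=
  Finite.of_injective
    (fun s : C.Mem => (s.R, s.Kh, s.mask, s.cSeed, s.cTag, s.sSeed, s.sTag)) (by
      intro s s' h
      simp only [Prod.mk.injEq] at h
      obtain ⟨h1, h2, h3, h4, h5, h6, h7⟩ := h
      exact Mem.ext h1 h2 h3 h4 h5 h6 h7)

instance : Fintype C.Mem := Fintype.ofFinite _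

/-- Discard what is never used again when the client's label is `a` and the server's is `b`:
masks below both labels, and seeds and tags of a party below its own label. -/
def Mem.discard {C : Params} (s : C.Mem) (a b : ℕ) : C.Mem where
  R := s.R
  Kh := s.Kh
  mask i := if min a b ≤ i then s.mask i else 0
  cSeed i := if a ≤ i then s.cSeed i else 0
  cTag i := if a ≤ i then s.cTag i else 0
  sSeed i := if b ≤ i then s.sSeed i else 0
  sTag i := if b ≤ i then s.sTag i else 0

/-! ### Ideal states -/

/-- Values that are drawn uniformly at random and independently of everything else. `seed i` is the
common value of `θ̃ᵢ` and `θ̃'ᵢ`, as long as this seed is secret. -/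
@[ext] structure Secrets where
  R : C.PASeed
  Kh : C.Key
  mask : Fin C.m → Bits C.lCV
  seed : Fin C.m → Bits C.lSeed

instance : Finite C.Secrets :=
  Finite.of_injective (fun z : C.Secrets => (z.R, z.Kh, z.mask, z.seed)) (by
      intro s s' h
      simp only [Prod.mk.injEq] at h
      obtain ⟨h1, h2, h3, h4⟩ := h
      exact Secrets.ext h1 h2 h3 h4)

instance : Fintype C.Secrets := Fintype.ofFinite _

/-- Values about which nothing is assumed (the adversary may know or choose them): all server tags
and check values, and the seeds of both parties where they are no longer secret. -/
@[ext] structure Lost where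
  cSeed : Fin C.m → Bits C.lSeed
  cTag : Fin C.m → Bits C.lSV
  sSeed : Fin C.m → Bits C.lSeed
  sTag : Fin C.m → Bits C.lSV

instance : Finite C.Lost :=
  Finite.of_injective (fun p : C.Lost => (p.cSeed, p.cTag, p.sSeed, p.sTag)) (by
      intro s s' h
      simp only [Prod.mk.injEq] at h
      obtain ⟨h1, h2, h3, h4⟩ := h
      exact Lost.ext h1 h2 h3 h4)

instance : Fintype C.Lost := Fintype.ofFinite _

/-- The indices `i` for which the adversary has had one call to the oracle
`M ↦ h₁(K₁ʰ, M) ⊕ K₁ᵐᵃˢᵏᵢ`, when `α = a`, `αᵁ = u`, `α' = b`. -/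
def oracleIdx (a u b i : ℕ) : Prop := (b ≤ i ∧ i < a) ∨ (u = a + 1 ∧ i = a)

open scoped Classical in
/-- The replies of the tag oracles to the queries `M` (`0` where there is no oracle). -/
def reply {C : Params} (a u b : ℕ) (z : C.Secrets) (M : Fin C.m → HashMsg C.n C.Syn) :
    Fin C.m → Bits C.lCV :=
  fun i => if oracleIdx a u b i then C.h₁ z.Kh (M i) + z.mask i else 0

open scoped Classical in
/-- The memory of the honest parties. If `u = a + 1`, the client's pair `T̃_SV,ₐ ‖ θ̃ₐ` is the value
of `h_PA(R, ·)` at the message `M` chosen by the adversary, who does not see the value. The seeds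
with index at least `max u b` are secret and equal for both parties. -/
def assemble {C : Params} (a u b : ℕ) (z : C.Secrets) (p : C.Lost) (M : PAMsg C.n) : C.Mem :=
  Mem.discard
    { R := z.R
      Kh := z.Kh
      mask := z.mask
      cSeed := fun i => if u = a + 1 ∧ (i : ℕ) = a then (C.hPA z.R M).2
        else if max u b ≤ i then z.seed i else p.cSeed i
      cTag := fun i => if u = a + 1 ∧ (i : ℕ) = a then (C.hPA z.R M).1 else p.cTag i
      sSeed := fun i => if max u b ≤ i then z.seed i else p.sSeed i
      sTag := p.sTag } a b

open scoped Classical in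
/-- `ω` is a nonnegative multiple of a state `ρ_SE^{a u b}`, where `u = a` or `u = a + 1`:
the secrets are uniform, and the adversary's system `E` depends on them only through the replies of
the oracles. Here `σ p M t M'` is the unnormalised state of `E` in the branch where the lost values
are `p`, the adversary's queries to the tag oracles are `M`, the replies are `t`, and the query to
the oracle `h_PA(R, ·)` is `M'` (irrelevant if `u = a`). Branches may be conditioned on what the
adversary has seen, so `σ` is not subject to a normalisation. -/
def IsIdealPart {C : Params} {ι : Type} (a u b : ℕ) (ω : C.Mem → Matrix ι ι ℂ) : Prop :=
  ∃ σ : C.Lost → (Fin C.m → HashMsg C.n C.Syn) → (Fin C.m → Bits C.lCV) → PAMsg C.n →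
      Matrix ι ι ℂ,
    (∀ p M t M', IsPos (σ p M t M')) ∧
    ∀ s, ω s = ∑ z : C.Secrets, ∑ p : C.Lost, ∑ M : Fin C.m → HashMsg C.n C.Syn,
      ∑ M' : PAMsg C.n, if assemble a u b z p M' = s
        then ((Fintype.card C.Secrets : ℂ)⁻¹) • σ p M (reply a u b z M) M' else 0

/-- `ω` is a valid input state `ρ_LSE^{a u b}`. -/
def IsInput {C : Params} {ι : Type} (a u b : ℕ) (ω : C.Mem → Matrix ι ι ℂ) : Prop :=
  IsIdealPart a u b ω ∧ cqTr ω = 1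

/-- The classical result of a round: `D_C` and `F_S` (`none` for a party that is not involved) and
the labels `α`, `αᵁ`, `α'` after the round. -/
structure Outcome where
  dC : Option Bool
  fS : Option Bool
  α : ℕ
  αU : ℕ
  α' : ℕ

/-- The outcomes that occur in the ideal output state for the input labels `a`, `u`, `b`. -/
def Allowed (a u b : ℕ) (o : Outcome) : Prop :=
  match o.dC, o.fS with
  | none, some false => o.α = a ∧ o.αU = u ∧ b + 1 ≤ o.α' ∧ o.α' ≤ C.m
  | some false, none => o.α = a + 1 ∧ o.αU = a + 1 ∧ o.α' = b
  | some true, none => a ≤ o.α ∧ o.α < C.m ∧ o.αU = o.α + 1 ∧ o.α' = b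
  | some false, some false => o.α = a + 1 ∧ o.αU = a + 1 ∧ b + 1 ≤ o.α' ∧ o.α' ≤ C.m
  | some true, some false =>
      a ≤ o.α ∧ o.α < C.m ∧ o.αU = o.α + 1 ∧ b + 1 ≤ o.α' ∧ o.α' ≤ C.m
  | some true, some true => o.α = b ∧ o.αU = b ∧ o.α' = b
  | _, _ => False

/-- `Ω` is an ideal output state for the input labels `a`, `u`, `b`. -/
def IsIdealOutput {C : Params} {ι : Type} (a u b : ℕ) (Ω : Outcome × C.Mem → Matrix ι ι ℂ) :
    Prop :=
  (∀ o, C.Allowed a u b o → IsIdealPart o.α o.αU o.α' fun s => Ω (o, s)) ∧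
  (∀ o, ¬ C.Allowed a u b o → ∀ s, Ω (o, s) = 0) ∧ cqTr Ω = 1

/-! ### The honest parties -/

/-- What the client receives: `α'_r` and `T_SV,r`. -/
abbrev ToClient := Fin C.m × Bits C.lSV

/-- What the client sends, or the server receives: `D_C`, `α` and the announcement. -/
abbrev ToServer := Bool × Fin C.m × Body C.n C.lCV C.Syn

open scoped Classical in
/-- `D_C`, for a client with label `a`. -/
def clientAccepts {C : Params} (a : Fin C.m) (s : C.Mem) (r : C.ToClient) : Bool :=
  decide (a < r.1 ∨ (r.1 = a ∧ s.cTag a = r.2))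

/-- The detected rounds. -/
def detected {n : ℕ} (y : Fin n → Option (ZMod 2)) : Finset (Fin n) :=
  Finset.univ.filter fun i => (y i).isSome

/-- The size of the test set. -/
def testSize (y : Fin C.n → Option (ZMod 2)) : ℕ := ⌈C.fP₁ * (detected y).card⌉₊

/-- Restriction of a string of outcomes to a set of detected rounds. -/
def outcomesOn {n : ℕ} (y : Fin n → Option (ZMod 2)) (A : Finset (Fin n)) : A → ZMod 2 :=
  fun i => (y i).getD 0

/-- The response of a client with (aligned) label `β` and `D_C = 1`, given its outcomes `y` and the
choice of `P₁`. -/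
def clientResponse {C : Params} (β : Fin C.m) (s : C.Mem) (y : Fin C.n → Option (ZMod 2))
    (P₁ : Finset (Fin C.n)) : C.ToServer :=
  let P₂ := detected y \ P₁
  let x₁ := outcomesOn y P₁
  let x₂ := outcomesOn y P₂
  let syn := C.fsyn P₂ x₂
  (true, β, ⟨P₁, P₂, x₁, syn, C.h₁ s.Kh ⟨P₁, P₂, x₁, x₂, syn⟩ + s.mask β⟩)

/-- The client's secret update `T̃_SV,β ‖ θ̃_β = h_PA(R, x'_{P₂})`. -/
def clientUpdate {C : Params} (β : Fin C.m) (s : C.Mem) (y : Fin C.n → Option (ZMod 2))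
    (P₁ : Finset (Fin C.n)) : C.Mem :=
  let P₂ := detected y \ P₁
  let w := C.hPA s.R ⟨P₂, outcomesOn y P₂⟩
  { s with cTag := Function.update s.cTag β w.1, cSeed := Function.update s.cSeed β w.2 }

/-- The unnormalised state of the second factor after outcome `y` of the receiver measurement on
the first factor. -/
def measure {C : Params} {ι : Type} (θ : Bits C.n) (y : Fin C.n → Option (ZMod 2))
    (ρ : Matrix (C.Rcv × ι) (C.Rcv × ι) ℂ) : Matrix ι ι ℂ :=
  fun e e' => C.effect θ y fun q q' => ρ (q, e) (q', e')

open scoped Classical in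
/-- The client's action, for label `a` and memory `s`, on receiving `r` and the first factor of the
system in state `ρ`: unnormalised states of the remaining system for each response and new memory.
If `D_C = 0`, the announcement is uniformly random. -/
def clientStep {C : Params} {ι : Type} (a : Fin C.m) (s : C.Mem) (r : C.ToClient)
    (ρ : Matrix (C.Rcv × ι) (C.Rcv × ι) ℂ) (out : C.ToServer × C.Mem) : Matrix ι ι ℂ :=
  let β := max a r.1
  if clientAccepts a s r then
    ∑ y : Fin C.n → Option (ZMod 2), ∑ P₁ ∈ (detected y).powersetCard (C.testSize y),
      if (clientResponse β s y P₁, clientUpdate β s y P₁) = out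
      then (((detected y).card.choose (C.testSize y) : ℂ)⁻¹) • measure (C.g (s.cSeed β)) y ρ
      else 0
  else
    ∑ y : Fin C.n → Option (ZMod 2), ∑ w : Body C.n C.lCV C.Syn,
      if ((false, a, w), s) = out
      then ((Fintype.card (Body C.n C.lCV C.Syn) : ℂ)⁻¹) • measure (C.g (s.cSeed β)) y ρ
      else 0

/-- The client's label after the round. -/
def clientLabel {C : Params} (c : C.ToServer) : ℕ := if c.1 then c.2.1 else c.2.1 + 1

/-- The server's decoded string `x̂'_{P₂}`. -/
def decoded {C : Params} (x : Bits C.n) (w : Body C.n C.lCV C.Syn) : w.2.1 → ZMod 2 :=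
  C.fdec w.2.1 (fun i => x i) w.2.2.2.1

open scoped Classical in
/-- Parameter estimation `D_PE`. -/
def serverPE {C : Params} (x : Bits C.n) (v : Fin C.n → Fin 3) (w : Body C.n C.lCV C.Syn) : Prop :=
  w.1.card = ⌈C.fP₁ * (w.1 ∪ w.2.1).card⌉₊ ∧ C.P₁tol ≤ w.1.card ∧
  C.N₀tol ≤ C.N₀LB x v w.1 w.2.1 w.2.2.1 ∧ C.N₁tol ≤ C.N₁LB x v w.1 w.2.1 w.2.2.1 ∧
  C.e₁UB x v w.1 w.2.1 w.2.2.1 ≤ C.e₁tol ∧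
  ((Finset.univ.filter fun i : w.1 => w.2.2.1 i ≠ x i).card : ℝ) ≤ C.etol * w.1.card

/-- Client validation `D_CV`, by a server with label `b`. -/
def serverCV {C : Params} (b : Fin C.m) (s : C.Mem) (x : Bits C.n) (w : Body C.n C.lCV C.Syn) :
    Prop :=
  w.2.2.2.2 = C.h₁ s.Kh ⟨w.1, w.2.1, w.2.2.1, decoded x w, w.2.2.2.1⟩ + s.mask b

/-- The received label `α_r`, increased by one if the received `D_C` is `0`. -/
def receivedLabel {C : Params} (c : C.ToServer) : ℕ := if c.1 then c.2.1 else c.2.1 + 1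

open scoped Classical in
/-- `F_S = D_PE ∧ D_CV ∧ D_SA`, where `D_SA = 1` means that the received label is not ahead. -/
def serverAccepts {C : Params} (b : Fin C.m) (s : C.Mem) (x : Bits C.n) (v : Fin C.n → Fin 3)
    (c : C.ToServer) : Bool :=
  decide (serverPE x v c.2.2 ∧ serverCV b s x c.2.2 ∧ receivedLabel c ≤ b)

/-- The server's label after the round. -/
def serverLabel {C : Params} (b : Fin C.m) (f : Bool) (c : C.ToServer) : ℕ :=
  if f then b else (if receivedLabel c ≤ b then (b : ℕ) else receivedLabel c - 1) + 1

/-- The server's secret update `T_SV,b ‖ θ̃'_b = h_PA(R, x̂'_{P₂})` if `F_S = 1`. -/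
def serverUpdate {C : Params} (b : Fin C.m) (f : Bool) (s : C.Mem) (x : Bits C.n)
    (c : C.ToServer) : C.Mem :=
  let w := C.hPA s.R ⟨c.2.2.2.1, decoded x c.2.2⟩
  if f then
    { s with sTag := Function.update s.sTag b w.1, sSeed := Function.update s.sSeed b w.2 }
  else s

/-- The index `αᵁ` after the round, from its old value `u`, the label `α'_r` received by the client
(if involved), `D_C` with the client's new label, and `F_S`. -/
def newU {C : Params} (u : ℕ) (cl : Option (C.ToClient × C.ToServer)) (f : Option Bool) : ℕ :=
  match cl with
  | none => u
  | some (r, c) =>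
    if c.1 then max u r.1 + (if f = some true then 0 else 1) else max u (clientLabel c)

/-! ### One round with an adversary -/

/-- An adversarial strategy, for an adversary whose system initially is `ℓ²(ι)`. Each stage is a
quantum instrument.
* `start true` / `start false`: the adversary decides whether or not the server takes part.
* If it does, the adversary gets the server's tag and signals, and either leaves the client out
  (`skip`), or sends it a message and a system (`call`).
* If it does not, the adversary sends the client a message and a system (`solo`).
* After the client's response (if any), it sends a message to the server (`final`), or, if the
  server does not take part, keeps the response (`finish`). -/
structure Strategy (ι : Type) where
  E₀ : Type
  E₁ : Type
  E₂ : Type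
  start : Bool → Op ι E₀
  skip : Bits C.lSV → Op (C.Sig × E₀) E₁
  call : Bits C.lSV → C.ToClient → Op (C.Sig × E₀) (C.Rcv × E₁)
  solo : C.ToClient → Op E₀ (C.Rcv × E₁)
  final : Option C.ToServer → C.ToServer → Op E₁ E₂
  finish : C.ToServer → Op E₁ E₂
  start_cp : ∀ d, IsCP (start d)
  skip_cp : ∀ t, IsCP (skip t)
  call_cp : ∀ t r, IsCP (call t r)
  solo_cp : ∀ r, IsCP (solo r)
  final_cp : ∀ c d, IsCP (final c d)
  finish_cp : ∀ c, IsCP (finish c)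
  start_tr : ∀ ρ, IsPos ρ → ∑ d, tr (start d ρ) = tr ρ
  react_tr : ∀ t ρ, IsPos ρ → tr (skip t ρ) + ∑ r, tr (call t r ρ) = tr ρ
  solo_tr : ∀ ρ, IsPos ρ → ∑ r, tr (solo r ρ) = tr ρ
  final_tr : ∀ c ρ, IsPos ρ → ∑ d, tr (final c d ρ) = tr ρ
  finish_tr : ∀ c ρ, IsPos ρ → tr (finish c ρ) = tr ρ

open scoped Classical in
/-- The operator `ρ`, recorded under the classical value `val`. -/
def record {X ι : Type} (val : X) (ρ : Matrix ι ι ℂ) : X → Matrix ι ι ℂ :=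
  fun x => if val = x then ρ else 0

/-- The classical result of a round: the outcome, and the memory after discarding. Here `cl` holds
what the client received and sent (if involved), and `sv` the server's decision and new label. -/
def result {C : Params} (a : Fin C.m) (u : ℕ) (b : Fin C.m) (cl : Option (C.ToClient × C.ToServer))
    (sv : Option (Bool × ℕ)) (s : C.Mem) : Outcome × C.Mem :=
  let α : ℕ := (cl.map fun p => clientLabel p.2).getD a
  let α' : ℕ := (sv.map fun p => p.2).getD b
  ({ dC := cl.map fun p => p.2.1
     fS := sv.map fun p => p.1
     α := α
     αU := newU u cl (sv.map fun p => p.1)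
     α' := α' }, s.discard α α')

/-- The final step of a server with random choices `x`, `v` that receives `d`, recorded together
with all classical results. -/
def serverStep {C : Params} {ι : Type} (a : Fin C.m) (u : ℕ) (b : Fin C.m)
    (cl : Option (C.ToClient × C.ToServer)) (s : C.Mem) (x : Bits C.n) (v : Fin C.n → Fin 3)
    (d : C.ToServer) (ρ : Matrix ι ι ℂ) : Outcome × C.Mem → Matrix ι ι ℂ :=
  let f := serverAccepts b s x v d
  record (result a u b cl (some (f, serverLabel b f d)) (serverUpdate b f s x d)) ρ

/-- The part of the output of a round in which the server takes part. -/
def serverRun {C : Params} {ι : Type} (a : Fin C.m) (u : ℕ) (b : Fin C.m) (A : C.Strategy ι)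
    (ω : C.Mem → Matrix ι ι ℂ) : Outcome × C.Mem → Matrix A.E₂ A.E₂ ℂ :=
  ∑ s : C.Mem, ∑ x : Bits C.n, ∑ v : Fin C.n → Fin 3,
    (((∏ i, C.pv (v i)) / 2 ^ C.n : ℝ) : ℂ) •
      (let ρ : Matrix (C.Sig × A.E₀) (C.Sig × A.E₀) ℂ :=
        C.source (C.g (s.sSeed b)) x v ⊗ₖ A.start true (ω s)
      (∑ d : C.ToServer,
          serverStep a u b none s x v d (A.final none d (A.skip (s.sTag b) ρ))) +
        ∑ r : C.ToClient, ∑ c : C.ToServer, ∑ s₁ : C.Mem, ∑ d : C.ToServer,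
          serverStep a u b (some (r, c)) s₁ x v d
            (A.final (some c) d (clientStep a s r (A.call (s.sTag b) r ρ) (c, s₁))))

/-- The part of the output of a round in which only the client takes part. -/
def clientRun {C : Params} {ι : Type} (a : Fin C.m) (u : ℕ) (b : Fin C.m) (A : C.Strategy ι)
    (ω : C.Mem → Matrix ι ι ℂ) : Outcome × C.Mem → Matrix A.E₂ A.E₂ ℂ :=
  ∑ s : C.Mem, ∑ r : C.ToClient, ∑ c : C.ToServer, ∑ s₁ : C.Mem,
    record (result a u b (some (r, c)) none s₁)
      (A.finish c (clientStep a s r (A.solo r (A.start false (ω s))) (c, s₁)))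

/-- The output state of one round of the protocol, run with labels `α = a`, `αᵁ = u`, `α' = b` and
initial state `ω`, under the adversarial strategy `A`. -/
def round {C : Params} {ι : Type} (a : Fin C.m) (u : ℕ) (b : Fin C.m) (A : C.Strategy ι)
    (ω : C.Mem → Matrix ι ι ℂ) : Outcome × C.Mem → Matrix A.E₂ A.E₂ ℂ :=
  serverRun a u b A ω + clientRun a u b A ω

/-- For all valid inputs `ρ_LSE^{a u b}` and all adversarial strategies, the output state of a round
is `ε`-close to an ideal output state. -/
def SecureFor (a : Fin C.m) (u : ℕ) (b : Fin C.m) (ε : ℝ) : Prop :=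
  ∀ (ι : Type) (ω : C.Mem → Matrix ι ι ℂ), IsInput a u b ω → ∀ A : C.Strategy ι,
    ∃ Ω : Outcome × C.Mem → Matrix A.E₂ A.E₂ ℂ,
      IsIdealOutput a u b Ω ∧ traceDist (round a u b A ω) Ω ≤ ENNReal.ofReal ε

end Params

end ClientAuth

end

/-!
Write `a` for the client's label, `a' = a + 1`, and `b` for the server's label. A client with label
`a` whose pair `T̃ₐ ‖ θ̃ₐ` is still secret (`αᵁ = a + 1`) is compared with a client with label `a'`,
for which security is assumed.

*The simulation.* If the client receives a label greater than `a`, it aligns its own label, so that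
it acts exactly as a client with label `a'` does. Hence an adversary against the label `a` can be
run against a client with label `a'` whose check value `T̃ₐ'` is `0`: a received label `a'` gets the
tag `0`, and in the response of a client that rejects, the label `a'` is replaced by `a`
(`simulate`, `advance`). The parts of the two rounds in which the client receives a label greater
than `a` agree (`indicator_round_simulate`), and for them the ideal output of the simulated round
can be used.

*The rest.* A received label at most `a` is rejected unless it comes with the check value `T̃ₐ`,
which is uniform and unknown to the adversary: this has probability at most `2^(-l_SV)`
(`sum_callMass_le`). Exchange this event with a rejection. What is left is ideal as soon as the
server rejects: then the labels only grow, and the adversary only learns seeds and forgets replies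
that do not matter any more (`isIdealPart_coarsen`, `isIdealFamily_quietSum`). The server accepts
either a forged tag, with probability at most `2^(-l_CV) + ε_MAC` (`quietMass_forge_le`), or a
replay, that is, the reply of the tag oracle with index `b` to the adversary's own query.

*Replays.* They need not be rare, but the same replay is accepted in the simulated round, where the
client does not accept either (`sum_acceptMass_le`). There, the ideal output does not contain this
outcome, so its probability is already a part of the assumed distance. Therefore it may be dropped
from the ideal output of the given round without increasing the distance, provided that the loss of
trace is balanced against the gain or loss where the client accepts; this is
`exists_traceDist_le_of_simulation`. Whether a replay occurs is seen by the adversary, so that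
conditioning on its absence leaves an ideal state.

The result is security with `ε_sec + 2^(-l_SV) + 2^(-l_CV) + ε_MAC` (`secureFor_of_succ`).

All states are written as ensembles over classical data, with a positive operator of the adversary
for each value. A round is a sum of linear maps applied to these operators (`round_ensemble`), and
probabilities are the traces of the corresponding parts (`HasMass`).
-/

open scoped ComplexOrder ENNReal Kronecker

noncomputable section

namespace ClientAuth

section Quantum

variable {ι κ X Y : Type}

/-! ### Positive semidefinite matrices over an arbitrary index type -/

theorem sum_nonneg_of_posSemidef {ρ : Matrix ι ι ℂ} (h : ρ.PosSemidef) (s : Finset ι) (x : ι → ℂ) :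
    0 ≤ ∑ i ∈ s, ∑ j ∈ s, star (x i) * ρ i j * x j := by
  have h1 := (h.submatrix (fun i : s => (i : ι))).dotProduct_mulVec_nonneg (fun i => x i)
  simp only [dotProduct, Matrix.mulVec, Matrix.submatrix_apply, Pi.star_apply, Finset.mul_sum] at h1
  rw [← Finset.sum_coe_sort]
  simp_rw [← Finset.sum_coe_sort s (fun j => star (x _) * ρ _ j * x j)]
  simpa only [mul_assoc] using h1

theorem posSemidef_of_sum_nonneg {ρ : Matrix ι ι ℂ} (hρ : ρ.IsHermitian)
    (h : ∀ (s : Finset ι) (x : ι → ℂ), 0 ≤ ∑ i ∈ s, ∑ j ∈ s, star (x i) * ρ i j * x j) :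
    ρ.PosSemidef :=
  ⟨hρ, fun x => h x.support x⟩

theorem posSemidef_re_nonneg {ρ : Matrix ι ι ℂ} (h : ρ.PosSemidef) (i : ι) : 0 ≤ (ρ i i).re :=
  (Complex.le_def.1 h.diag_nonneg).1

theorem posSemidef_diag_eq {ρ : Matrix ι ι ℂ} (h : ρ.PosSemidef) (i : ι) :
    ρ i i = ((ρ i i).re : ℂ) :=
  Complex.ext rfl ((Complex.le_def.1 h.diag_nonneg).2.symm)

theorem norm_apply_le_of_posSemidef {ρ : Matrix ι ι ℂ} (h : ρ.PosSemidef) (i j : ι) :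
    ‖ρ i j‖ ≤ (ρ i i).re + (ρ j j).re := by
  classical
  have hi := posSemidef_re_nonneg h i
  have hj := posSemidef_re_nonneg h j
  by_cases hij : i = j
  · subst hij
    rw [posSemidef_diag_eq h i, Complex.norm_real, Real.norm_of_nonneg hi]
    simpa using hi
  by_cases h0 : ρ i j = 0
  · simp [h0]; linarith
  set c : ℂ := -(star (ρ i j)) / ‖ρ i j‖ with hc
  have hn : (‖ρ i j‖ : ℂ) ≠ 0 := by simpa using h0
  have hcc : star c * c = 1 := by
    have : star (‖ρ i j‖ : ℂ) = ‖ρ i j‖ := Complex.conj_ofReal _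
    rw [hc, star_div₀, star_neg, star_star, this]
    field_simp
    rw [RCLike.star_def, Complex.mul_conj, Complex.normSq_eq_norm_sq]; push_cast; ring
  have hcr : ρ i j * c = -‖ρ i j‖ := by
    rw [hc]
    simp only [RCLike.star_def]
    field_simp
    rw [Complex.mul_conj, Complex.normSq_eq_norm_sq]; push_cast; ring
  have hji : ρ j i = star (ρ i j) := (h.1.apply j i).symm
  have hcr' : star c * ρ j i = -‖ρ i j‖ := by
    rw [hji, ← star_mul, hcr]; simp
  have h1 := sum_nonneg_of_posSemidef h {i, j} (fun k => if k = i then 1 else c)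
  rw [Finset.sum_pair hij, Finset.sum_pair hij, Finset.sum_pair hij] at h1
  simp only [if_true, if_neg (Ne.symm hij), star_one, one_mul, mul_one] at h1
  rw [hcr, hcr', show star c * ρ j j * c = ρ j j * (star c * c) by ring, hcc] at h1
  have := (Complex.le_def.1 h1).1
  simp at this
  linarith [norm_nonneg (ρ i j)]

/-! ### Traces of positive operators -/

@[simp] theorem tr_zero : tr (0 : Matrix ι ι ℂ) = 0 := by simp [tr]

theorem tr_add {ρ σ : Matrix ι ι ℂ} (hρ : ρ.PosSemidef) (hσ : σ.PosSemidef) :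
    tr (ρ + σ) = tr ρ + tr σ := by
  simp only [tr, Matrix.add_apply, Complex.add_re]
  rw [← ENNReal.tsum_add]
  exact tsum_congr fun i =>
    ENNReal.ofReal_add (posSemidef_re_nonneg hρ i) (posSemidef_re_nonneg hσ i)

theorem tr_smul {c : ℝ} (hc : 0 ≤ c) (ρ : Matrix ι ι ℂ) :
    tr ((c : ℂ) • ρ) = ENNReal.ofReal c * tr ρ := by
  simp only [tr, Matrix.smul_apply, smul_eq_mul, Complex.re_ofReal_mul]
  rw [← ENNReal.tsum_mul_left]
  exact tsum_congr fun i => ENNReal.ofReal_mul hc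

theorem tr_sum {A : Type*} (s : Finset A) {ρ : A → Matrix ι ι ℂ} (h : ∀ a ∈ s, (ρ a).PosSemidef) :
    tr (∑ a ∈ s, ρ a) = ∑ a ∈ s, tr (ρ a) := by
  classical
  induction s using Finset.induction_on with
  | empty => simp
  | insert a s ha ih =>
    rw [Finset.sum_insert ha, Finset.sum_insert ha, tr_add (h a (by simp))
      (Matrix.posSemidef_sum _ fun b hb => h b (by simp [hb])), ih fun b hb => h b (by simp [hb])]

theorem posSemidef_smul {c : ℝ} (hc : 0 ≤ c) {ρ : Matrix ι ι ℂ} (h : ρ.PosSemidef) :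
    ((c : ℂ) • ρ).PosSemidef := h.smul (by simpa using hc)

theorem isPos_zero : IsPos (0 : Matrix ι ι ℂ) := ⟨Matrix.PosSemidef.zero, by simp⟩

theorem IsPos.add {ρ σ : Matrix ι ι ℂ} (hρ : IsPos ρ) (hσ : IsPos σ) : IsPos (ρ + σ) :=
  ⟨hρ.1.add hσ.1, by rw [tr_add hρ.1 hσ.1]; exact ENNReal.add_ne_top.2 ⟨hρ.2, hσ.2⟩⟩

theorem IsPos.smul {c : ℝ} (hc : 0 ≤ c) {ρ : Matrix ι ι ℂ} (h : IsPos ρ) : IsPos ((c : ℂ) • ρ) :=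
  ⟨posSemidef_smul hc h.1, by
    rw [tr_smul hc]; exact ENNReal.mul_ne_top ENNReal.ofReal_ne_top h.2⟩

theorem isPos_sum {A : Type*} (s : Finset A) {ρ : A → Matrix ι ι ℂ} (h : ∀ a ∈ s, IsPos (ρ a)) :
    IsPos (∑ a ∈ s, ρ a) :=
  ⟨Matrix.posSemidef_sum _ fun a ha => (h a ha).1, by
    rw [tr_sum s fun a ha => (h a ha).1]
    exact ENNReal.sum_ne_top.2 fun a ha => (h a ha).2⟩

theorem IsState.isPos {ρ : Matrix ι ι ℂ} (h : IsState ρ) : IsPos ρ := ⟨h.1, by simp [h.2]⟩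

/-- A completely positive map is positive: this is the case of a one-dimensional ancilla. -/
theorem IsCP.isPos {L : Op ι κ} (hL : IsCP L) {ρ : Matrix ι ι ℂ} (h : IsPos ρ) : IsPos (L ρ) := by
  have h1 : IsPos (ρ.submatrix (Prod.snd : Fin 1 × ι → ι) Prod.snd) := by
    refine ⟨h.1.submatrix _, ?_⟩
    have : tr (ρ.submatrix (Prod.snd : Fin 1 × ι → ι) Prod.snd) = tr ρ :=
      (Equiv.uniqueProd ι (Fin 1)).tsum_eq fun i => ENNReal.ofReal (ρ i i).re
    rw [this]; exact h.2
  have h2 := hL 1 _ h1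
  have h3 : L ρ = (amplify 1 L (ρ.submatrix (Prod.snd : Fin 1 × ι → ι) Prod.snd)).submatrix
      (fun i => ((0 : Fin 1), i)) (fun i => (0, i)) := rfl
  rw [h3]
  refine ⟨h2.1.submatrix _, ?_⟩
  have : tr ((amplify 1 L (ρ.submatrix (Prod.snd : Fin 1 × ι → ι) Prod.snd)).submatrix
      (fun i => ((0 : Fin 1), i)) (fun i => (0, i))) =
      tr (amplify 1 L (ρ.submatrix (Prod.snd : Fin 1 × ι → ι) Prod.snd)) :=
    (Equiv.uniqueProd κ (Fin 1)).symm.tsum_eq fun i => ENNReal.ofReal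
      (amplify 1 L (ρ.submatrix (Prod.snd : Fin 1 × ι → ι) Prod.snd) i i).re
  rw [this]; exact h2.2

theorem isCP_sum {A : Type*} (s : Finset A) {L : A → Op ι κ} (h : ∀ a ∈ s, IsCP (L a)) :
    IsCP (∑ a ∈ s, L a) := by
  intro k ρ hρ
  have : amplify k (∑ a ∈ s, L a) ρ = ∑ a ∈ s, amplify k (L a) ρ := by
    ext i j
    rw [Matrix.sum_apply]
    exact (congrArg (fun T : Matrix κ κ ℂ => T i.2 j.2) (LinearMap.sum_apply s L _)).trans
      (Matrix.sum_apply _ _ _ _)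
  rw [this]
  exact isPos_sum s fun a ha => h a ha k ρ hρ

open Matrix in
theorem posSemidef_kronecker {ρ : Matrix ι ι ℂ} {σ : Matrix κ κ ℂ} (hρ : ρ.PosSemidef)
    (hσ : σ.PosSemidef) : (ρ ⊗ₖ σ).PosSemidef := by
  classical
  refine posSemidef_of_sum_nonneg ?_ fun s x => ?_
  · rw [Matrix.IsHermitian, Matrix.conjTranspose_kronecker, hρ.1.eq, hσ.1.eq]
  · have h1 := (hρ.submatrix (fun i : s.image Prod.fst => (i : ι))).kronecker
      (hσ.submatrix (fun i : s.image Prod.snd => (i : κ)))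
    have h2 := h1.submatrix (fun a : s => ((⟨a.1.1, Finset.mem_image_of_mem _ a.2⟩ :
      s.image Prod.fst), (⟨a.1.2, Finset.mem_image_of_mem _ a.2⟩ : s.image Prod.snd)))
    have h3 := h2.dotProduct_mulVec_nonneg (fun i => x i)
    simp only [dotProduct, Matrix.mulVec, Matrix.submatrix_apply, Pi.star_apply, Finset.mul_sum,
      Matrix.kroneckerMap_apply] at h3
    rw [← Finset.sum_coe_sort]
    simp_rw [← Finset.sum_coe_sort s (fun j => star (x _) * (ρ ⊗ₖ σ) _ j * x j)]
    simpa only [mul_assoc, Matrix.kroneckerMap_apply] using h3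

theorem tr_kronecker {ρ : Matrix ι ι ℂ} {σ : Matrix κ κ ℂ} (hρ : ρ.PosSemidef)
    (hσ : σ.PosSemidef) : tr (ρ ⊗ₖ σ) = tr ρ * tr σ := by
  simp only [tr, Matrix.kroneckerMap_apply]
  rw [ENNReal.tsum_prod (f := fun i j => ENNReal.ofReal (ρ i i * σ j j).re),
    ← ENNReal.tsum_mul_right]
  refine tsum_congr fun i => ?_
  rw [← ENNReal.tsum_mul_left]
  refine tsum_congr fun j => ?_
  rw [← ENNReal.ofReal_mul (posSemidef_re_nonneg hρ i), posSemidef_diag_eq hρ i,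
    posSemidef_diag_eq hσ j, ← Complex.ofReal_mul]
  simp

theorem isPos_kronecker {ρ : Matrix ι ι ℂ} {σ : Matrix κ κ ℂ} (hρ : IsPos ρ)
    (hσ : IsPos σ) : IsPos (ρ ⊗ₖ σ) :=
  ⟨posSemidef_kronecker hρ.1 hσ.1, by
    rw [tr_kronecker hρ.1 hσ.1]; exact ENNReal.mul_ne_top hρ.2 hσ.2⟩

/-! ### Slices of an operator on a bipartite system -/

/-- The block `⟨e| ρ |e'⟩` of an operator, with respect to the standard basis of the second
factor. -/
def block (ρ : Matrix (ι × κ) (ι × κ) ℂ) (e e' : κ) : Matrix ι ι ℂ :=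
  ρ.submatrix (fun q => (q, e)) fun q => (q, e')

/-- The operator `⟨x| ρ |x⟩` on the first factor, for the vector `x` on the second factor,
restricted to the finite index set `s`. -/
def slice (s : Finset κ) (x : κ → ℂ) (ρ : Matrix (ι × κ) (ι × κ) ℂ) : Matrix ι ι ℂ :=
  ∑ e ∈ s, ∑ e' ∈ s, (star (x e) * x e') • block ρ e e'

theorem slice_apply (s : Finset κ) (x : κ → ℂ) (ρ : Matrix (ι × κ) (ι × κ) ℂ) (q q' : ι) :
    slice s x ρ q q' = ∑ e ∈ s, ∑ e' ∈ s, star (x e) * x e' * ρ (q, e) (q', e') := by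
  simp only [slice, Matrix.sum_apply, Matrix.smul_apply, smul_eq_mul]
  rfl

theorem posSemidef_slice (s : Finset κ) (x : κ → ℂ) {ρ : Matrix (ι × κ) (ι × κ) ℂ}
    (h : ρ.PosSemidef) : (slice s x ρ).PosSemidef := by
  refine posSemidef_of_sum_nonneg ?_ fun t v => ?_
  · ext q q'
    rw [Matrix.conjTranspose_apply, slice_apply, slice_apply, star_sum, Finset.sum_comm]
    refine Finset.sum_congr rfl fun e _ => ?_
    rw [star_sum]
    refine Finset.sum_congr rfl fun e' _ => ?_
    rw [star_mul, star_mul, star_star, h.1.apply]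
    ring
  · have h1 := sum_nonneg_of_posSemidef h (t ×ˢ s) (fun p => v p.1 * x p.2)
    simp only [Finset.sum_product] at h1
    convert h1 using 1
    refine Finset.sum_congr rfl fun q _ => ?_
    rw [Finset.sum_comm]
    refine Finset.sum_congr rfl fun q' _ => ?_
    rw [slice_apply, Finset.mul_sum, Finset.sum_mul]
    refine Finset.sum_congr rfl fun e _ => ?_
    rw [Finset.mul_sum, Finset.sum_mul]
    refine Finset.sum_congr rfl fun e' _ => ?_
    rw [star_mul]; ring

theorem tr_eq_tsum_block (ρ : Matrix (ι × κ) (ι × κ) ℂ) :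
    tr ρ = ∑' e, tr (block ρ e e) := by
  simp only [tr]
  rw [ENNReal.tsum_prod (f := fun i e => ENNReal.ofReal (ρ (i, e) (i, e)).re), ENNReal.tsum_comm]
  rfl

theorem isPos_block {ρ : Matrix (ι × κ) (ι × κ) ℂ} (h : IsPos ρ) (e : κ) :
    IsPos (block ρ e e) :=
  ⟨h.1.submatrix fun q => (q, e), ne_top_of_le_ne_top h.2 (by
    rw [tr_eq_tsum_block]
    exact ENNReal.le_tsum (f := fun e => tr (block ρ e e)) e)⟩

theorem isPos_slice (s : Finset κ) (x : κ → ℂ) {ρ : Matrix (ι × κ) (ι × κ) ℂ} (h : IsPos ρ) :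
    IsPos (slice s x ρ) := by
  refine ⟨posSemidef_slice s x h.1, ?_⟩
  have hle : tr (slice s x ρ) ≤ ∑ e ∈ s, ∑ e' ∈ s, ENNReal.ofReal (‖x e‖ * ‖x e'‖) *
      (tr (block ρ e e) + tr (block ρ e' e')) := by
    simp only [tr, ← ENNReal.tsum_add, ← ENNReal.tsum_mul_left]
    simp only [← Summable.tsum_finsetSum fun _ _ => ENNReal.summable]
    refine ENNReal.tsum_le_tsum fun q => ?_
    have : (slice s x ρ q q).re ≤ ∑ e ∈ s, ∑ e' ∈ s,
        ‖x e‖ * ‖x e'‖ * ((ρ (q, e) (q, e)).re + (ρ (q, e') (q, e')).re) := by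
      rw [slice_apply, Complex.re_sum]
      refine Finset.sum_le_sum fun e _ => ?_
      rw [Complex.re_sum]
      refine Finset.sum_le_sum fun e' _ => (Complex.re_le_norm _).trans ?_
      rw [norm_mul, norm_mul, norm_star]
      exact mul_le_mul_of_nonneg_left (norm_apply_le_of_posSemidef h.1 _ _) (by positivity)
    have hnn := fun e => posSemidef_re_nonneg h.1 (q, e)
    refine (ENNReal.ofReal_le_ofReal this).trans (le_of_eq ?_)
    rw [ENNReal.ofReal_sum_of_nonneg fun e _ => Finset.sum_nonneg fun e' _ =>
      mul_nonneg (by positivity) (add_nonneg (hnn e) (hnn e'))]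
    refine Finset.sum_congr rfl fun e _ => ?_
    rw [ENNReal.ofReal_sum_of_nonneg fun e' _ =>
      mul_nonneg (by positivity) (add_nonneg (hnn e) (hnn e'))]
    refine Finset.sum_congr rfl fun e' _ => ?_
    rw [ENNReal.ofReal_mul (by positivity), ENNReal.ofReal_add (hnn e) (hnn e')]
    rfl
  refine ne_top_of_le_ne_top ?_ hle
  exact ENNReal.sum_ne_top.2 fun e _ => ENNReal.sum_ne_top.2 fun e' _ =>
    ENNReal.mul_ne_top ENNReal.ofReal_ne_top
      (ENNReal.add_ne_top.2 ⟨(isPos_block h e).2, (isPos_block h e').2⟩)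

/-- A linear functional that vanishes on positive trace-class operators vanishes on the blocks of
such operators (by polarization). -/
theorem map_block_eq_zero {D : Matrix ι ι ℂ →ₗ[ℂ] ℂ} (hD : ∀ ρ, IsPos ρ → D ρ = 0)
    {ρ : Matrix (ι × κ) (ι × κ) ℂ} (h : IsPos ρ) (e e' : κ) :
    D (block ρ e e') = 0 := by
  classical
  by_cases he : e = e'
  · subst he; exact hD _ (isPos_block h e)
  have key : ∀ c : ℂ, c * D (block ρ e e') +
      star c * D (block ρ e' e) = 0 := by
    intro c
    have h1 := hD _ (isPos_slice {e, e'} (fun k => if k = e then 1 else c) h)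
    rw [slice, Finset.sum_pair he, Finset.sum_pair he, Finset.sum_pair he] at h1
    simp only [if_true, if_neg (Ne.symm he), star_one, one_mul, mul_one, map_add, map_smul,
      smul_eq_mul, hD _ (isPos_block h e), hD _ (isPos_block h e')] at h1
    simpa using h1
  have k1 := key 1
  have k2 := key Complex.I
  simp only [star_one, one_mul, RCLike.star_def, Complex.conj_I] at k1 k2
  have k3 : Complex.I * (2 * D (block ρ e e')) = 0 := by
    linear_combination k2 + Complex.I * k1
  simpa using k3

end Quantum

section ClassicalQuantum

variable {ι κ X Y : Type}

/-! ### Classical-quantum operators -/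

/-- The family `Ω` is a positive classical-quantum operator of trace `t`. -/
def HasMass (Ω : X → Matrix ι ι ℂ) (t : ℝ≥0∞) : Prop := (∀ x, (Ω x).PosSemidef) ∧ cqTr Ω = t

theorem hasMass_cqTr {Ω : X → Matrix ι ι ℂ} (h : ∀ x, (Ω x).PosSemidef) : HasMass Ω (cqTr Ω) :=
  ⟨h, rfl⟩

theorem HasMass.congr {Ω : X → Matrix ι ι ℂ} {t t' : ℝ≥0∞} (h : HasMass Ω t) (ht : t = t') :
    HasMass Ω t' := ht ▸ h

theorem hasMass_zero : HasMass (0 : X → Matrix ι ι ℂ) 0 :=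
  ⟨fun _ => Matrix.PosSemidef.zero, by simp [cqTr]⟩

theorem HasMass.add {Ω Ω' : X → Matrix ι ι ℂ} {t t' : ℝ≥0∞} (h : HasMass Ω t)
    (h' : HasMass Ω' t') : HasMass (Ω + Ω') (t + t') := by
  refine ⟨fun x => (h.1 x).add (h'.1 x), ?_⟩
  rw [← h.2, ← h'.2, cqTr, cqTr, cqTr, ← ENNReal.tsum_add]
  exact tsum_congr fun x => tr_add (h.1 x) (h'.1 x)

theorem HasMass.smul {Ω : X → Matrix ι ι ℂ} {t : ℝ≥0∞} (h : HasMass Ω t) {c : ℝ} (hc : 0 ≤ c) :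
    HasMass ((c : ℂ) • Ω) (ENNReal.ofReal c * t) := by
  refine ⟨fun x => posSemidef_smul hc (h.1 x), ?_⟩
  rw [← h.2, cqTr, cqTr, ← ENNReal.tsum_mul_left]
  exact tsum_congr fun x => tr_smul hc _

theorem hasMass_sum {A : Type*} (s : Finset A) {Ω : A → X → Matrix ι ι ℂ} {t : A → ℝ≥0∞}
    (h : ∀ a ∈ s, HasMass (Ω a) (t a)) : HasMass (∑ a ∈ s, Ω a) (∑ a ∈ s, t a) := by
  classical
  induction s using Finset.induction_on with
  | empty => simpa using hasMass_zero
  | insert a s ha ih =>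
    rw [Finset.sum_insert ha, Finset.sum_insert ha]
    exact (h a (by simp)).add (ih fun b hb => h b (by simp [hb]))

open Params in
theorem hasMass_record (val : X) {ρ : Matrix ι ι ℂ} (h : ρ.PosSemidef) :
    HasMass (record val ρ) (tr ρ) := by
  classical
  refine ⟨fun x => ?_, ?_⟩
  · unfold record; split_ifs
    · exact h
    · exact Matrix.PosSemidef.zero
  · rw [cqTr, tsum_eq_single val]
    · simp [record]
    · intro x hx
      simp [record, Ne.symm hx]

theorem HasMass.indicator {Ω : X → Matrix ι ι ℂ} {t : ℝ≥0∞} (h : HasMass Ω t) (S : Set X) :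
    HasMass (S.indicator Ω) (cqTr (S.indicator Ω)) := by
  classical
  refine hasMass_cqTr fun x => ?_
  rw [Set.indicator_apply]; split_ifs
  · exact h.1 x
  · exact Matrix.PosSemidef.zero

theorem HasMass.indicator_add_compl {Ω : X → Matrix ι ι ℂ} {t : ℝ≥0∞} (h : HasMass Ω t)
    (S : Set X) : cqTr (S.indicator Ω) + cqTr (Sᶜ.indicator Ω) = t := by
  rw [← ((h.indicator S).add (h.indicator Sᶜ)).2, Set.indicator_self_add_compl, h.2]

theorem cqTr_indicator_mono (Ω : X → Matrix ι ι ℂ) {S T : Set X} (h : S ⊆ T) :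
    cqTr (S.indicator Ω) ≤ cqTr (T.indicator Ω) := by
  classical
  refine ENNReal.tsum_le_tsum fun x => ?_
  by_cases hx : x ∈ S
  · rw [Set.indicator_of_mem hx, Set.indicator_of_mem (h hx)]
  · rw [Set.indicator_of_notMem hx, tr_zero]; exact zero_le

theorem cqTr_eq_of_add_eq {A B A' B' : X → Matrix ι ι ℂ} {a b a' b' : ℝ≥0∞} (h : A + B = A' + B')
    (hA : HasMass A a) (hB : HasMass B b) (hA' : HasMass A' a') (hB' : HasMass B' b') :
    a + b = a' + b' := by
  rw [← (hA.add hB).2, ← (hA'.add hB').2, h]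

/-! ### Trace distance -/

theorem traceDist_le {Ω Ω' P N : X → Matrix ι ι ℂ} {p n : ℝ≥0∞} (hP : HasMass P p)
    (hN : HasMass N n) (h : Ω + N = Ω' + P) : traceDist Ω Ω' ≤ (p + n) / 2 := by
  unfold traceDist
  refine ENNReal.div_le_div_right ?_ 2
  refine iInf_le_of_le P (iInf_le_of_le N (iInf_le_of_le hP.1 (iInf_le_of_le hN.1
    (iInf_le_of_le (fun x => ?_) (by rw [hP.2, hN.2])))))
  rw [sub_eq_sub_iff_add_eq_add, add_comm (P x)]
  exact congrFun h x

theorem exists_of_traceDist_le {Ω Ω' : X → Matrix ι ι ℂ} {ε η : ℝ} (hε : 0 ≤ ε) (hη : 0 < η)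
    (h : traceDist Ω Ω' ≤ ENNReal.ofReal ε) : ∃ P N : X → Matrix ι ι ℂ,
      (∀ x, (P x).PosSemidef) ∧ (∀ x, (N x).PosSemidef) ∧ Ω + N = Ω' + P ∧
      cqTr P + cqTr N ≤ ENNReal.ofReal (2 * ε + η) := by
  unfold traceDist at h
  have h2 : (⨅ (P : X → Matrix ι ι ℂ) (N : X → Matrix ι ι ℂ) (_ : ∀ x, (P x).PosSemidef)
    (_ : ∀ x, (N x).PosSemidef) (_ : ∀ x, Ω x - Ω' x = P x - N x), (cqTr P + cqTr N)) <
      ENNReal.ofReal (2 * ε + η) := by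
    have h3 := (ENNReal.div_le_iff (by norm_num) (by norm_num)).1 h
    refine h3.trans_lt ?_
    rw [← ENNReal.ofReal_ofNat 2, ← ENNReal.ofReal_mul hε]
    exact (ENNReal.ofReal_lt_ofReal_iff (by linarith)).2 (by linarith)
  simp only [iInf_lt_iff] at h2
  obtain ⟨P, N, hP, hN, he, hlt⟩ := h2
  refine ⟨P, N, hP, hN, funext fun x => ?_, hlt.le⟩
  have := he x
  rw [sub_eq_sub_iff_add_eq_add] at this
  rw [Pi.add_apply, Pi.add_apply, this, add_comm]

/-- Let `Γ'` be close to `Ω'`, where `Γ'` agrees on `S₁` with `W`, and `Ω'` vanishes on a set `S₂`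
outside `S₁` on which `Γ'` has mass at least `e`. If `Γ` differs from `W + R` by a positive
operator `E` of mass `e` and by an exchange of operators `D₁`, `D₂` of mass `p`, then `Γ` is close
to an operator of trace one that agrees with `Ω'` on `S₁` and is a combination of `R` and `R₀`
elsewhere. The mass `e` is not counted again, because it is already part of the distance of
`Γ'` and `Ω'`. -/
theorem exists_traceDist_le_of_simulation {S₁ S₂ : Set X} (hS : Disjoint S₁ S₂)
    {Γ Γ' Ω' W D₁ D₂ E R R₀ : X → Matrix ι ι ℂ} {ε : ℝ} {p e r : ℝ≥0∞} (hε : 0 ≤ ε)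
    (hΓ : HasMass Γ 1) (hΓ' : HasMass Γ' 1) (hΩ' : HasMass Ω' 1)
    (hW : S₁.indicator Γ' = W) (he : e ≤ cqTr (S₂.indicator Γ')) (hΩ₂ : S₂.indicator Ω' = 0)
    (hD₁ : HasMass D₁ p) (hD₂ : HasMass D₂ p) (hE : HasMass E e) (hR : HasMass R r)
    (hR₀ : HasMass R₀ 1) (hp : p ≠ ∞)
    (hsum : Γ + D₂ = W + R + (D₁ + E)) (hdist : traceDist Γ' Ω' ≤ ENNReal.ofReal ε) :
    ∃ c d : ℝ, 0 ≤ c ∧ 0 ≤ d ∧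
      HasMass (S₁.indicator Ω' + ((c : ℂ) • R + (d : ℂ) • R₀)) 1 ∧
      traceDist Γ (S₁.indicator Ω' + ((c : ℂ) • R + (d : ℂ) • R₀)) ≤ ENNReal.ofReal ε + p := by
  have hWm : HasMass W (cqTr W) := hW ▸ hΓ'.indicator S₁
  have hΩm := hΩ'.indicator S₁
  have hΩsplit := hΩ'.indicator_add_compl S₁
  have hΓsum := cqTr_eq_of_add_eq hsum hΓ hD₂ (hWm.add hR) (hD₁.add hE)
  -- All masses are finite, and are treated as real numbers from here on.
  have hfin : cqTr W + r + (p + e) ≠ ∞ := by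
    rw [← hΓsum]; exact ENNReal.add_ne_top.2 ⟨ENNReal.one_ne_top, hp⟩
  set w := cqTr W
  set o := cqTr (S₁.indicator Ω')
  set o' := cqTr (S₁ᶜ.indicator Ω')
  have hofin : o + o' ≠ ∞ := by rw [hΩsplit]; exact ENNReal.one_ne_top
  obtain ⟨⟨hwf, hrf⟩, -, hef⟩ : (w ≠ ∞ ∧ r ≠ ∞) ∧ p ≠ ∞ ∧ e ≠ ∞ := by
    simpa [ENNReal.add_eq_top, not_or] using hfin
  obtain ⟨hof, hof'⟩ : o ≠ ∞ ∧ o' ≠ ∞ := by simpa [ENNReal.add_eq_top, not_or] using hofin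
  clear_value w o o'
  lift w to NNReal using hwf
  lift r to NNReal using hrf
  lift p to NNReal using hp
  lift e to NNReal using hef
  lift o to NNReal using hof
  lift o' to NNReal using hof'
  have e1 : (1 : ℝ) + p = w + r + (p + e) := by exact_mod_cast hΓsum
  have e2 : (o : ℝ) + o' = 1 := by exact_mod_cast hΩsplit
  obtain ⟨c, d, hc, hd, hc1, hcr⟩ : ∃ c d : ℝ, 0 ≤ c ∧ 0 ≤ d ∧ c ≤ 1 ∧
      (c * r + d = o' ∧ ((1 - c) * r + d = r - o' ∨ (1 - c) * r + d = o' - r)) := by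
    rcases le_or_gt (r : ℝ) o' with h | h
    · exact ⟨1, o' - r, by simp, by linarith, le_rfl, by ring, Or.inr (by ring)⟩
    · have hr0 : (r : ℝ) ≠ 0 := (lt_of_le_of_lt o'.2 h).ne'
      exact ⟨o' / r, 0, div_nonneg o'.2 r.2, le_rfl, (div_le_one₀ (lt_of_le_of_lt o'.2 h)).2 h.le,
        by field_simp; simp, Or.inl (by field_simp; simp)⟩
  refine ⟨c, d, hc, hd, ?_, ?_⟩
  · refine (hΩm.add ((hR.smul hc).add (hR₀.smul hd))).congr ?_
    rw [mul_one, ENNReal.ofReal, ENNReal.ofReal]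
    norm_cast
    apply NNReal.coe_injective
    push_cast
    rw [Real.coe_toNNReal _ hc, Real.coe_toNNReal _ hd, hcr.1, e2]
  refine ENNReal.le_of_forall_pos_le_add fun η hη _ => ?_
  obtain ⟨P, N, hP, hN, hPN, hle⟩ := exists_of_traceDist_le hε (by exact_mod_cast hη) hdist
  have hPm := hasMass_cqTr hP
  have hNm := hasMass_cqTr hN
  have hP₁ := hPm.indicator S₁
  have hN₁ := hNm.indicator S₁
  have f1 := cqTr_eq_of_add_eq hPN hΓ' hNm hΩ' hPm
  have hPN₁ : W + S₁.indicator N = S₁.indicator Ω' + S₁.indicator P := by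
    rw [← hW, ← Set.indicator_add', ← Set.indicator_add', hPN]
  have f2 := cqTr_eq_of_add_eq hPN₁ hWm hN₁ hΩm hP₁
  have f3 : (e : ℝ≥0∞) ≤ cqTr (S₁ᶜ.indicator P) := by
    refine he.trans (le_trans ?_ (cqTr_indicator_mono P (Set.subset_compl_iff_disjoint_left.2 hS)))
    have : S₂.indicator Γ' + S₂.indicator N = 0 + S₂.indicator P := by
      rw [← hΩ₂, ← Set.indicator_add', ← Set.indicator_add', hPN]
    have := cqTr_eq_of_add_eq this (hΓ'.indicator S₂) (hNm.indicator S₂) hasMass_zero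
      (hPm.indicator S₂)
    rw [zero_add] at this
    rw [← this]; exact le_self_add
  have f4 := hPm.indicator_add_compl S₁
  have f5 := hNm.indicator_add_compl S₁
  have hdiff : Γ + (S₁.indicator N + D₂ + (d : ℂ) • R₀) =
      (S₁.indicator Ω' + ((c : ℂ) • R + (d : ℂ) • R₀)) +
        (S₁.indicator P + (D₁ + E) + ((1 - c : ℝ) : ℂ) • R) := by
    have : Γ + (S₁.indicator N + D₂ + (d : ℂ) • R₀) =
        (Γ + D₂) + S₁.indicator N + (d : ℂ) • R₀ := by abel
    rw [this, hsum]
    have : W + R + (D₁ + E) + S₁.indicator N + (d : ℂ) • R₀ =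
        (W + S₁.indicator N) + R + (D₁ + E) + (d : ℂ) • R₀ := by abel
    rw [this, hPN₁]
    push_cast
    module
  refine (traceDist_le ((hP₁.add (hD₁.add hE)).add (hR.smul (by linarith)))
    ((hN₁.add hD₂).add (hR₀.smul hd)) hdiff).trans ?_
  rw [ENNReal.div_le_iff (by norm_num) (by norm_num), mul_one]
  set P1 := cqTr (S₁.indicator P)
  set P2 := cqTr (S₁ᶜ.indicator P)
  set N1 := cqTr (S₁.indicator N)
  set N2 := cqTr (S₁ᶜ.indicator N)
  rw [← f4, ← f5] at hle f1
  have hPNfin : P1 + P2 + (N1 + N2) ≠ ∞ := ne_top_of_le_ne_top ENNReal.ofReal_ne_top hle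
  obtain ⟨⟨a1, a2⟩, a3, a4⟩ : (P1 ≠ ∞ ∧ P2 ≠ ∞) ∧ N1 ≠ ∞ ∧ N2 ≠ ∞ := by
    simpa only [ne_eq, ENNReal.add_eq_top, not_or] using hPNfin
  clear_value P1 P2 N1 N2
  lift P1 to NNReal using a1
  lift P2 to NNReal using a2
  lift N1 to NNReal using a3
  lift N2 to NNReal using a4
  have g1 : (1 : ℝ) + (N1 + N2) = 1 + (P1 + P2) := by exact_mod_cast f1
  have g2 : (w : ℝ) + N1 = o + P1 := by exact_mod_cast f2
  have g3 : (e : ℝ) ≤ P2 := by exact_mod_cast f3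
  have g4 : (P1 : ℝ) + P2 + (N1 + N2) ≤ 2 * ε + η := by
    rw [ENNReal.ofReal] at hle
    have : P1 + P2 + (N1 + N2) ≤ (2 * ε + η).toNNReal := by exact_mod_cast hle
    have := NNReal.coe_le_coe.2 this
    rwa [Real.coe_toNNReal _ (by positivity), NNReal.coe_add, NNReal.coe_add, NNReal.coe_add]
      at this
  rw [ENNReal.ofReal, ENNReal.ofReal, ENNReal.ofReal]
  norm_cast
  rw [← NNReal.coe_le_coe]
  push_cast
  rw [Real.coe_toNNReal _ hε, Real.coe_toNNReal _ hd, Real.coe_toNNReal _ (by linarith)]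
  have := P1.2; have := P2.2; have := N1.2; have := N2.2; have := (zero_le (a := η)); have := η.2
  rcases hcr.2 with h | h <;> simp only [NNReal.val_eq_coe] at * <;> linarith

end ClassicalQuantum

namespace Params

variable {C : Params} {ι κ X Y : Type}

/-! ### The maps of which a round is composed -/

/-- `record` as a linear map. -/
def recordL (val : X) : Matrix ι ι ℂ →ₗ[ℂ] (X → Matrix ι ι ℂ) where
  toFun := record val
  map_add' ρ σ := by ext x : 1; simp only [record, Pi.add_apply]; split_ifs <;> simp
  map_smul' c ρ := by ext x : 1; simp [record]

@[simp] theorem recordL_apply (val : X) (ρ : Matrix ι ι ℂ) : recordL val ρ = record val ρ := rfl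

/-- Preparation of a system in the state `τ`. -/
def prepareL (τ : Matrix κ κ ℂ) : Op ι (κ × ι) where
  toFun ρ := τ ⊗ₖ ρ
  map_add' := Matrix.kronecker_add τ
  map_smul' c ρ := Matrix.kronecker_smul c τ ρ

/-- `measure` as a linear map. -/
def measureL (θ : Bits C.n) (y : Fin C.n → Option (ZMod 2)) : Op (C.Rcv × ι) ι where
  toFun := measure θ y
  map_add' ρ σ := by
    ext e e'
    exact (C.effect θ y).map_add (block ρ e e') (block σ e e')
  map_smul' c ρ := by
    ext e e'
    exact (C.effect θ y).map_smul c (block ρ e e')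

@[simp] theorem measureL_apply (θ : Bits C.n) (y : Fin C.n → Option (ZMod 2))
    (ρ : Matrix (C.Rcv × ι) (C.Rcv × ι) ℂ) : measureL θ y ρ = measure θ y ρ := rfl

variable (C ι) in
/-- The partial trace over the system that the client receives: a measurement whose outcome is
ignored. The choice of the basis does not matter. -/
def discardRcv : Op (C.Rcv × ι) ι := ∑ y, measureL 0 y

theorem measure_apply (θ : Bits C.n) (y : Fin C.n → Option (ZMod 2))
    (ρ : Matrix (C.Rcv × ι) (C.Rcv × ι) ℂ) (e e' : ι) :
    measure θ y ρ e e' = C.effect θ y (block ρ e e') := rfl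

theorem sum_measure_eq_discardRcv (θ : Bits C.n) {ρ : Matrix (C.Rcv × ι) (C.Rcv × ι) ℂ}
    (h : IsPos ρ) : ∑ y, measure θ y ρ = discardRcv C ι ρ := by
  ext e e'
  rw [discardRcv, LinearMap.sum_apply, Matrix.sum_apply, Matrix.sum_apply, ← sub_eq_zero]
  have := map_block_eq_zero (D := ∑ y, C.effect θ y - ∑ y, C.effect 0 y) (fun ρ hρ => by
    rw [LinearMap.sub_apply, LinearMap.sum_apply, LinearMap.sum_apply, C.effect_sum θ ρ hρ,
      C.effect_sum 0 ρ hρ, sub_self]) h e e'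
  rw [LinearMap.sub_apply, LinearMap.sum_apply, LinearMap.sum_apply] at this
  exact this

theorem posSemidef_measure (θ : Bits C.n) (y : Fin C.n → Option (ZMod 2))
    {ρ : Matrix (C.Rcv × ι) (C.Rcv × ι) ℂ} (h : IsPos ρ) : (measure θ y ρ).PosSemidef := by
  have key : ∀ (s : Finset ι) (x : ι → ℂ),
      0 ≤ ∑ i ∈ s, ∑ j ∈ s, star (x i) * measure θ y ρ i j * x j := by
    intro s x
    have h1 := C.effect_nonneg θ y _ (isPos_slice s x h)
    rw [slice, map_sum] at h1
    convert h1 using 2 with i hi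
    rw [map_sum]
    refine Finset.sum_congr rfl fun j hj => ?_
    rw [map_smul, smul_eq_mul, measure_apply]; ring
  refine posSemidef_of_sum_nonneg ?_ key
  -- A form that takes real values only is Hermitian.
  classical
  have hre : ∀ (s : Finset ι) (x : ι → ℂ),
      (∑ i ∈ s, ∑ j ∈ s, star (x i) * measure θ y ρ i j * x j).im = 0 :=
    fun s x => (Complex.le_def.1 (key s x)).2.symm
  ext e e'
  rw [Matrix.conjTranspose_apply]
  have hd : ∀ e, (measure θ y ρ e e).im = 0 := fun e => by simpa using hre {e} (fun _ => 1)
  by_cases he : e = e'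
  · subst he
    exact Complex.conj_eq_iff_im.2 (hd e)
  have h1 := hre {e, e'} (fun _ => 1)
  have h2 := hre {e, e'} (fun k => if k = e then 1 else Complex.I)
  simp only [Finset.sum_pair he, if_true, if_neg (Ne.symm he)] at h1 h2
  simp [hd] at h1 h2
  apply Complex.ext <;> simp <;> linarith

theorem tr_discardRcv {ρ : Matrix (C.Rcv × ι) (C.Rcv × ι) ℂ} (h : IsPos ρ) :
    tr (discardRcv C ι ρ) = tr ρ := by
  rw [tr_eq_tsum_block, tr]
  refine tsum_congr fun e => ?_
  rw [← sum_measure_eq_discardRcv 0 h, Matrix.sum_apply]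
  simp only [measure_apply]
  rw [C.effect_sum 0 _ (isPos_block h e), Complex.ofReal_re,
    ENNReal.ofReal_toReal (isPos_block h e).2]

theorem sum_tr_measure (θ : Bits C.n) {ρ : Matrix (C.Rcv × ι) (C.Rcv × ι) ℂ} (h : IsPos ρ) :
    ∑ y, tr (measure θ y ρ) = tr ρ := by
  rw [← tr_sum _ fun y _ => posSemidef_measure θ y h, sum_measure_eq_discardRcv θ h,
    tr_discardRcv h]

theorem isPos_measure (θ : Bits C.n) (y : Fin C.n → Option (ZMod 2))
    {ρ : Matrix (C.Rcv × ι) (C.Rcv × ι) ℂ} (h : IsPos ρ) : IsPos (measure θ y ρ) :=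
  ⟨posSemidef_measure θ y h, ne_top_of_le_ne_top h.2 (by
    rw [← sum_tr_measure θ h]
    exact Finset.single_le_sum (f := fun y => tr (measure θ y ρ)) (fun _ _ => zero_le)
      (Finset.mem_univ y))⟩

theorem isPos_discardRcv {ρ : Matrix (C.Rcv × ι) (C.Rcv × ι) ℂ} (h : IsPos ρ) :
    IsPos (discardRcv C ι ρ) := by
  rw [← sum_measure_eq_discardRcv 0 h]
  exact isPos_sum _ fun y _ => isPos_measure 0 y h

/-- The probability of the server's random choices `x` and `v`. -/
def choiceProb (C : Params) (v : Fin C.n → Fin 3) : ℝ := (∏ i, C.pv (v i)) / 2 ^ C.n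

theorem choiceProb_nonneg (v : Fin C.n → Fin 3) : 0 ≤ choiceProb C v :=
  div_nonneg (Finset.prod_nonneg fun i _ => C.pv_nonneg _) (by positivity)

theorem sum_choiceProb : ∑ _x : Bits C.n, ∑ v, ENNReal.ofReal (choiceProb C v) = 1 := by
  have h1 : ∑ v : Fin C.n → Fin 3, ∏ i, C.pv (v i) = 1 := by
    have := Finset.prod_univ_sum (fun _ : Fin C.n => (Finset.univ : Finset (Fin 3)))
      (fun _ j => C.pv j)
    rw [Fintype.piFinset_univ] at this
    rw [← this]
    simp [C.pv_sum]
  rw [Finset.sum_const, ← ENNReal.ofReal_sum_of_nonneg fun v _ => choiceProb_nonneg v]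
  simp only [choiceProb]
  rw [← Finset.sum_div, h1, ← ENNReal.ofReal_nsmul]
  simp [ZMod.card]

/-- The choice of a test set of the prescribed size among the detected rounds is possible. -/
theorem testSize_le (y : Fin C.n → Option (ZMod 2)) : C.testSize y ≤ (detected y).card := by
  refine Nat.ceil_le.2 ?_
  have := C.fP₁_le_one
  nlinarith [(Nat.cast_nonneg (detected y).card : (0 : ℝ) ≤ _)]

/-- The sum over the responses and new memories of the client. When the client rejects, the outcome
of its measurement is ignored, which amounts to a partial trace. -/
theorem clientStep_sum {V : Type*} [AddCommGroup V] [Module ℂ V] (a : Fin C.m) (s : C.Mem)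
    (r : C.ToClient) (F : C.ToServer → C.Mem → Matrix ι ι ℂ →ₗ[ℂ] V)
    {ρ : Matrix (C.Rcv × ι) (C.Rcv × ι) ℂ} (h : IsPos ρ) :
    ∑ c, ∑ s₁, F c s₁ (clientStep a s r ρ (c, s₁)) =
      if clientAccepts a s r then
        ∑ y, ∑ P₁ ∈ (detected y).powersetCard (C.testSize y),
          F (clientResponse (max a r.1) s y P₁) (clientUpdate (max a r.1) s y P₁)
            ((((detected y).card.choose (C.testSize y) : ℂ)⁻¹) •
              measure (C.g (s.cSeed (max a r.1))) y ρ)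
      else ∑ w, F (false, a, w) s
        (((Fintype.card (Body C.n C.lCV C.Syn) : ℂ)⁻¹) • discardRcv C ι ρ) := by
  classical
  rw [← Fintype.sum_prod_type']
  by_cases hacc : clientAccepts a s r = true
  · simp only [clientStep, hacc, if_true, map_sum]
    rw [Finset.sum_comm]
    refine Finset.sum_congr rfl fun y _ => ?_
    rw [Finset.sum_comm]
    refine Finset.sum_congr rfl fun P₁ _ => ?_
    rw [Finset.sum_eq_single (clientResponse (max a r.1) s y P₁, clientUpdate (max a r.1) s y P₁)]
    · simp
    · intro o _ ho
      rw [if_neg (Ne.symm ho), map_zero]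
    · simp
  · simp only [clientStep, hacc, Bool.false_eq_true, if_false, map_sum]
    rw [Finset.sum_comm, ← sum_measure_eq_discardRcv (C.g (s.cSeed (max a r.1))) h]
    simp only [Finset.smul_sum, map_sum]
    conv_rhs => rw [Finset.sum_comm]
    refine Finset.sum_congr rfl fun y _ => ?_
    rw [Finset.sum_comm]
    refine Finset.sum_congr rfl fun w _ => ?_
    rw [Finset.sum_eq_single ((false, a, w), s)]
    · simp
    · intro o _ ho
      rw [if_neg (Ne.symm ho), map_zero]
    · simp

/-! ### The output of a round as a sum over classical data -/

/-- The server's signals with random choices `x`, `v` and basis seed `sd`, next to the system of an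
adversary who lets the server take part. -/
def signalL (A : C.Strategy ι) (sd : Bits C.lSeed) (x : Bits C.n) (v : Fin C.n → Fin 3) :
    Op ι (C.Sig × A.E₀) :=
  prepareL (C.source (C.g sd) x v) ∘ₗ A.start true

theorem isPos_signalL (A : C.Strategy ι) (sd : Bits C.lSeed) (x : Bits C.n) (v : Fin C.n → Fin 3)
    {ρ : Matrix ι ι ℂ} (h : IsPos ρ) : IsPos (signalL A sd x v ρ) :=
  isPos_kronecker (C.source_isState _ _ _).isPos ((A.start_cp true).isPos h)

theorem tr_signalL (A : C.Strategy ι) (sd : Bits C.lSeed) (x : Bits C.n) (v : Fin C.n → Fin 3)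
    {ρ : Matrix ι ι ℂ} (h : IsPos ρ) : tr (signalL A sd x v ρ) = tr (A.start true ρ) := by
  have := tr_kronecker (C.source_isState (C.g sd) x v).1 ((A.start_cp true).isPos h).1
  rwa [(C.source_isState _ _ _).2, one_mul] at this

/-- The part of the output of a round in which the server takes part, the server's initial memory
is `s`, the client's actions are `cl` and leave the memory `s₁`, and `L` describes what happens to
the signals before the server's final step. -/
def serverTerm (a : Fin C.m) (u : ℕ) (b : Fin C.m) (A : C.Strategy ι)
    (cl : Option (C.ToClient × C.ToServer)) (s s₁ : C.Mem) (L : Op (C.Sig × A.E₀) A.E₁) :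
    Matrix ι ι ℂ →ₗ[ℂ] (Outcome × C.Mem → Matrix A.E₂ A.E₂ ℂ) :=
  ∑ x : Bits C.n, ∑ v : Fin C.n → Fin 3, (choiceProb C v : ℂ) • ∑ d : C.ToServer,
    recordL (result a u b cl (some (serverAccepts b s₁ x v d,
        serverLabel b (serverAccepts b s₁ x v d) d))
      (serverUpdate b (serverAccepts b s₁ x v d) s₁ x d)) ∘ₗ
    A.final (cl.map Prod.snd) d ∘ₗ L ∘ₗ signalL A (s.sSeed b) x v

/-- The part of the output of a round in which the client receives `r` and responds with `c`, its
memory becomes `s₁`, and its action on the quantum system is `L`. -/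
def reactTerm (a : Fin C.m) (u : ℕ) (b : Fin C.m) (A : C.Strategy ι) (r : C.ToClient)
    (s : C.Mem) (c : C.ToServer) (s₁ : C.Mem) (L : Op (C.Rcv × A.E₁) A.E₁) :
    Matrix ι ι ℂ →ₗ[ℂ] (Outcome × C.Mem → Matrix A.E₂ A.E₂ ℂ) :=
  serverTerm a u b A (some (r, c)) s s₁ (L ∘ₗ A.call (s.sTag b) r) +
    recordL (result a u b (some (r, c)) none s₁) ∘ₗ A.finish c ∘ₗ L ∘ₗ A.solo r ∘ₗ A.start false

variable (C) in
/-- The pairs of a measurement outcome and a test set of the prescribed size. -/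
def testChoices : Finset ((Fin C.n → Option (ZMod 2)) × Finset (Fin C.n)) :=
  Finset.univ.filter fun k => k.2 ∈ (detected k.1).powersetCard (C.testSize k.1)

/-- The client's measurement with basis `θ`, weighted with the probability of the test set. -/
def testMeasureL (θ : Bits C.n) (y : Fin C.n → Option (ZMod 2)) : Op (C.Rcv × ι) ι :=
  (((((detected y).card.choose (C.testSize y) : ℝ)⁻¹ : ℝ)) : ℂ) • measureL θ y

/-- The part of the output in which the client receives and accepts `r`. -/
def acceptTerm (a : Fin C.m) (u : ℕ) (b : Fin C.m) (A : C.Strategy ι) (s : C.Mem)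
    (r : C.ToClient) : Matrix ι ι ℂ →ₗ[ℂ] (Outcome × C.Mem → Matrix A.E₂ A.E₂ ℂ) :=
  ∑ k ∈ testChoices C, reactTerm a u b A r s (clientResponse (max a r.1) s k.1 k.2)
    (clientUpdate (max a r.1) s k.1 k.2) (testMeasureL (C.g (s.cSeed (max a r.1))) k.1)

variable (C ι) in
/-- The measurement of a client that rejects, weighted with the probability of its uniformly random
announcement. -/
def randomL : Op (C.Rcv × ι) ι :=
  (((Fintype.card (Body C.n C.lCV C.Syn) : ℝ)⁻¹ : ℝ) : ℂ) • discardRcv C ι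

/-- The part of the output in which the client receives and rejects `r`. -/
def rejectTerm (a : Fin C.m) (u : ℕ) (b : Fin C.m) (A : C.Strategy ι) (s : C.Mem)
    (r : C.ToClient) : Matrix ι ι ℂ →ₗ[ℂ] (Outcome × C.Mem → Matrix A.E₂ A.E₂ ℂ) :=
  ∑ w, reactTerm a u b A r s (false, a, w) s (randomL C A.E₁)

open scoped Classical in
/-- The classical-quantum operator of an ensemble of memories `st y` with states `ρ y`. -/
def ensemble [Fintype Y] (st : Y → C.Mem) (ρ : Y → Matrix ι ι ℂ) : C.Mem → Matrix ι ι ℂ :=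
  fun s => ∑ y, if st y = s then ρ y else 0

theorem sum_ensemble [Fintype Y] {V : Type*} [AddCommGroup V] [Module ℂ V] (st : Y → C.Mem)
    (ρ : Y → Matrix ι ι ℂ) (L : C.Mem → Matrix ι ι ℂ →ₗ[ℂ] V) :
    ∑ s, L s (ensemble st ρ s) = ∑ y, L (st y) (ρ y) := by
  classical
  simp only [ensemble, map_sum]
  rw [Finset.sum_comm]
  refine Finset.sum_congr rfl fun y _ => ?_
  rw [Finset.sum_eq_single (st y)]
  · simp
  · intro s _ hs
    rw [if_neg (Ne.symm hs), map_zero]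
  · simp

theorem isPos_ensemble [Fintype Y] {st : Y → C.Mem} {ρ : Y → Matrix ι ι ℂ}
    (h : ∀ y, IsPos (ρ y)) (s : C.Mem) : IsPos (ensemble st ρ s) := by
  classical
  refine isPos_sum _ fun y _ => ?_
  split_ifs
  · exact h y
  · exact isPos_zero

theorem cqTr_ensemble [Fintype Y] {st : Y → C.Mem} {ρ : Y → Matrix ι ι ℂ}
    (h : ∀ y, IsPos (ρ y)) : cqTr (ensemble st ρ) = ∑ y, tr (ρ y) := by
  classical
  rw [cqTr, tsum_fintype]
  have : ∀ s, tr (ensemble st ρ s) = ∑ y, if st y = s then tr (ρ y) else 0 := by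
    intro s
    rw [ensemble, tr_sum _ fun y _ => by
      split_ifs
      · exact (h y).1
      · exact isPos_zero.1]
    refine Finset.sum_congr rfl fun y _ => ?_
    split_ifs <;> simp
  simp only [this]
  rw [Finset.sum_comm]
  simp

theorem sum_testChoices {V : Type*} [AddCommMonoid V]
    (f : (Fin C.n → Option (ZMod 2)) → Finset (Fin C.n) → V) :
    ∑ k ∈ testChoices C, f k.1 k.2 =
      ∑ y, ∑ P₁ ∈ (detected y).powersetCard (C.testSize y), f y P₁ := by
  rw [testChoices, Finset.sum_filter, Fintype.sum_prod_type]
  refine Finset.sum_congr rfl fun y _ => ?_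
  rw [← Finset.sum_filter]
  refine Finset.sum_congr ?_ fun _ _ => rfl
  ext P₁
  simp

/-- The sum over the client's responses, with its test choices or its random announcement made
explicit. -/
theorem clientStep_sum_eq {V : Type*} [AddCommGroup V] [Module ℂ V] (a : Fin C.m) (s : C.Mem)
    (r : C.ToClient) (F : C.ToServer → C.Mem → Matrix ι ι ℂ →ₗ[ℂ] V)
    {ρ : Matrix (C.Rcv × ι) (C.Rcv × ι) ℂ} (h : IsPos ρ) :
    ∑ c, ∑ s₁, F c s₁ (clientStep a s r ρ (c, s₁)) =
      if clientAccepts a s r then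
        ∑ k ∈ testChoices C,
          F (clientResponse (max a r.1) s k.1 k.2) (clientUpdate (max a r.1) s k.1 k.2)
            (testMeasureL (C.g (s.cSeed (max a r.1))) k.1 ρ)
      else ∑ w, F (false, a, w) s (randomL C ι ρ) := by
  rw [clientStep_sum a s r F h]
  refine if_congr Iff.rfl ?_ ?_
  · rw [sum_testChoices fun y P₁ => F (clientResponse (max a r.1) s y P₁)
      (clientUpdate (max a r.1) s y P₁) (testMeasureL (C.g (s.cSeed (max a r.1))) y ρ)]
    simp only [testMeasureL, LinearMap.smul_apply, measureL_apply, Complex.ofReal_inv,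
      Complex.ofReal_natCast]
  · simp only [randomL, LinearMap.smul_apply, Complex.ofReal_inv, Complex.ofReal_natCast]

theorem sum_rotate {A B D V : Type*} [Fintype A] [Fintype B] [AddCommMonoid V] (s : Finset D)
    (f : A → B → D → V) : ∑ x, ∑ v, ∑ r ∈ s, f x v r = ∑ r ∈ s, ∑ x, ∑ v, f x v r := by
  rw [Finset.sum_comm (s := s)]
  exact Finset.sum_congr rfl fun x _ => Finset.sum_comm

open scoped Classical in
theorem round_eq (a : Fin C.m) (u : ℕ) (b : Fin C.m) (A : C.Strategy ι)
    {ω : C.Mem → Matrix ι ι ℂ} (h : ∀ s, IsPos (ω s)) :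
    round a u b A ω = ∑ s, (serverTerm a u b A none s s (A.skip (s.sTag b)) +
      ∑ r, if clientAccepts a s r then acceptTerm a u b A s r else rejectTerm a u b A s r)
        (ω s) := by
  have hcall : ∀ (s : C.Mem) x v r, IsPos (A.call (s.sTag b) r (C.source (C.g (s.sSeed b)) x v ⊗ₖ
      A.start true (ω s))) := fun s x v r =>
    (A.call_cp _ _).isPos (isPos_signalL A _ x v (h s))
  have hsolo : ∀ s r, IsPos (A.solo r (A.start false (ω s))) := fun s r =>
    (A.solo_cp _).isPos ((A.start_cp _).isPos (h s))
  rw [round, serverRun, clientRun, ← Finset.sum_add_distrib]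
  refine Finset.sum_congr rfl fun s _ => ?_
  -- For each message `r` to the client, both parts of the round are sums over its responses.
  have hr : ∀ r, ∑ x : Bits C.n, ∑ v : Fin C.n → Fin 3, (choiceProb C v : ℂ) •
      (∑ c : C.ToServer, ∑ s₁ : C.Mem, ∑ d : C.ToServer,
        serverStep a u b (some (r, c)) s₁ x v d (A.final (some c) d (clientStep a s r
          (A.call (s.sTag b) r (C.source (C.g (s.sSeed b)) x v ⊗ₖ A.start true (ω s)))
            (c, s₁)))) +
      ∑ c : C.ToServer, ∑ s₁ : C.Mem, record (result a u b (some (r, c)) none s₁)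
        (A.finish c (clientStep a s r (A.solo r (A.start false (ω s))) (c, s₁))) =
      (if clientAccepts a s r then acceptTerm a u b A s r else rejectTerm a u b A s r) (ω s) := by
    intro r
    have h1 := fun x v => clientStep_sum_eq a s r (fun c s₁ => ∑ d : C.ToServer,
      recordL (result a u b (some (r, c)) (some (serverAccepts b s₁ x v d,
        serverLabel b (serverAccepts b s₁ x v d) d))
      (serverUpdate b (serverAccepts b s₁ x v d) s₁ x d)) ∘ₗ A.final (some c) d) (hcall s x v r)
    simp only [LinearMap.sum_apply, LinearMap.comp_apply, recordL_apply] at h1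
    have h2 := clientStep_sum_eq a s r (fun c s₁ => recordL (result a u b (some (r, c)) none s₁) ∘ₗ
      A.finish c) (hsolo s r)
    simp only [LinearMap.comp_apply, recordL_apply] at h2
    rw [h2]
    simp only [serverStep, h1]
    split_ifs
    · simp only [acceptTerm, reactTerm, LinearMap.sum_apply, LinearMap.add_apply,
        Finset.sum_add_distrib, serverTerm, LinearMap.smul_apply, LinearMap.comp_apply,
        recordL_apply, Option.map_some]
      rw [← sum_rotate]
      simp only [Finset.smul_sum]
      rfl
    · simp only [rejectTerm, reactTerm, LinearMap.sum_apply, LinearMap.add_apply,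
        Finset.sum_add_distrib, serverTerm, LinearMap.smul_apply, LinearMap.comp_apply,
        recordL_apply, Option.map_some]
      rw [← sum_rotate]
      simp only [Finset.smul_sum]
      rfl
  rw [LinearMap.add_apply, LinearMap.sum_apply, ← Finset.sum_congr rfl fun r _ => hr r,
    Finset.sum_add_distrib, ← add_assoc,
    ← sum_rotate (A := Bits C.n) (B := Fin C.n → Fin 3)]
  congr 1
  simp only [serverTerm, LinearMap.sum_apply, LinearMap.smul_apply, LinearMap.comp_apply,
    ← Finset.sum_add_distrib, ← Finset.smul_sum, ← smul_add]
  rfl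

/-! ### Trace preservation -/

theorem hasMass_serverTerm (a : Fin C.m) (u : ℕ) (b : Fin C.m) (A : C.Strategy ι)
    (cl : Option (C.ToClient × C.ToServer)) (s s₁ : C.Mem) {L : Op (C.Sig × A.E₀) A.E₁}
    (hL : ∀ ρ, IsPos ρ → IsPos (L ρ)) {ρ : Matrix ι ι ℂ} (h : IsPos ρ) :
    HasMass (serverTerm a u b A cl s s₁ L ρ) (∑ x : Bits C.n, ∑ v : Fin C.n → Fin 3,
      ENNReal.ofReal (choiceProb C v) * tr (L (signalL A (s.sSeed b) x v ρ))) := by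
  simp only [serverTerm, LinearMap.sum_apply, LinearMap.smul_apply, LinearMap.comp_apply,
    recordL_apply]
  refine hasMass_sum _ fun x _ => hasMass_sum _ fun v _ =>
    HasMass.smul (HasMass.congr (hasMass_sum _ fun d _ => hasMass_record _ ?_) ?_)
      (choiceProb_nonneg v)
  · exact ((A.final_cp _ _).isPos (hL _ (isPos_signalL A _ x v h))).1
  · exact A.final_tr _ _ (hL _ (isPos_signalL A _ x v h))

/-- The probability that the client receives `r`, if the server's tag and basis seed are `tag` and
`sd`. -/
def callMass (A : C.Strategy ι) (tag : Bits C.lSV) (sd : Bits C.lSeed) (r : C.ToClient)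
    (ρ : Matrix ι ι ℂ) : ℝ≥0∞ :=
  (∑ x : Bits C.n, ∑ v : Fin C.n → Fin 3, ENNReal.ofReal (choiceProb C v) *
    tr (A.call tag r (signalL A sd x v ρ))) + tr (A.solo r (A.start false ρ))

theorem hasMass_sum_reactTerm {K : Type} (J : Finset K) (a : Fin C.m) (u : ℕ) (b : Fin C.m)
    (A : C.Strategy ι) (s : C.Mem) (r : C.ToClient) (c : K → C.ToServer) (s₁ : K → C.Mem)
    {L : K → Op (C.Rcv × A.E₁) A.E₁} (hL : ∀ k ρ, IsPos ρ → IsPos (L k ρ))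
    (htr : ∀ ρ, IsPos ρ → ∑ k ∈ J, tr (L k ρ) = tr ρ) {ρ : Matrix ι ι ℂ} (h : IsPos ρ) :
    HasMass ((∑ k ∈ J, reactTerm a u b A r s (c k) (s₁ k) (L k)) ρ)
      (callMass A (s.sTag b) (s.sSeed b) r ρ) := by
  have hsolo : IsPos (A.solo r (A.start false ρ)) := (A.solo_cp _).isPos ((A.start_cp _).isPos h)
  simp only [reactTerm, LinearMap.sum_apply, LinearMap.add_apply]
  refine (hasMass_sum J fun k _ => (hasMass_serverTerm a u b A (some (r, c k)) s (s₁ k) (fun σ hσ =>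
    hL k _ ((A.call_cp _ _).isPos hσ)) h).add (hasMass_record _
      ((A.finish_cp _).isPos (hL k _ hsolo)).1)).congr ?_
  rw [Finset.sum_add_distrib, ← sum_rotate, callMass]
  congr 1
  · refine Finset.sum_congr rfl fun x _ => Finset.sum_congr rfl fun v _ => ?_
    rw [← Finset.mul_sum]
    exact congrArg _ (htr _ ((A.call_cp _ _).isPos (isPos_signalL A _ x v h)))
  · rw [← htr _ hsolo]
    exact Finset.sum_congr rfl fun k _ => A.finish_tr _ _ (hL k _ hsolo)

theorem isPos_testMeasureL (θ : Bits C.n) (y : Fin C.n → Option (ZMod 2))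
    {ρ : Matrix (C.Rcv × ι) (C.Rcv × ι) ℂ} (h : IsPos ρ) : IsPos (testMeasureL θ y ρ) :=
  (isPos_measure θ y h).smul (by positivity)

theorem sum_tr_testMeasureL (θ : Bits C.n) {ρ : Matrix (C.Rcv × ι) (C.Rcv × ι) ℂ} (h : IsPos ρ) :
    ∑ k ∈ testChoices C, tr (testMeasureL θ k.1 ρ) = tr ρ := by
  rw [sum_testChoices fun y _ => tr (testMeasureL θ y ρ), ← sum_tr_measure θ h]
  refine Finset.sum_congr rfl fun y _ => ?_
  rw [Finset.sum_const, Finset.card_powersetCard, nsmul_eq_mul, testMeasureL, LinearMap.smul_apply,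
    tr_smul (by positivity), ← mul_assoc, ← ENNReal.ofReal_natCast,
    ← ENNReal.ofReal_mul (by positivity), mul_inv_cancel₀, ENNReal.ofReal_one, one_mul]
  · rfl
  · exact_mod_cast (Nat.choose_pos (testSize_le y)).ne'

theorem isPos_randomL {ρ : Matrix (C.Rcv × ι) (C.Rcv × ι) ℂ} (h : IsPos ρ) :
    IsPos (randomL C ι ρ) :=
  (isPos_discardRcv h).smul (by positivity)

theorem sum_tr_randomL {ρ : Matrix (C.Rcv × ι) (C.Rcv × ι) ℂ} (h : IsPos ρ) :
    ∑ _w : Body C.n C.lCV C.Syn, tr (randomL C ι ρ) = tr ρ := by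
  -- The type of announcements contains an element as soon as there is a syndrome, and the syndrome
  -- map provides one.
  have : Nonempty (Body C.n C.lCV C.Syn) := ⟨⟨∅, ∅, 0, C.fsyn ∅ 0, 0⟩⟩
  rw [Finset.sum_const, Finset.card_univ, nsmul_eq_mul, randomL, LinearMap.smul_apply,
    tr_smul (by positivity), ← mul_assoc, ← ENNReal.ofReal_natCast,
    ← ENNReal.ofReal_mul (by positivity), mul_inv_cancel₀, ENNReal.ofReal_one, one_mul,
    tr_discardRcv h]
  exact_mod_cast Fintype.card_ne_zero

theorem hasMass_acceptTerm (a : Fin C.m) (u : ℕ) (b : Fin C.m) (A : C.Strategy ι) (s : C.Mem)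
    (r : C.ToClient) {ρ : Matrix ι ι ℂ} (h : IsPos ρ) :
    HasMass (acceptTerm a u b A s r ρ) (callMass A (s.sTag b) (s.sSeed b) r ρ) :=
  hasMass_sum_reactTerm _ a u b A s r _ _ (fun _ _ hσ => isPos_testMeasureL _ _ hσ)
    (fun _ hσ => sum_tr_testMeasureL _ hσ) h

theorem hasMass_rejectTerm (a : Fin C.m) (u : ℕ) (b : Fin C.m) (A : C.Strategy ι) (s : C.Mem)
    (r : C.ToClient) {ρ : Matrix ι ι ℂ} (h : IsPos ρ) :
    HasMass (rejectTerm a u b A s r ρ) (callMass A (s.sTag b) (s.sSeed b) r ρ) :=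
  hasMass_sum_reactTerm _ a u b A s r _ _ (fun _ _ hσ => isPos_randomL hσ)
    (fun _ hσ => sum_tr_randomL hσ) h

/-- Either the server takes part and the client is left out, or the client receives a message. -/
theorem skip_add_sum_callMass (A : C.Strategy ι) (tag : Bits C.lSV) (sd : Bits C.lSeed)
    {ρ : Matrix ι ι ℂ} (h : IsPos ρ) :
    (∑ x : Bits C.n, ∑ v : Fin C.n → Fin 3, ENNReal.ofReal (choiceProb C v) *
      tr (A.skip tag (signalL A sd x v ρ))) + ∑ r, callMass A tag sd r ρ = tr ρ := by
  simp only [callMass, Finset.sum_add_distrib]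
  rw [A.solo_tr _ ((A.start_cp _).isPos h), ← add_assoc, ← sum_rotate, ← A.start_tr ρ h,
    Fintype.sum_bool]
  congr 1
  simp only [← Finset.sum_add_distrib, ← Finset.mul_sum, ← mul_add,
    A.react_tr _ _ (isPos_signalL A _ _ _ h), tr_signalL A _ _ _ h]
  simp only [← Finset.sum_mul, sum_choiceProb, one_mul]

theorem hasMass_round (a : Fin C.m) (u : ℕ) (b : Fin C.m) (A : C.Strategy ι)
    {ω : C.Mem → Matrix ι ι ℂ} (h : ∀ s, IsPos (ω s)) : HasMass (round a u b A ω) (cqTr ω) := by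
  classical
  rw [round_eq a u b A h]
  refine (hasMass_sum Finset.univ fun s _ => ?_).congr (tsum_fintype (fun s => tr (ω s))).symm
  rw [LinearMap.add_apply, LinearMap.sum_apply]
  refine ((hasMass_serverTerm a u b A none s s (fun _ hσ => (A.skip_cp _).isPos hσ) (h s)).add
    (hasMass_sum Finset.univ (t := fun r => callMass A (s.sTag b) (s.sSeed b) r (ω s))
      fun r _ => ?_)).congr (skip_add_sum_callMass A (s.sTag b) (s.sSeed b) (h s))
  split_ifs
  · exact hasMass_acceptTerm a u b A s r (h s)
  · exact hasMass_rejectTerm a u b A s r (h s)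

/-! ### Ideal states as ensembles -/

variable (C) in
/-- The data over which an ideal state is a mixture: the secrets, the lost values, the queries to
the tag oracles and the query to the oracle `h_PA(R, ·)`. -/
abbrev Branch := C.Secrets × C.Lost × (Fin C.m → HashMsg C.n C.Syn) × PAMsg C.n

theorem IsIdealPart.exists_ensemble {a u b : ℕ} {ω : C.Mem → Matrix ι ι ℂ}
    (h : IsIdealPart a u b ω) :
    ∃ σ : C.Lost → (Fin C.m → HashMsg C.n C.Syn) → (Fin C.m → Bits C.lCV) → PAMsg C.n →
      Matrix ι ι ℂ, (∀ p M t M', IsPos (σ p M t M')) ∧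
      ω = ensemble (fun y : Branch C => assemble a u b y.1 y.2.1 y.2.2.2)
        fun y => ((((Fintype.card C.Secrets : ℝ)⁻¹ : ℝ)) : ℂ) •
          σ y.2.1 y.2.2.1 (reply a u b y.1 y.2.2.1) y.2.2.2 := by
  obtain ⟨σ, hσ, h⟩ := h
  refine ⟨σ, hσ, funext fun s => ?_⟩
  rw [h, ensemble]
  simp only [Fintype.sum_prod_type, Complex.ofReal_inv, Complex.ofReal_natCast]

theorem isIdealPart_zero (a u b : ℕ) : IsIdealPart a u b (0 : C.Mem → Matrix ι ι ℂ) :=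
  ⟨0, fun _ _ _ _ => isPos_zero, fun s => by simp⟩

theorem IsIdealPart.add {a u b : ℕ} {ω ω' : C.Mem → Matrix ι ι ℂ} (h : IsIdealPart a u b ω)
    (h' : IsIdealPart a u b ω') : IsIdealPart a u b (ω + ω') := by
  obtain ⟨σ, hσ, h⟩ := h
  obtain ⟨σ', hσ', h'⟩ := h'
  refine ⟨σ + σ', fun p M t M' => (hσ p M t M').add (hσ' p M t M'), fun s => ?_⟩
  rw [Pi.add_apply, h, h']
  simp only [← Finset.sum_add_distrib]
  refine Finset.sum_congr rfl fun z _ => Finset.sum_congr rfl fun p _ =>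
    Finset.sum_congr rfl fun M _ => Finset.sum_congr rfl fun M' _ => ?_
  split_ifs
  · exact (smul_add _ _ _).symm
  · exact add_zero _

theorem IsIdealPart.smul {a u b : ℕ} {ω : C.Mem → Matrix ι ι ℂ} (h : IsIdealPart a u b ω) {c : ℝ}
    (hc : 0 ≤ c) : IsIdealPart a u b ((c : ℂ) • ω) := by
  obtain ⟨σ, hσ, h⟩ := h
  refine ⟨(c : ℂ) • σ, fun p M t M' => (hσ p M t M').smul hc, fun s => ?_⟩
  rw [Pi.smul_apply, h]
  simp only [Finset.smul_sum]
  refine Finset.sum_congr rfl fun z _ => Finset.sum_congr rfl fun p _ =>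
    Finset.sum_congr rfl fun M _ => Finset.sum_congr rfl fun M' _ => ?_
  split_ifs
  · exact smul_comm _ _ _
  · exact smul_zero _

/-- The seeds with index below `hi`. -/
def lowSeeds (hi : ℕ) (sd : Fin C.m → Bits C.lSeed) : Fin C.m → Bits C.lSeed :=
  fun i => if (i : ℕ) < hi then sd i else 0

theorem bits_add_add_cancel {l : ℕ} (x y : Bits l) : x + y + y = x := by
  funext i
  simp [add_assoc, CharTwo.add_self_eq_zero]

open scoped Classical in
/-- Exchange the seeds below `hi` with the fresh seeds `w.1`, and the replies of the oracles in `D`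
with the fresh strings `w.2`. -/
def exchange (hi : ℕ) (D : Fin C.m → Prop) (M : Fin C.m → HashMsg C.n C.Syn)
    (zw : C.Secrets × (Fin C.m → Bits C.lSeed) × (Fin C.m → Bits C.lCV)) :
    C.Secrets × (Fin C.m → Bits C.lSeed) × (Fin C.m → Bits C.lCV) :=
  ({ zw.1 with
      seed := fun i => if (i : ℕ) < hi then zw.2.1 i else zw.1.seed i
      mask := fun i => if D i then zw.2.2 i + C.h₁ zw.1.Kh (M i) else zw.1.mask i },
    fun i => if (i : ℕ) < hi then zw.1.seed i else zw.2.1 i,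
    fun i => if D i then C.h₁ zw.1.Kh (M i) + zw.1.mask i else zw.2.2 i)

theorem exchange_involutive (hi : ℕ) (D : Fin C.m → Prop) (M : Fin C.m → HashMsg C.n C.Syn) :
    Function.Involutive (exchange (C := C) hi D M) := by
  rintro ⟨z, sd, mk⟩
  refine Prod.ext (Secrets.ext rfl rfl ?_ ?_) (Prod.ext ?_ ?_) <;> funext i
  · by_cases h : D i
    · simp [exchange, h, add_comm (C.h₁ _ _), bits_add_add_cancel]
    · simp [exchange, h]
  · by_cases h : (i : ℕ) < hi <;> simp [exchange, h]
  · by_cases h : (i : ℕ) < hi <;> simp [exchange, h]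
  · by_cases h : D i
    · simp [exchange, h, add_comm (C.h₁ _ _), bits_add_add_cancel]
    · simp [exchange, h]

/-- If the labels grow from `a`, `b` to `a₂`, `b₂`, then seeds with index below `max u b₂` may
become known to the adversary (they may influence its system and the lost values), and it may
forget the replies of oracles whose masks are discarded. -/
theorem isIdealPart_coarsen {a u b a₂ b₂ : ℕ}
    (τ : C.Lost → (Fin C.m → Bits C.lSeed) → (Fin C.m → HashMsg C.n C.Syn) →
      (Fin C.m → Bits C.lCV) → PAMsg C.n → Matrix ι ι ℂ)
    (hτ : ∀ p sd M t M', IsPos (τ p sd M t M'))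
    (q : C.Lost → (Fin C.m → Bits C.lSeed) → C.Lost)
    (hidx : ∀ i, oracleIdx a₂ u b₂ i → oracleIdx a u b i)
    (hdrop : ∀ i, oracleIdx a u b i → ¬ oracleIdx a₂ u b₂ i → i < min a₂ b₂) :
    IsIdealPart a₂ u b₂ (ensemble (fun y : Branch C => assemble a₂ u b₂ y.1
        (q y.2.1 (lowSeeds (max u b₂) y.1.seed)) y.2.2.2)
      fun y => ((((Fintype.card C.Secrets : ℝ)⁻¹ : ℝ)) : ℂ) •
        τ y.2.1 (lowSeeds (max u b₂) y.1.seed) y.2.2.1 (reply a u b y.1 y.2.2.1) y.2.2.2) := by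
  classical
  set hi := max u b₂ with hhi
  let D : Fin C.m → Prop := fun i => oracleIdx a u b i ∧ ¬ oracleIdx a₂ u b₂ i
  let W := (Fin C.m → Bits C.lSeed) × (Fin C.m → Bits C.lCV)
  let w : ℂ := ((((Fintype.card W : ℝ)⁻¹ : ℝ)) : ℂ)
  have hw : (Fintype.card W : ℂ) * w = 1 := by
    simp only [w, Complex.ofReal_inv, Complex.ofReal_natCast]
    exact mul_inv_cancel₀ (by exact_mod_cast Fintype.card_ne_zero)
  let c : ℂ := (Fintype.card C.Secrets : ℂ)⁻¹
  refine ⟨fun p' M t M' => ∑ p, ∑ k : W, if q p (lowSeeds hi k.1) = p' then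
    w • τ p (lowSeeds hi k.1) M (fun i => if D i then k.2 i else t i) M' else 0, ?_, ?_⟩
  · intro p' M t M'
    refine isPos_sum _ fun p _ => isPos_sum _ fun k _ => ?_
    split_ifs
    · exact (hτ _ _ _ _ _).smul (by positivity)
    · exact isPos_zero
  intro s
  -- After the exchange, the summand does not depend on the fresh values.
  have key : ∀ p M M', ∑ z : C.Secrets, (if assemble a₂ u b₂ z (q p (lowSeeds hi z.seed)) M' = s
      then c • τ p (lowSeeds hi z.seed) M (reply a u b z M) M' else 0) =
      ∑ z : C.Secrets, ∑ k : W, if assemble a₂ u b₂ z (q p (lowSeeds hi k.1)) M' = s then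
        c • w • τ p (lowSeeds hi k.1) M (fun i => if D i then k.2 i else reply a₂ u b₂ z M i) M'
        else 0 := by
    intro p M M'
    rw [← Fintype.sum_prod_type' (f := fun z (k : W) =>
      if assemble a₂ u b₂ z (q p (lowSeeds hi k.1)) M' = s then
        c • w • τ p (lowSeeds hi k.1) M (fun i => if D i then k.2 i else reply a₂ u b₂ z M i) M'
        else 0), ← Equiv.sum_comp (exchange_involutive hi D M).toPerm, Fintype.sum_prod_type]
    refine Finset.sum_congr rfl fun z _ => ?_
    have hconst : ∀ k : W, (if assemble a₂ u b₂ (exchange hi D M (z, k)).1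
          (q p (lowSeeds hi (exchange hi D M (z, k)).2.1)) M' = s then
        c • w • τ p (lowSeeds hi (exchange hi D M (z, k)).2.1) M
          (fun i => if D i then (exchange hi D M (z, k)).2.2 i
            else reply a₂ u b₂ (exchange hi D M (z, k)).1 M i) M' else 0) =
        w • if assemble a₂ u b₂ z (q p (lowSeeds hi z.seed)) M' = s
          then c • τ p (lowSeeds hi z.seed) M (reply a u b z M) M' else 0 := by
      intro k
      have h1 : lowSeeds hi (exchange hi D M (z, k)).2.1 = lowSeeds hi z.seed := by
        funext i
        by_cases h : (i : ℕ) < hi <;> simp [lowSeeds, exchange, h]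
      have h2 : (fun i => if D i then (exchange hi D M (z, k)).2.2 i
            else reply a₂ u b₂ (exchange hi D M (z, k)).1 M i) = reply a u b z M := by
        funext i
        by_cases h : D i
        · simp [exchange, h, reply, h.1]
        · rw [if_neg h, reply, reply]
          by_cases h' : oracleIdx a₂ u b₂ i
          · rw [if_pos h', if_pos (hidx i h')]
            simp [exchange, h]
          · rw [if_neg h', if_neg fun h'' => h ⟨h'', h'⟩]
      have h3 : ∀ p', assemble a₂ u b₂ (exchange hi D M (z, k)).1 p' M' =
          assemble a₂ u b₂ z p' M' := by
        intro p'
        have hs : ∀ i : Fin C.m, hi ≤ (i : ℕ) → (exchange hi D M (z, k)).1.seed i = z.seed i :=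
          fun i h => by simp [exchange, not_lt.2 h]
        have hm : ∀ i : Fin C.m, min a₂ b₂ ≤ (i : ℕ) →
            (exchange hi D M (z, k)).1.mask i = z.mask i := fun i h => by
          have : ¬ D i := fun h' => absurd (hdrop i h'.1 h'.2) (not_lt.2 h)
          simp [exchange, this]
        have hR : (exchange hi D M (z, k)).1.R = z.R := rfl
        refine Mem.ext rfl rfl ?_ ?_ rfl ?_ rfl <;> funext i <;>
          simp only [assemble, Mem.discard, hR]
        · split_ifs with h
          · exact hm i h
          · rfl
        · rw [← hhi]; split_ifs with _ _ h <;> first | rfl | exact hs i h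
        · rw [← hhi]; split_ifs with _ h <;> first | rfl | exact hs i h
      rw [h1, h2, h3]
      split_ifs
      · exact smul_comm _ _ _
      · exact (smul_zero _).symm
    refine Eq.trans ?_ (Finset.sum_congr rfl fun k _ => (hconst k).symm)
    rw [Finset.sum_const, Finset.card_univ, ← Nat.cast_smul_eq_nsmul ℂ, smul_smul, hw, one_smul]
  have hL : ∀ z p M M', (∑ p', if assemble a₂ u b₂ z p' M' = s then c • ∑ k : W,
        (if q p (lowSeeds hi k.1) = p' then w • τ p (lowSeeds hi k.1) M
          (fun i => if D i then k.2 i else reply a₂ u b₂ z M i) M' else 0) else 0) =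
      ∑ k : W, if assemble a₂ u b₂ z (q p (lowSeeds hi k.1)) M' = s then
        c • w • τ p (lowSeeds hi k.1) M (fun i => if D i then k.2 i else reply a₂ u b₂ z M i) M'
        else 0 := by
    intro z p M M'
    rw [Finset.sum_congr rfl fun p' _ => show _ = ∑ k : W, (if q p (lowSeeds hi k.1) = p' then
      if assemble a₂ u b₂ z p' M' = s then c • w • τ p (lowSeeds hi k.1) M
          (fun i => if D i then k.2 i else reply a₂ u b₂ z M i) M' else 0 else 0) from ?_,
      Finset.sum_comm]
    · refine Finset.sum_congr rfl fun k _ => ?_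
      rw [Finset.sum_ite_eq]; simp
    · split_ifs with h
      · rw [Finset.smul_sum]
        refine Finset.sum_congr rfl fun k _ => ?_
        split_ifs <;> simp
      · simp
  rw [ensemble, Fintype.sum_prod_type_right]
  simp only [Complex.ofReal_inv, Complex.ofReal_natCast]
  rw [Finset.sum_congr rfl fun t _ => (key t.1 t.2.1 t.2.2).trans
    (Finset.sum_congr rfl fun z _ => (hL z t.1 t.2.1 t.2.2).symm), Finset.sum_comm]
  refine Finset.sum_congr rfl fun z _ => ?_
  rw [Finset.sum_comm]
  refine Finset.sum_congr rfl fun p' _ => ?_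
  simp only [Fintype.sum_prod_type]
  rw [Finset.sum_comm]
  refine Finset.sum_congr rfl fun M _ => ?_
  rw [Finset.sum_comm]
  refine Finset.sum_congr rfl fun M' _ => ?_
  split_ifs with h
  · rw [← Finset.smul_sum]
  · simp

/-! ### Guessing and forging probabilities -/

/-- An involution that exchanges a part of `z` with a fresh value `t` leaves the uniform
distribution of `z` unchanged. -/
theorem sum_resample {Z T : Type} [Fintype Z] [Fintype T] {e : Z × T → Z × T}
    (he : Function.Involutive e) (G : Z → ℝ≥0∞) :
    ∑ z, ∑ t, G (e (z, t)).1 = Fintype.card T * ∑ z, G z := by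
  rw [← Fintype.sum_prod_type' (f := fun z t => G (e (z, t)).1)]
  refine (Equiv.sum_comp he.toPerm (fun zt : Z × T => G zt.1)).trans ?_
  rw [Fintype.sum_prod_type, Finset.mul_sum]
  simp

theorem le_of_card_mul_le {T : Type} [Fintype T] [Nonempty T] {x y : ℝ≥0∞}
    (h : (Fintype.card T : ℝ≥0∞) * x ≤ Fintype.card T * y) : x ≤ y :=
  (ENNReal.mul_le_mul_iff_right (by exact_mod_cast Fintype.card_ne_zero)
    (ENNReal.natCast_ne_top _)).1 h

theorem sum_ite_eq_card_mul {T : Type} [Fintype T] (P : T → Prop) [DecidablePred P] (f : ℝ≥0∞) :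
    ∑ k, (if P k then f else 0) = (Nat.card {k // P k} : ℝ≥0∞) * f := by
  rw [← Finset.sum_filter, Finset.sum_const, nsmul_eq_mul, Nat.card_eq_fintype_card,
    Fintype.card_subtype]

/-- The check value `h_PA(R, M')` is uniform and independent of the adversary's system, so a guess
is correct with probability `2^(-l_SV)`. -/
theorem sum_checkValue (hPA : IsUniformHash fun R M => (C.hPA R M).1) (a u b : ℕ)
    (M : Fin C.m → HashMsg C.n C.Syn) (M' : PAMsg C.n)
    (F : (Fin C.m → Bits C.lCV) → (Fin C.m → Bits C.lSeed) → Bits C.lSV → ℝ≥0∞) :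
    ∑ z : C.Secrets, F (reply a u b z M) z.seed (C.hPA z.R M').1 =
      ENNReal.ofReal (1 / 2 ^ C.lSV) * ∑ z : C.Secrets, ∑ T, F (reply a u b z M) z.seed T := by
  classical
  have hcount : ∀ T, (Nat.card {R // (C.hPA R M').1 = T} : ℝ≥0∞) =
      Fintype.card C.PASeed * ENNReal.ofReal (1 / 2 ^ C.lSV) := by
    intro T
    have := hPA M' T
    rw [div_eq_iff (by exact_mod_cast Fintype.card_ne_zero)] at this
    rw [← ENNReal.ofReal_natCast, this, ENNReal.ofReal_mul (by positivity), ENNReal.ofReal_natCast,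
      mul_comm]
  let e : C.Secrets × C.PASeed → C.Secrets × C.PASeed := fun p => ({ p.1 with R := p.2 }, p.1.R)
  have h1 := sum_resample (e := e) (fun _ => rfl)
    (fun z => F (reply a u b z M) z.seed (C.hPA z.R M').1)
  have h2 : ∀ z : C.Secrets, ∑ R, F (reply a u b z M) z.seed (C.hPA R M').1 =
      Fintype.card C.PASeed * (ENNReal.ofReal (1 / 2 ^ C.lSV) *
        ∑ T, F (reply a u b z M) z.seed T) := by
    intro z
    rw [← Finset.sum_fiberwise_of_maps_to (fun R _ => Finset.mem_univ (C.hPA R M').1), ← mul_assoc,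
      Finset.mul_sum]
    refine Finset.sum_congr rfl fun T _ => ?_
    rw [← hcount T, ← sum_ite_eq_card_mul, Finset.sum_filter]
    refine Finset.sum_congr rfl fun R _ => ?_
    split_ifs with h
    · rw [h]
    · rfl
  have h3 : (Fintype.card C.PASeed : ℝ≥0∞) * ∑ z : C.Secrets,
      F (reply a u b z M) z.seed (C.hPA z.R M').1 = Fintype.card C.PASeed *
        (ENNReal.ofReal (1 / 2 ^ C.lSV) * ∑ z : C.Secrets, ∑ T, F (reply a u b z M) z.seed T) := by
    rw [← h1, Finset.mul_sum, Finset.mul_sum]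
    exact Finset.sum_congr rfl fun z _ => h2 z
  exact le_antisymm (le_of_card_mul_le h3.le) (le_of_card_mul_le h3.ge)

/-- The server, with label `b`, receives the reply of the tag oracle with index `b`, and decodes the
message of the query. Apart from the server's string `x`, this is determined by what the adversary
has seen. -/
def IsReplay (a u : ℕ) (b : Fin C.m) (M : Fin C.m → HashMsg C.n C.Syn)
    (t : Fin C.m → Bits C.lCV) (x : Bits C.n) (w : Body C.n C.lCV C.Syn) : Prop :=
  oracleIdx a u b b ∧ (⟨w.1, w.2.1, w.2.2.1, decoded x w, w.2.2.2.1⟩ : HashMsg C.n C.Syn) = M b ∧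
    w.2.2.2.2 = t b

open scoped Classical in
/-- A tag that is not a replay is accepted with probability at most `2^(-l_CV) + ε_MAC`: the mask of
the server's index is unknown to the adversary, except for its sum with the hash value of another
message. -/
theorem sum_forge_le {εMAC : ℝ} (hMAC : IsAlmostXORUniversal εMAC C.h₁) (hMAC0 : 0 ≤ εMAC)
    (a u : ℕ) (b : Fin C.m) (M : Fin C.m → HashMsg C.n C.Syn) (x : Bits C.n)
    (w : Body C.n C.lCV C.Syn)
    (F : (Fin C.m → Bits C.lCV) → (Fin C.m → Bits C.lSeed) → ℝ≥0∞) :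
    ∑ z : C.Secrets, (if w.2.2.2.2 = C.h₁ z.Kh ⟨w.1, w.2.1, w.2.2.1, decoded x w, w.2.2.2.1⟩ +
        z.mask b ∧ ¬ IsReplay a u b M (reply a u b z M) x w
      then F (reply a u b z M) z.seed else 0) ≤
      ENNReal.ofReal (1 / 2 ^ C.lCV + εMAC) * ∑ z : C.Secrets, F (reply a u b z M) z.seed := by
  set N : HashMsg C.n C.Syn := ⟨w.1, w.2.1, w.2.2.1, decoded x w, w.2.2.2.1⟩ with hN
  set tag := w.2.2.2.2 with htag
  set G : C.Secrets → ℝ≥0∞ := fun z => if tag = C.h₁ z.Kh N + z.mask b ∧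
    ¬ IsReplay a u b M (reply a u b z M) x w then F (reply a u b z M) z.seed else 0 with hG
  have hle1 : ENNReal.ofReal (1 / 2 ^ C.lCV) ≤ ENNReal.ofReal (1 / 2 ^ C.lCV + εMAC) :=
    ENNReal.ofReal_le_ofReal (by linarith)
  have hle2 : ENNReal.ofReal εMAC ≤ ENNReal.ofReal (1 / 2 ^ C.lCV + εMAC) :=
    ENNReal.ofReal_le_ofReal (by
      have : (0 : ℝ) ≤ 1 / 2 ^ C.lCV := by positivity
      linarith)
  by_cases hor : oracleIdx a u b b
  · by_cases hNM : N = M b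
    · -- For the same message, the tag is accepted only if it is the reply itself.
      have : ∀ z, G z = 0 := by
        intro z
        rw [hG]
        refine if_neg ?_
        rintro ⟨h1, h2⟩
        refine h2 ⟨hor, hNM, ?_⟩
        rw [reply, if_pos hor, ← hNM, ← h1]
      simp only [this, Finset.sum_const_zero]
      exact zero_le
    · refine le_trans ?_ (mul_le_mul_left hle2 _)
      -- Resample the hash key, and change the masks so that all replies are the same.
      let e : C.Secrets × C.Key → C.Secrets × C.Key := fun p =>
        ({ p.1 with
            Kh := p.2
            mask := fun i => if oracleIdx a u b i then
              p.1.mask i + C.h₁ p.1.Kh (M i) + C.h₁ p.2 (M i) else p.1.mask i }, p.1.Kh)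
      have he : Function.Involutive e := by
        rintro ⟨z, k⟩
        refine Prod.ext (Secrets.ext rfl rfl ?_ rfl) rfl
        funext i
        by_cases h : oracleIdx a u b i
        · simp [e, h, bits_add_add_cancel]
        · simp [e, h]
      have hrep : ∀ z k, reply a u b (e (z, k)).1 M = reply a u b z M := by
        intro z k
        funext i
        by_cases h : oracleIdx a u b i
        · simp only [reply, e, if_pos h]
          rw [add_comm, bits_add_add_cancel, add_comm]
        · simp [reply, h]
      refine le_of_card_mul_le (T := C.Key) ?_
      rw [← sum_resample he, Finset.mul_sum, Finset.mul_sum]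
      refine Finset.sum_le_sum fun z _ => ?_
      have hstep : ∀ k, G (e (z, k)).1 ≤
          if C.h₁ k N + C.h₁ k (M b) = tag + (z.mask b + C.h₁ z.Kh (M b))
            then F (reply a u b z M) z.seed else 0 := by
        intro k
        simp only [hG, hrep]
        split_ifs with h1 h2 h2
        · exact le_rfl
        · refine absurd ?_ h2
          rw [h1.1]
          simp only [e, if_pos hor]
          rw [show C.h₁ k N + (z.mask b + C.h₁ z.Kh (M b) + C.h₁ k (M b)) +
            (z.mask b + C.h₁ z.Kh (M b)) = C.h₁ k N + C.h₁ k (M b) +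
              ((z.mask b + C.h₁ z.Kh (M b)) + (z.mask b + C.h₁ z.Kh (M b))) by abel,
            ← add_assoc, bits_add_add_cancel]
        · exact zero_le
        · exact le_rfl
      refine (Finset.sum_le_sum fun k _ => hstep k).trans ?_
      rw [sum_ite_eq_card_mul, ← mul_assoc]
      refine mul_le_mul_left ?_ _
      have := hMAC N (M b) hNM (tag + (z.mask b + C.h₁ z.Kh (M b)))
      rw [div_le_iff₀ (by exact_mod_cast Fintype.card_pos), mul_comm] at this
      rw [← ENNReal.ofReal_natCast, ← ENNReal.ofReal_natCast,
        ← ENNReal.ofReal_mul (Nat.cast_nonneg _)]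
      exact ENNReal.ofReal_le_ofReal this
  · refine le_trans ?_ (mul_le_mul_left hle1 _)
    -- No reply depends on the mask with index `b`.
    let e : C.Secrets × Bits C.lCV → C.Secrets × Bits C.lCV := fun p =>
      ({ p.1 with mask := Function.update p.1.mask b p.2 }, p.1.mask b)
    have he : Function.Involutive e := by
      rintro ⟨z, k⟩
      refine Prod.ext (Secrets.ext rfl rfl ?_ rfl) ?_ <;> simp [e]
    have hrep : ∀ z k, reply a u b (e (z, k)).1 M = reply a u b z M := by
      intro z k
      funext i
      by_cases h : oracleIdx a u b i
      · have : i ≠ b := fun h' => hor (h' ▸ h)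
        simp [reply, e, h, this]
      · simp [reply, h]
    refine le_of_card_mul_le (T := Bits C.lCV) ?_
    rw [← sum_resample he, ← mul_assoc]
    have hcard : (Fintype.card (Bits C.lCV) : ℝ≥0∞) * ENNReal.ofReal (1 / 2 ^ C.lCV) = 1 := by
      rw [← ENNReal.ofReal_natCast, ← ENNReal.ofReal_mul (Nat.cast_nonneg _)]
      simp [ZMod.card]
    rw [hcard, one_mul]
    refine Finset.sum_le_sum fun z _ => ?_
    have hstep : ∀ k, G (e (z, k)).1 ≤
        if C.h₁ z.Kh N + tag = k then F (reply a u b z M) z.seed else 0 := by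
      intro k
      simp only [hG, hrep]
      split_ifs with h1 h2 h2
      · exact le_rfl
      · refine absurd ?_ h2
        rw [h1.1]
        simp only [e, Function.update_self]
        rw [add_comm, add_comm _ k, bits_add_add_cancel]
      · exact zero_le
      · exact le_rfl
    refine (Finset.sum_le_sum fun k _ => hstep k).trans ?_
    simp

/-! ### Simulation of a round by a round with the next client label -/

/-- The message that the simulated client receives. With the check value `0` at its own label, it
accepts every message with this label. -/
def relabel (a' : Fin C.m) (r : C.ToClient) : C.ToClient := if r.1 = a' then (a', 0) else r

theorem relabel_fst (a' : Fin C.m) (r : C.ToClient) : (relabel a' r).1 = r.1 := by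
  unfold relabel; split_ifs with h
  · exact h.symm
  · rfl

/-- The client's response with the label of a rejection replaced by `a`. -/
def rejectAs (a : Fin C.m) (c : C.ToServer) : C.ToServer := if c.1 then c else (false, a, c.2.2)

/-- The strategy `A` against a client with label `a`, adapted to a client with label `a'` and check
value `0`. -/
abbrev simulate (a a' : Fin C.m) (A : C.Strategy ι) : C.Strategy ι where
  E₀ := A.E₀
  E₁ := A.E₁
  E₂ := A.E₂
  start := A.start
  skip := A.skip
  call t r := ∑ r₀ with relabel a' r₀ = r, A.call t r₀
  solo r := ∑ r₀ with relabel a' r₀ = r, A.solo r₀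
  final c d := A.final (c.map (rejectAs a)) d
  finish := A.finish
  start_cp := A.start_cp
  skip_cp := A.skip_cp
  call_cp t r := isCP_sum _ fun r₀ _ => A.call_cp t r₀
  solo_cp r := isCP_sum _ fun r₀ _ => A.solo_cp r₀
  final_cp c d := A.final_cp _ d
  finish_cp := A.finish_cp
  start_tr := A.start_tr
  react_tr t ρ h := by
    rw [← A.react_tr t ρ h,
      ← Finset.sum_fiberwise Finset.univ (relabel a') fun r => tr (A.call t r ρ)]
    congr 1
    refine Finset.sum_congr rfl fun r _ => ?_
    rw [LinearMap.sum_apply, tr_sum _ fun r₀ _ => ((A.call_cp t r₀).isPos h).1]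
  solo_tr ρ h := by
    rw [← A.solo_tr ρ h, ← Finset.sum_fiberwise Finset.univ (relabel a') fun r => tr (A.solo r ρ)]
    refine Finset.sum_congr rfl fun r _ => ?_
    rw [LinearMap.sum_apply, tr_sum _ fun r₀ _ => ((A.solo_cp r₀).isPos h).1]
  final_tr c ρ h := A.final_tr _ ρ h
  finish_tr := A.finish_tr

/-- The memory of the simulated round, whose client has label `a'`: what is not used any more is
discarded, and the check value with index `a'`, which the simulated client has not received, is
`0`. -/
def advance (a' b : Fin C.m) (s : C.Mem) : C.Mem :=
  { s.discard a' b with cTag := fun i => if (a' : ℕ) < i then s.cTag i else 0 }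

theorem result_some_congr (a a' : Fin C.m) (u : ℕ) (b : Fin C.m) {r r₀ : C.ToClient}
    (h : r.1 = r₀.1) (c : C.ToServer) (sv : Option (Bool × ℕ)) (s : C.Mem) :
    result a u b (some (r, c)) sv s = result a' u b (some (r₀, c)) sv s := by
  simp [result, newU, h]

theorem serverTerm_sum {J : Type} (K : Finset J) (a : Fin C.m) (u : ℕ) (b : Fin C.m)
    (A : C.Strategy ι) (cl : Option (C.ToClient × C.ToServer)) (s s₁ : C.Mem)
    (L : J → Op (C.Sig × A.E₀) A.E₁) :
    serverTerm a u b A cl s s₁ (∑ k ∈ K, L k) = ∑ k ∈ K, serverTerm a u b A cl s s₁ (L k) := by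
  refine LinearMap.ext fun ρ => ?_
  simp only [serverTerm, LinearMap.sum_apply, LinearMap.smul_apply, LinearMap.comp_apply, map_sum]
  rw [← sum_rotate]
  refine Finset.sum_congr rfl fun x _ => Finset.sum_congr rfl fun v _ => ?_
  rw [← Finset.smul_sum, Finset.sum_comm]

theorem reactTerm_simulate (a a' : Fin C.m) (u : ℕ) (b : Fin C.m) (A : C.Strategy ι)
    (r : C.ToClient) (s : C.Mem) {c : C.ToServer} (hc : c.1 = true) (s₁ : C.Mem)
    (L : Op (C.Rcv × A.E₁) A.E₁) :
    reactTerm a' u b (simulate a a' A) r s c s₁ L =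
      ∑ r₀ with relabel a' r₀ = r, reactTerm a u b A r₀ s c s₁ L := by
  have hr : ∀ r₀ ∈ Finset.univ.filter (fun r₀ => relabel a' r₀ = r), r.1 = r₀.1 := by
    intro r₀ h
    rw [← (Finset.mem_filter.1 h).2, relabel_fst]
  have hcomp : ∀ {E F G : Type} (L : Op F G) (Q : C.ToClient → Op E F) (J : Finset C.ToClient),
      L ∘ₗ (∑ r₀ ∈ J, Q r₀) = ∑ r₀ ∈ J, L ∘ₗ Q r₀ := by
    intro E F G L Q J
    refine LinearMap.ext fun ρ => ?_
    simp only [LinearMap.comp_apply, LinearMap.sum_apply, map_sum]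
  have hfin : rejectAs a c = c := if_pos hc
  simp only [reactTerm, Finset.sum_add_distrib]
  congr 1
  · rw [hcomp]
    refine (serverTerm_sum _ a' u b (simulate a a' A) (some (r, c)) s s₁ _).trans ?_
    refine Finset.sum_congr rfl fun r₀ h => ?_
    simp only [serverTerm, Option.map_some, hfin, result_some_congr a' a u b (hr r₀ h)]
    rfl
  · refine LinearMap.ext fun ρ => ?_
    simp only [LinearMap.comp_apply, LinearMap.sum_apply, map_sum]
    refine Finset.sum_congr rfl fun r₀ h => ?_
    rw [result_some_congr a' a u b (hr r₀ h)]

theorem serverAccepts_congr {b : Fin C.m} {s s' : C.Mem} (hK : s.Kh = s'.Kh)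
    (hm : s.mask b = s'.mask b) (x : Bits C.n) (v : Fin C.n → Fin 3) (d : C.ToServer) :
    serverAccepts b s x v d = serverAccepts b s' x v d := by
  rw [serverAccepts, serverAccepts, decide_eq_decide, serverCV, serverCV, hK, hm]

theorem le_serverLabel (b : Fin C.m) (f : Bool) (c : C.ToServer) : (b : ℕ) ≤ serverLabel b f c := by
  unfold serverLabel; split_ifs <;> omega

theorem clientAccepts_advance {a a' : Fin C.m} (ha : (a' : ℕ) = a + 1) (b : Fin C.m) (s : C.Mem)
    (r : C.ToClient) :
    clientAccepts a' (advance a' b s) (relabel a' r) = true ↔ a < r.1 := by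
  rw [clientAccepts, decide_eq_true_iff, relabel_fst]
  simp only [Fin.lt_def, relabel, advance, lt_irrefl, if_false]
  constructor
  · rintro (h | ⟨h, -⟩)
    · omega
    · rw [h]; omega
  · intro h
    by_cases h' : r.1 = a'
    · right; simp [h']
    · left
      have : (r.1 : ℕ) ≠ a' := fun h'' => h' (Fin.ext h'')
      omega

/-- A client that accepts a label ahead of its own uses nothing that `advance` changes. -/
theorem acceptTerm_advance {a a' : Fin C.m} (ha : (a' : ℕ) = a + 1) (u : ℕ) (b : Fin C.m)
    (A : C.Strategy ι) (s : C.Mem) {r : C.ToClient} (hr : a < r.1) :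
    acceptTerm a u b A s r = ∑ k ∈ testChoices C, reactTerm a u b A r (advance a' b s)
      (clientResponse (max a' r.1) (advance a' b s) k.1 k.2)
      (clientUpdate (max a' r.1) (advance a' b s) k.1 k.2)
      (testMeasureL (C.g ((advance a' b s).cSeed (max a' r.1))) k.1) := by
  have hr' : a' ≤ r.1 := by rw [Fin.le_def, ha]; exact hr
  have hrn : (a' : ℕ) ≤ r.1 := hr'
  rw [max_eq_right hr', acceptTerm, max_eq_right hr.le]
  refine Finset.sum_congr rfl fun k _ => ?_
  have hmask : ∀ i : Fin C.m, min (a' : ℕ) b ≤ i → (advance a' b s).mask i = s.mask i :=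
    fun i hi => if_pos hi
  have h1 : clientResponse r.1 (advance a' b s) k.1 k.2 = clientResponse r.1 s k.1 k.2 := by
    simp only [clientResponse, hmask r.1 ((min_le_left _ _).trans hrn)]
    rfl
  have h2 : (advance a' b s).cSeed r.1 = s.cSeed r.1 := if_pos hrn
  have h3 : (advance a' b s).sSeed b = s.sSeed b := if_pos le_rfl
  have h4 : (advance a' b s).sTag b = s.sTag b := if_pos le_rfl
  have h5 : ∀ x v d, serverAccepts b (clientUpdate r.1 (advance a' b s) k.1 k.2) x v d =
      serverAccepts b (clientUpdate r.1 s k.1 k.2) x v d := by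
    exact fun x v d => serverAccepts_congr (s := clientUpdate r.1 (advance a' b s) k.1 k.2)
      (s' := clientUpdate r.1 s k.1 k.2) rfl (hmask b (min_le_right _ _)) x v d
  -- The memories differ only in what is discarded at the end of the round.
  have h6 : ∀ (f : Bool) (x : Bits C.n) (d : C.ToServer) (l : ℕ), (b : ℕ) ≤ l →
      Mem.discard (serverUpdate b f (clientUpdate r.1 (advance a' b s) k.1 k.2) x d) r.1 l =
      Mem.discard (serverUpdate b f (clientUpdate r.1 s k.1 k.2) x d) r.1 l := by
    intro f x d l hl
    refine Mem.ext ?_ ?_ ?_ ?_ ?_ ?_ ?_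
    · cases f <;> rfl
    · cases f <;> rfl
    · funext i
      have := fun h => hmask i (le_trans (min_le_min hrn hl) h)
      cases f <;> simp only [Mem.discard] <;> split_ifs with h <;> first | exact this h | rfl
    · funext i
      have : (r.1 : ℕ) ≤ i → (advance a' b s).cSeed i = s.cSeed i := fun h => if_pos (hrn.trans h)
      cases f <;> simp only [Mem.discard, serverUpdate, clientUpdate, Bool.false_eq_true, if_true,
        if_false, Function.update_apply] <;> split_ifs with h <;> first | exact this h | rfl
    · funext i
      have : (r.1 : ℕ) ≤ i → ¬ i = r.1 → (advance a' b s).cTag i = s.cTag i := fun h h' =>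
        if_pos (hrn.trans_lt (lt_of_le_of_ne h fun h'' => h' (Fin.ext h''.symm)))
      cases f <;> simp only [Mem.discard, serverUpdate, clientUpdate, Bool.false_eq_true, if_true,
        if_false, Function.update_apply] <;> split_ifs with h h' <;> first | rfl | exact this h h'
    · funext i
      have : l ≤ (i : ℕ) → (advance a' b s).sSeed i = s.sSeed i := fun h => if_pos (hl.trans h)
      cases f <;> simp only [Mem.discard, serverUpdate, clientUpdate, Bool.false_eq_true, if_true,
        if_false, Function.update_apply] <;> split_ifs with h <;> first | exact this h | rfl
    · funext i
      have : l ≤ (i : ℕ) → (advance a' b s).sTag i = s.sTag i := fun h => if_pos (hl.trans h)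
      cases f <;> simp only [Mem.discard, serverUpdate, clientUpdate, Bool.false_eq_true, if_true,
        if_false, Function.update_apply] <;> split_ifs with h <;> first | exact this h | rfl
  have h7 : ∀ (f : Bool) (x : Bits C.n) (d : C.ToServer),
      result a u b (some (r, clientResponse r.1 s k.1 k.2)) (some (f, serverLabel b f d))
        (serverUpdate b f (clientUpdate r.1 (advance a' b s) k.1 k.2) x d) =
      result a u b (some (r, clientResponse r.1 s k.1 k.2)) (some (f, serverLabel b f d))
        (serverUpdate b f (clientUpdate r.1 s k.1 k.2) x d) := by
    intro f x d
    exact Prod.ext rfl (h6 f x d _ (le_serverLabel b f d))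
  have h8 : result a u b (some (r, clientResponse r.1 s k.1 k.2)) none
        (clientUpdate r.1 (advance a' b s) k.1 k.2) =
      result a u b (some (r, clientResponse r.1 s k.1 k.2)) none
        (clientUpdate r.1 s k.1 k.2) :=
    Prod.ext rfl (h6 false 0 (true, b, ⟨∅, ∅, 0, C.fsyn ∅ 0, 0⟩) _ le_rfl)
  simp only [reactTerm, serverTerm, h1, h2, h3, h4, h5, h7, h8]

open scoped Classical in
/-- The part of the simulated round in which the client accepts is the part of the given round in
which the client receives a label ahead of its own. -/
theorem sum_acceptTerm_simulate {a a' : Fin C.m} (ha : (a' : ℕ) = a + 1) (u : ℕ) (b : Fin C.m)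
    (A : C.Strategy ι) (s : C.Mem) :
    (∑ r, if clientAccepts a' (advance a' b s) r
      then acceptTerm a' u b (simulate a a' A) (advance a' b s) r else 0) =
    ∑ r : C.ToClient, if a < r.1 then acceptTerm a u b A s r else 0 := by
  have h1 : ∀ r, acceptTerm a' u b (simulate a a' A) (advance a' b s) r =
      ∑ r₀ with relabel a' r₀ = r, ∑ k ∈ testChoices C, reactTerm a u b A r₀ (advance a' b s)
      (clientResponse (max a' r₀.1) (advance a' b s) k.1 k.2)
      (clientUpdate (max a' r₀.1) (advance a' b s) k.1 k.2)
      (testMeasureL (C.g ((advance a' b s).cSeed (max a' r₀.1))) k.1) := by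
    intro r
    rw [acceptTerm, Finset.sum_comm]
    refine Finset.sum_congr rfl fun k _ => ?_
    refine (reactTerm_simulate a a' u b A r (advance a' b s) rfl _ _).trans ?_
    refine Finset.sum_congr rfl fun r₀ h => ?_
    have : r.1 = r₀.1 := by rw [← (Finset.mem_filter.1 h).2, relabel_fst]
    rw [this]
  rw [← Finset.sum_fiberwise Finset.univ (relabel a') (fun r : C.ToClient =>
    if a < r.1 then acceptTerm a u b A s r else 0)]
  refine Finset.sum_congr rfl fun r _ => ?_
  rw [h1]
  split_ifs with h
  · refine Finset.sum_congr rfl fun r₀ h₀ => ?_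
    have hr : a < r₀.1 := by
      rw [← clientAccepts_advance ha b s, (Finset.mem_filter.1 h₀).2]; exact h
    rw [if_pos hr, acceptTerm_advance ha u b A s hr]
  · refine (Finset.sum_eq_zero fun r₀ h₀ => if_neg ?_).symm
    rw [← clientAccepts_advance ha b s, (Finset.mem_filter.1 h₀).2]; exact h

/-! ### The part of a round in which the client is left out or rejects -/

variable (C) in
/-- The classical data of a round in which the server takes part and the client is left out
(`false`) or made to reject (`true`): besides this alternative, the server's random choices and the
message that it receives. -/
abbrev QuietData := Bool × Bits C.n × (Fin C.n → Fin 3) × C.ToServer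

/-- The action of the adversary and of a client with label `a` that is left out, or made to reject
by a message whose label is not ahead. -/
def quietL (a : Fin C.m) (A : C.Strategy ι) (k : Bool) (tag : Bits C.lSV) (d : C.ToServer) :
    Op (C.Sig × A.E₀) A.E₂ :=
  if k then ∑ r : C.ToClient with r.1 ≤ a, ∑ w, A.final (some (false, a, w)) d ∘ₗ
    randomL C A.E₁ ∘ₗ A.call tag r
  else A.final none d ∘ₗ A.skip tag

/-- The outcome if the client is left out or rejects, in a round with `αᵁ = a + 1`, if the
server decides `f` and its label becomes `l`. -/
def quietOutcome (a : ℕ) (k f : Bool) (l : ℕ) : Outcome where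
  dC := if k then some false else none
  fS := some f
  α := if k then a + 1 else a
  αU := a + 1
  α' := l

/-- The outcome and memory, if the server decides `f`. -/
def quietResult (a b : Fin C.m) (f : Bool) (s : C.Mem) (j : QuietData C) : Outcome × C.Mem :=
  (quietOutcome a j.1 f (serverLabel b f j.2.2.2),
    (serverUpdate b f s j.2.1 j.2.2.2).discard (if j.1 then a + 1 else a)
      (serverLabel b f j.2.2.2))

/-- The unnormalised state of the adversary, with the probability of the server's choices. -/
def quietState (a b : Fin C.m) (A : C.Strategy ι) (s : C.Mem) (ρ : Matrix ι ι ℂ)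
    (j : QuietData C) : Matrix A.E₂ A.E₂ ℂ :=
  (choiceProb C j.2.2.1 : ℂ) •
    quietL a A j.1 (s.sTag b) j.2.2.2 (signalL A (s.sSeed b) j.2.1 j.2.2.1 ρ)

open scoped Classical in
/-- The part of the output in which `P` holds, if the server's decision is replaced by `f`. -/
def quietSum [Fintype Y] (a b : Fin C.m) (A : C.Strategy ι) (st : Y → C.Mem)
    (ρ : Y → Matrix ι ι ℂ) (P : Y → QuietData C → Prop) (f : Y → QuietData C → Bool) :
    Outcome × C.Mem → Matrix A.E₂ A.E₂ ℂ :=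
  ∑ y, ∑ j, if P y j
    then record (quietResult a b (f y j) (st y) j) (quietState a b A (st y) (ρ y) j) else 0

open scoped Classical in
/-- The probability that the client is left out or made to reject and `P` holds. -/
def quietMass [Fintype Y] (a b : Fin C.m) (A : C.Strategy ι) (st : Y → C.Mem)
    (ρ : Y → Matrix ι ι ℂ) (P : Y → QuietData C → Prop) : ℝ≥0∞ :=
  ∑ y, ∑ j, if P y j then tr (quietState a b A (st y) (ρ y) j) else 0

/-- The decision that the server actually takes. -/
def quietAccepts (b : Fin C.m) (st : Y → C.Mem) (y : Y) (j : QuietData C) : Bool :=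
  serverAccepts b (st y) j.2.1 j.2.2.1 j.2.2.2

/-- The outcome in which the server does not take part and the client rejects. -/
def soloOutcome (a b : ℕ) : Outcome where
  dC := some false
  fS := none
  α := a + 1
  αU := a + 1
  α' := b

/-- The action of the adversary and of a client that is made to reject, without the server. -/
def soloL (a : Fin C.m) (A : C.Strategy ι) : Op ι A.E₂ :=
  (∑ r : C.ToClient with r.1 ≤ a, ∑ w, A.finish (false, a, w) ∘ₗ randomL C A.E₁ ∘ₗ A.solo r) ∘ₗ
    A.start false

theorem isPos_quietL (a : Fin C.m) (A : C.Strategy ι) (k : Bool) (tag : Bits C.lSV)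
    (d : C.ToServer) {ρ : Matrix (C.Sig × A.E₀) (C.Sig × A.E₀) ℂ} (h : IsPos ρ) :
    IsPos (quietL a A k tag d ρ) := by
  unfold quietL
  split_ifs
  · simp only [LinearMap.sum_apply, LinearMap.comp_apply]
    exact isPos_sum _ fun r _ => isPos_sum _ fun w _ =>
      (A.final_cp _ _).isPos (isPos_randomL ((A.call_cp _ _).isPos h))
  · exact (A.final_cp _ _).isPos ((A.skip_cp _).isPos h)

theorem tr_quietL_true (a : Fin C.m) (A : C.Strategy ι) (tag : Bits C.lSV)
    (d : C.ToServer) {ρ : Matrix (C.Sig × A.E₀) (C.Sig × A.E₀) ℂ} (h : IsPos ρ) :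
    tr (quietL a A true tag d ρ) = ∑ r : C.ToClient with r.1 ≤ a, ∑ w,
      tr (A.final (some (false, a, w)) d (randomL C A.E₁ (A.call tag r ρ))) := by
  have hp := fun r w => (A.final_cp (some (false, a, w)) d).isPos
    (isPos_randomL ((A.call_cp tag r).isPos h))
  simp only [quietL, if_true, LinearMap.sum_apply, LinearMap.comp_apply]
  rw [tr_sum _ fun r _ => (isPos_sum _ fun w _ => hp r w).1]
  exact Finset.sum_congr rfl fun r _ => tr_sum _ fun w _ => (hp r w).1

theorem sum_tr_quietL_le (a : Fin C.m) (A : C.Strategy ι) (tag : Bits C.lSV)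
    {ρ : Matrix (C.Sig × A.E₀) (C.Sig × A.E₀) ℂ} (h : IsPos ρ) :
    ∑ k, ∑ d, tr (quietL a A k tag d ρ) ≤ tr ρ := by
  have h1 : ∑ d, tr (quietL a A true tag d ρ) =
      ∑ r : C.ToClient with r.1 ≤ a, tr (A.call tag r ρ) := by
    simp only [tr_quietL_true a A tag _ h]
    rw [Finset.sum_comm]
    refine Finset.sum_congr rfl fun r _ => ?_
    rw [Finset.sum_comm, ← sum_tr_randomL ((A.call_cp tag r).isPos h)]
    exact Finset.sum_congr rfl fun w _ => A.final_tr _ _ (isPos_randomL ((A.call_cp tag r).isPos h))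
  rw [Fintype.sum_bool, h1, ← A.react_tr tag ρ h, add_comm]
  refine add_le_add (le_of_eq (A.final_tr _ _ ((A.skip_cp _).isPos h))) ?_
  exact Finset.sum_le_sum_of_subset (Finset.filter_subset _ _)

theorem isPos_quietState (a b : Fin C.m) (A : C.Strategy ι) (s : C.Mem) {ρ : Matrix ι ι ℂ}
    (h : IsPos ρ) (j : QuietData C) : IsPos (quietState a b A s ρ j) :=
  (isPos_quietL a A _ _ _ (isPos_signalL A _ _ _ h)).smul (choiceProb_nonneg _)

theorem sum_tr_quietState_le (a b : Fin C.m) (A : C.Strategy ι) (s : C.Mem) {ρ : Matrix ι ι ℂ}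
    (h : IsPos ρ) : ∑ j, tr (quietState a b A s ρ j) ≤ tr ρ := by
  simp only [quietState, tr_smul (choiceProb_nonneg _)]
  rw [Fintype.sum_prod_type]
  simp only [Fintype.sum_prod_type]
  rw [Finset.sum_comm]
  simp_rw [Finset.sum_comm (s := (Finset.univ : Finset Bool))
    (t := (Finset.univ : Finset (Fin C.n → Fin 3)))]
  simp only [← Finset.mul_sum]
  calc _ ≤ ∑ x : Bits C.n, ∑ v, ENNReal.ofReal (choiceProb C v) * tr (A.start true ρ) := by
        refine Finset.sum_le_sum fun x _ => Finset.sum_le_sum fun v _ => mul_le_mul_right ?_ _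
        rw [← tr_signalL A (s.sSeed b) x v h]
        refine le_trans (le_of_eq ?_) (sum_tr_quietL_le a A (s.sTag b) (isPos_signalL A _ x v h))
        simp only [Fintype.sum_prod_type]
    _ ≤ tr ρ := by
        simp only [← Finset.sum_mul, sum_choiceProb, one_mul]
        rw [← A.start_tr ρ h, Fintype.sum_bool]
        exact le_self_add

theorem hasMass_quietSum [Fintype Y] (a b : Fin C.m) (A : C.Strategy ι) (st : Y → C.Mem)
    {ρ : Y → Matrix ι ι ℂ} (h : ∀ y, IsPos (ρ y)) (P : Y → QuietData C → Prop)
    (f : Y → QuietData C → Bool) :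
    HasMass (quietSum a b A st ρ P f) (quietMass a b A st ρ P) := by
  refine hasMass_sum _ fun y _ => hasMass_sum _ fun j _ => ?_
  split_ifs
  · exact hasMass_record _ (isPos_quietState a b A (st y) (h y) j).1
  · exact hasMass_zero

theorem isPos_soloL (a : Fin C.m) (A : C.Strategy ι) {ρ : Matrix ι ι ℂ} (h : IsPos ρ) :
    IsPos (soloL a A ρ) := by
  simp only [soloL, LinearMap.comp_apply, LinearMap.sum_apply]
  exact isPos_sum _ fun r _ => isPos_sum _ fun w _ => (A.finish_cp _).isPos
    (isPos_randomL ((A.solo_cp _).isPos ((A.start_cp _).isPos h)))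

theorem record_sum {K : Type} (J : Finset K) (val : X) (ρ : K → Matrix ι ι ℂ) :
    record val (∑ k ∈ J, ρ k) = ∑ k ∈ J, record val (ρ k) :=
  map_sum (recordL val) ρ J

theorem record_smul (val : X) (c : ℂ) (ρ : Matrix ι ι ℂ) : record val (c • ρ) = c • record val ρ :=
  map_smul (recordL val) c ρ

theorem sum_quietData {V : Type*} [AddCommMonoid V] (f : QuietData C → V) :
    ∑ j, f j = (∑ x, ∑ v, ∑ d, f (false, x, v, d)) + ∑ x, ∑ v, ∑ d, f (true, x, v, d) := by
  rw [Fintype.sum_prod_type, Fintype.sum_bool, add_comm]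
  simp only [Fintype.sum_prod_type]

theorem serverTerm_skip_eq {a : Fin C.m} {u : ℕ} (hu : u = a + 1) (b : Fin C.m)
    (A : C.Strategy ι) (s : C.Mem) (ρ : Matrix ι ι ℂ) :
    serverTerm a u b A none s s (A.skip (s.sTag b)) ρ =
      ∑ x, ∑ v, ∑ d, record (quietResult a b (serverAccepts b s x v d) s (false, x, v, d))
        (quietState a b A s ρ (false, x, v, d)) := by
  subst hu
  simp only [serverTerm, LinearMap.sum_apply, LinearMap.smul_apply, LinearMap.comp_apply,
    recordL_apply, quietState, record_smul, Finset.smul_sum]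
  rfl

theorem sum_rejectTerm_eq {a : Fin C.m} {u : ℕ} (hu : u = a + 1) (b : Fin C.m)
    (A : C.Strategy ι) (s : C.Mem) (ρ : Matrix ι ι ℂ) :
    ∑ r : C.ToClient with r.1 ≤ a, rejectTerm a u b A s r ρ =
      (∑ x, ∑ v, ∑ d, record (quietResult a b (serverAccepts b s x v d) s (true, x, v, d))
        (quietState a b A s ρ (true, x, v, d))) +
      record (soloOutcome a b, s.discard (a + 1) b) (soloL a A ρ) := by
  subst hu
  have h1 : ∀ (r : C.ToClient) w sv s₁, result a ((a : ℕ) + 1) b (some (r, (false, a, w))) sv s₁ =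
      ({ dC := some false, fS := sv.map fun p => p.1, α := a + 1, αU := a + 1,
         α' := (sv.map fun p => p.2).getD b },
        s₁.discard (a + 1) ((sv.map fun p => p.2).getD b)) := by
    intro r w sv s₁
    simp [result, newU, clientLabel]
  simp only [rejectTerm, reactTerm, LinearMap.sum_apply, LinearMap.add_apply,
    Finset.sum_add_distrib]
  congr 1
  · simp only [serverTerm, LinearMap.sum_apply, LinearMap.smul_apply, LinearMap.comp_apply,
      recordL_apply, h1, Option.map_some, Option.getD_some, quietState, record_smul, quietL,
      if_true, record_sum, ← Finset.smul_sum]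
    refine (Finset.sum_congr rfl fun r _ => (sum_rotate (A := Bits C.n) (B := Fin C.n → Fin 3)
      Finset.univ _).symm).trans ?_
    rw [← sum_rotate (A := Bits C.n) (B := Fin C.n → Fin 3)]
    refine Finset.sum_congr rfl fun x _ => Finset.sum_congr rfl fun v _ => ?_
    simp only [← Finset.smul_sum]
    congr 1
    rw [Finset.sum_comm (s := Finset.univ)]
    refine Finset.sum_congr rfl fun r _ => ?_
    rw [Finset.sum_comm]
    rfl
  · simp only [soloL, LinearMap.sum_apply, LinearMap.comp_apply, recordL_apply, h1, Option.map_none,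
      Option.getD_none, record_sum]
    rfl

/-! ### Ideal families -/

/-- For every outcome, the memory and the adversary's system are in an ideal state for the labels
of the outcome. -/
def IsIdealFamily (Ω : Outcome × C.Mem → Matrix ι ι ℂ) : Prop :=
  ∀ o, IsIdealPart o.α o.αU o.α' fun s => Ω (o, s)

theorem isIdealFamily_zero : IsIdealFamily (0 : Outcome × C.Mem → Matrix ι ι ℂ) :=
  fun _ => isIdealPart_zero _ _ _

theorem IsIdealFamily.add {Ω Ω' : Outcome × C.Mem → Matrix ι ι ℂ} (h : IsIdealFamily Ω)
    (h' : IsIdealFamily Ω') : IsIdealFamily (Ω + Ω') := fun o => (h o).add (h' o)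

theorem IsIdealFamily.smul {Ω : Outcome × C.Mem → Matrix ι ι ℂ} (h : IsIdealFamily Ω) {c : ℝ}
    (hc : 0 ≤ c) : IsIdealFamily ((c : ℂ) • Ω) := fun o => (h o).smul hc

theorem isIdealFamily_sum {K : Type} (J : Finset K) {Ω : K → Outcome × C.Mem → Matrix ι ι ℂ}
    (h : ∀ k ∈ J, IsIdealFamily (Ω k)) : IsIdealFamily (∑ k ∈ J, Ω k) := by
  classical
  induction J using Finset.induction_on with
  | empty => simpa using isIdealFamily_zero
  | insert k J hk ih =>
    rw [Finset.sum_insert hk]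
    exact (h k (by simp)).add (ih fun k' hk' => h k' (by simp [hk']))

theorem isIdealFamily_record [Fintype Y] (o : Outcome) (st : Y → C.Mem) (ρ : Y → Matrix ι ι ℂ)
    (h : IsIdealPart o.α o.αU o.α' (ensemble st ρ)) :
    IsIdealFamily (∑ y, record (o, st y) (ρ y)) := by
  classical
  intro o'
  by_cases ho : o = o'
  · subst ho
    convert h using 2 with s
    rw [Finset.sum_apply, ensemble]
    refine Finset.sum_congr rfl fun y _ => ?_
    simp [record]
  · convert isIdealPart_zero o'.α o'.αU o'.α' using 2 with s
    rw [Finset.sum_apply]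
    refine Finset.sum_eq_zero fun y _ => ?_
    simp [record, ho]

/-- The lost values after the labels have grown: previously secret seeds are added. -/
def leak (lo : ℕ) (p : C.Lost) (sd : Fin C.m → Bits C.lSeed) : C.Lost :=
  { p with
    cSeed := fun i => if lo ≤ i then sd i else p.cSeed i
    sSeed := fun i => if lo ≤ i then sd i else p.sSeed i }

/-- Discarding, when the labels grow to `a₂`, `l`, gives a memory of the form of an ideal state for
the new labels. The seeds between `max (a + 1) b` and `max (a + 1) l` are then counted as lost. -/
theorem discard_assemble {a a₂ b l : ℕ} (ha : a₂ = a ∨ a₂ = a + 1) (hl : b ≤ l) (z : C.Secrets)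
    (p : C.Lost) (M' : PAMsg C.n) :
    (assemble a (a + 1) b z p M').discard a₂ l = assemble a₂ (a + 1) l z
      (leak (max (a + 1) b) p (lowSeeds (max (a + 1) l) z.seed)) M' := by
  rcases ha with rfl | rfl <;> refine Mem.ext rfl rfl ?_ ?_ ?_ ?_ ?_ <;> funext i <;>
    simp only [assemble, Mem.discard, leak, lowSeeds, true_and] <;>
    split_ifs <;> first | rfl | omega

theorem oracleIdx_of_grow {a a₂ b l i : ℕ} (ha : a₂ = a ∨ a₂ = a + 1) (hl : b ≤ l)
    (h : oracleIdx a₂ (a + 1) l i) : oracleIdx a (a + 1) b i := by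
  unfold oracleIdx at *; omega

theorem lt_of_oracleIdx_of_grow {a a₂ b l i : ℕ} (ha : a₂ = a ∨ a₂ = a + 1)
    (h : oracleIdx a (a + 1) b i) (h' : ¬ oracleIdx a₂ (a + 1) l i) : i < min a₂ l := by
  unfold oracleIdx at *; omega

/-- The memory in a branch of an ideal state. -/
def idealMem (a u b : ℕ) (y : Branch C) : C.Mem := assemble a u b y.1 y.2.1 y.2.2.2

/-- The unnormalised state of the adversary in a branch of an ideal state. -/
def idealState (a u b : ℕ) (σ : C.Lost → (Fin C.m → HashMsg C.n C.Syn) →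
    (Fin C.m → Bits C.lCV) → PAMsg C.n → Matrix ι ι ℂ) (y : Branch C) : Matrix ι ι ℂ :=
  ((((Fintype.card C.Secrets : ℝ)⁻¹ : ℝ)) : ℂ) • σ y.2.1 y.2.2.1 (reply a u b y.1 y.2.2.1) y.2.2.2

variable {σ : C.Lost → (Fin C.m → HashMsg C.n C.Syn) → (Fin C.m → Bits C.lCV) → PAMsg C.n →
  Matrix ι ι ℂ}

theorem isPos_idealState (hσ : ∀ p M t M', IsPos (σ p M t M')) (a u b : ℕ) (y : Branch C) :
    IsPos (idealState a u b σ y) :=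
  (hσ _ _ _ _).smul (by positivity)

theorem isIdealFamily_solo (hσ : ∀ p M t M', IsPos (σ p M t M')) (a b : Fin C.m)
    (A : C.Strategy ι) :
    IsIdealFamily (∑ y, record (soloOutcome a b, (idealMem a (a + 1) b y).discard (a + 1) b)
      (soloL a A (idealState a (a + 1) b σ y))) := by
  refine isIdealFamily_record _ _ _ ?_
  have := isIdealPart_coarsen (a := a) (u := a + 1) (b := b) (a₂ := a + 1) (b₂ := b)
    (fun p _ M t M' => soloL a A (σ p M t M')) (fun _ _ _ _ _ => isPos_soloL a A (hσ _ _ _ _))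
    (leak (max (a + 1) b)) (fun i => oracleIdx_of_grow (Or.inr rfl) le_rfl)
    (fun i => lt_of_oracleIdx_of_grow (Or.inr rfl))
  have hst : (fun y => (idealMem a (a + 1) b y).discard (a + 1) b) = fun y : Branch C =>
      assemble (a + 1) (a + 1) b y.1
        (leak (max (a + 1) b) y.2.1 (lowSeeds (max (a + 1) b) y.1.seed)) y.2.2.2 :=
    funext fun y => discard_assemble (Or.inr rfl) le_rfl _ _ _
  have hρ : (fun y => soloL a A (idealState a (a + 1) b σ y)) = fun y : Branch C =>
      ((((Fintype.card C.Secrets : ℝ)⁻¹ : ℝ)) : ℂ) •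
        soloL a A (σ y.2.1 y.2.2.1 (reply a (a + 1) b y.1 y.2.2.1) y.2.2.2) :=
    funext fun y => map_smul _ _ _
  rw [hst, hρ]
  exact this

/-- The server accepts a replayed tag. Apart from the server's choices, this is determined by what
the adversary has seen. -/
def IsReplayAccepted (a u : ℕ) (b : Fin C.m) (M : Fin C.m → HashMsg C.n C.Syn)
    (t : Fin C.m → Bits C.lCV) (j : QuietData C) : Prop :=
  IsReplay a u b M t j.2.1 j.2.2.2.2.2 ∧ serverPE j.2.1 j.2.2.1 j.2.2.2.2.2 ∧
    receivedLabel j.2.2.2 ≤ b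

theorem serverAccepts_iff {b : Fin C.m} {s : C.Mem} {x : Bits C.n} {v : Fin C.n → Fin 3}
    {d : C.ToServer} : serverAccepts b s x v d = true ↔
      serverPE x v d.2.2 ∧ serverCV b s x d.2.2 ∧ receivedLabel d ≤ b := by
  simp only [serverAccepts, decide_eq_true_eq]

theorem lt_serverLabel (b : Fin C.m) (d : C.ToServer) : (b : ℕ) < serverLabel b false d := by
  simp only [serverLabel, Bool.false_eq_true, if_false]
  split_ifs <;> omega

theorem serverCV_of_isReplay {a u : ℕ} {b : Fin C.m} (y : Branch C) {x : Bits C.n}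
    {w : Body C.n C.lCV C.Syn} (h : IsReplay a u b y.2.2.1 (reply a u b y.1 y.2.2.1) x w) :
    serverCV b (idealMem a u b y) x w := by
  have hm : (idealMem a u b y).mask b = y.1.mask b := if_pos (min_le_right _ _)
  have hK : (idealMem a u b y).Kh = y.1.Kh := rfl
  rw [serverCV, hm, hK, h.2.2, reply, if_pos h.1, h.2.1]

theorem isReplayAccepted_iff {a u : ℕ} {b : Fin C.m} (y : Branch C) (j : QuietData C) :
    IsReplayAccepted a u b y.2.2.1 (reply a u b y.1 y.2.2.1) j ↔
      quietAccepts b (idealMem a u b) y j = true ∧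
        IsReplay a u b y.2.2.1 (reply a u b y.1 y.2.2.1) j.2.1 j.2.2.2.2.2 := by
  rw [quietAccepts, serverAccepts_iff]
  exact ⟨fun h => ⟨⟨h.2.1, serverCV_of_isReplay y h.1, h.2.2⟩, h.1⟩,
    fun h => ⟨h.2, h.1.1, h.1.2.2⟩⟩

/-- If the server is forced to reject, except that the branches in which it accepts a replayed tag
are dropped, then the output is ideal. -/
theorem isIdealFamily_quietSum (hσ : ∀ p M t M', IsPos (σ p M t M')) (a b : Fin C.m)
    (A : C.Strategy ι) :
    IsIdealFamily (quietSum a b A (idealMem a (a + 1) b) (idealState a (a + 1) b σ)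
      (fun y j => ¬ IsReplayAccepted a (a + 1) b y.2.2.1 (reply a (a + 1) b y.1 y.2.2.1) j)
      fun _ _ => false) := by
  classical
  rw [quietSum, Finset.sum_comm]
  refine isIdealFamily_sum _ fun j _ => ?_
  obtain ⟨k, x, v, d⟩ := j
  set l := serverLabel b false d
  have hbl : (b : ℕ) < l := lt_serverLabel b d
  set a₂ : ℕ := if k then a + 1 else a with ha₂
  have ha : a₂ = a ∨ a₂ = a + 1 := by cases k <;> simp [ha₂]
  have := isIdealPart_coarsen (a := a) (u := a + 1) (b := b) (a₂ := a₂) (b₂ := l)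
    (fun p sd M t M' => if ¬ IsReplayAccepted a (a + 1) b M t (k, x, v, d) then
      (choiceProb C v : ℂ) • quietL a A k (p.sTag b) d
        (signalL A (if max ((a : ℕ) + 1) b ≤ b then sd b else p.sSeed b) x v (σ p M t M')) else 0)
    (fun p sd M t M' => by
      split
      · exact (isPos_quietL a A _ _ _ (isPos_signalL A _ _ _ (hσ _ _ _ _))).smul
          (choiceProb_nonneg _)
      · exact isPos_zero)
    (leak (max (a + 1) b)) (fun i => oracleIdx_of_grow ha hbl.le)
    (fun i => lt_of_oracleIdx_of_grow ha)
  have h2 := isIdealFamily_record (quietOutcome a k false l) _ _ this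
  convert h2 using 2 with y
  have hsd : (idealMem a (a + 1) b y).sSeed b = if max ((a : ℕ) + 1) b ≤ b then
      lowSeeds (max (a + 1) l) y.1.seed b else y.2.1.sSeed b := by
    have : (b : ℕ) < max ((a : ℕ) + 1) l := lt_max_of_lt_right hbl
    simp only [idealMem, assemble, Mem.discard, le_refl, if_true, lowSeeds, if_pos this]
  have htag : (idealMem a (a + 1) b y).sTag b = y.2.1.sTag b := if_pos le_rfl
  have hmem : quietResult a b false (idealMem a (a + 1) b y) (k, x, v, d) =
      (quietOutcome a k false l, assemble a₂ (a + 1) l y.1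
        (leak (max (a + 1) b) y.2.1 (lowSeeds (max (a + 1) l) y.1.seed)) y.2.2.2) :=
    Prod.ext rfl (discard_assemble ha hbl.le _ _ _)
  rw [hmem, quietState, hsd, htag]
  by_cases h : IsReplayAccepted a (a + 1) b y.2.2.1 (reply a (a + 1) b y.1 y.2.2.1) (k, x, v, d)
  · rw [if_neg (not_not.2 h), if_neg (not_not.2 h), smul_zero]
    exact (map_zero (recordL _)).symm
  · rw [if_pos h, if_pos h]
    refine congrArg _ ?_
    simp only [idealState, map_smul]
    rw [smul_comm]

/-- The input of the simulated round is ideal for the labels `a + 1`, `a + 1`, `b`. -/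
theorem isIdealPart_advance (hσ : ∀ p M t M', IsPos (σ p M t M')) {a a' : Fin C.m}
    (ha : (a' : ℕ) = a + 1) (b : Fin C.m) :
    IsIdealPart (a + 1) (a + 1) b (ensemble (fun y => advance a' b (idealMem a (a + 1) b y))
      (idealState a (a + 1) b σ)) := by
  have := isIdealPart_coarsen (a := a) (u := a + 1) (b := b) (a₂ := a + 1) (b₂ := b)
    (fun p _ M t M' => σ p M t M') (fun _ _ _ _ _ => hσ _ _ _ _)
    (fun p sd => { leak (max (a + 1) b) p sd with
      cTag := fun i => if (a' : ℕ) < i then p.cTag i else 0 })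
    (fun i => oracleIdx_of_grow (Or.inr rfl) le_rfl)
    (fun i => lt_of_oracleIdx_of_grow (Or.inr rfl))
  rw [show (fun y => advance a' b (idealMem a (a + 1) b y)) = _ from funext fun y => ?_]
  · exact this
  have h1 := discard_assemble (a := a) (Or.inr rfl) (le_refl (b : ℕ)) y.1 y.2.1 y.2.2.2
  have h2 : advance a' b (idealMem a (a + 1) b y) = { (idealMem a (a + 1) b y).discard (a + 1) b
      with cTag := fun i => if (a' : ℕ) < i then (idealMem a (a + 1) b y).cTag i else 0 } := by
    rw [advance, ha]
  rw [h2]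
  have h3 := congrArg Mem.mask h1
  have h4 := congrArg Mem.cSeed h1
  have h5 := congrArg Mem.sSeed h1
  have h6 := congrArg Mem.sTag h1
  refine Mem.ext rfl rfl h3 h4 ?_ h5 h6
  funext i
  simp only [idealMem, assemble, Mem.discard, ha]
  split_ifs <;> first | rfl | omega

/-! ### The probabilities of the deviations from the ideal output -/

theorem tr_idealState (y : Branch C) (a u b : ℕ) :
    tr (idealState a u b σ y) = ENNReal.ofReal (Fintype.card C.Secrets : ℝ)⁻¹ *
      tr (σ y.2.1 y.2.2.1 (reply a u b y.1 y.2.2.1) y.2.2.2) :=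
  tr_smul (by positivity) _

/-- The client accepts a label that is not ahead only if the check value is guessed. -/
theorem sum_callMass_le (hPA : IsUniformHash fun R M => (C.hPA R M).1)
    (hσ : ∀ p M t M', IsPos (σ p M t M')) (a b : Fin C.m) (A : C.Strategy ι) :
    ∑ y : Branch C, callMass A ((idealMem a (a + 1) b y).sTag b) ((idealMem a (a + 1) b y).sSeed b)
        (a, (idealMem a (a + 1) b y).cTag a) (idealState a (a + 1) b σ y) ≤
      ENNReal.ofReal (1 / 2 ^ C.lSV) * ∑ y, tr (idealState a (a + 1) b σ y) := by
  rw [Fintype.sum_prod_type_right, Fintype.sum_prod_type_right (f := fun y => tr _), Finset.mul_sum]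
  refine Finset.sum_le_sum fun ⟨p, M, M'⟩ _ => ?_
  have htag : ∀ z, (idealMem a (a + 1) b (z, p, M, M')).cTag a = (C.hPA z.R M').1 := by
    intro z
    simp [idealMem, assemble, Mem.discard]
  have hsd : ∀ z, (idealMem a (a + 1) b (z, p, M, M')).sSeed b =
      if max ((a : ℕ) + 1) b ≤ b then z.seed b else p.sSeed b := fun z => if_pos le_rfl
  have hst : ∀ z, (idealMem a (a + 1) b (z, p, M, M')).sTag b = p.sTag b := fun z => if_pos le_rfl
  simp only [htag, hsd, hst]
  refine (sum_checkValue hPA a (a + 1) b M M' (fun t sd T => callMass A (p.sTag b)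
    (if max ((a : ℕ) + 1) b ≤ b then sd b else p.sSeed b) (a, T)
    (((((Fintype.card C.Secrets : ℝ)⁻¹ : ℝ)) : ℂ) • σ p M t M'))).le.trans ?_
  refine mul_le_mul_right (Finset.sum_le_sum fun z _ => ?_) _
  rw [← skip_add_sum_callMass A (p.sTag b) (if max ((a : ℕ) + 1) b ≤ b then z.seed b else p.sSeed b)
    (isPos_idealState hσ a (a + 1) b (z, p, M, M')),
    Fintype.sum_prod_type (f := fun r => callMass _ _ _ r _)]
  refine le_trans ?_ le_add_self
  exact Finset.single_le_sum (f := fun i => ∑ T, callMass A (p.sTag b)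
    (if max ((a : ℕ) + 1) b ≤ b then z.seed b else p.sSeed b) (i, T)
      (idealState a (a + 1) b σ (z, p, M, M'))) (fun _ _ => zero_le) (Finset.mem_univ a)

theorem quietMass_forge_le {εMAC : ℝ} (hMAC : IsAlmostXORUniversal εMAC C.h₁) (hMAC0 : 0 ≤ εMAC)
    (hσ : ∀ p M t M', IsPos (σ p M t M')) (a b : Fin C.m) (A : C.Strategy ι) :
    quietMass a b A (idealMem a (a + 1) b) (idealState a (a + 1) b σ)
        (fun y j => quietAccepts b (idealMem a (a + 1) b) y j = true ∧
          ¬ IsReplay a (a + 1) b y.2.2.1 (reply a (a + 1) b y.1 y.2.2.1) j.2.1 j.2.2.2.2.2) ≤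
      ENNReal.ofReal (1 / 2 ^ C.lCV + εMAC) * ∑ y, tr (idealState a (a + 1) b σ y) := by
  classical
  refine le_trans ?_ (mul_le_mul_right (Finset.sum_le_sum fun y _ => sum_tr_quietState_le a b A
    (idealMem a (a + 1) b y) (isPos_idealState hσ a (a + 1) b y)) _)
  rw [quietMass, Finset.sum_comm, Finset.sum_comm (s := (Finset.univ : Finset (Branch C))),
    Finset.mul_sum]
  refine Finset.sum_le_sum fun j _ => ?_
  rw [Fintype.sum_prod_type_right, Fintype.sum_prod_type_right (f := fun y => tr _), Finset.mul_sum]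
  refine Finset.sum_le_sum fun ⟨p, M, M'⟩ _ => ?_
  have hsd : ∀ z, (idealMem a (a + 1) b (z, p, M, M')).sSeed b =
      if max ((a : ℕ) + 1) b ≤ b then z.seed b else p.sSeed b := fun z => if_pos le_rfl
  have hst : ∀ z, (idealMem a (a + 1) b (z, p, M, M')).sTag b = p.sTag b := fun z => if_pos le_rfl
  set F : (Fin C.m → Bits C.lCV) → (Fin C.m → Bits C.lSeed) → ℝ≥0∞ := fun t sd =>
    tr ((choiceProb C j.2.2.1 : ℂ) • quietL a A j.1 (p.sTag b) j.2.2.2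
      (signalL A (if max ((a : ℕ) + 1) b ≤ b then sd b else p.sSeed b) j.2.1 j.2.2.1
        (((((Fintype.card C.Secrets : ℝ)⁻¹ : ℝ)) : ℂ) • σ p M t M'))) with hF
  have hq : ∀ z, tr (quietState a b A (idealMem a (a + 1) b (z, p, M, M'))
      (idealState a (a + 1) b σ (z, p, M, M')) j) = F (reply a (a + 1) b z M) z.seed := by
    intro z
    rw [quietState, hsd, hst, hF, idealState]
  simp only [hq]
  clear_value F
  refine le_trans (Finset.sum_le_sum fun z _ => ?_)
    (sum_forge_le hMAC hMAC0 a (a + 1) b M j.2.1 j.2.2.2.2.2 F)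
  split_ifs with h1 h2 h2
  · exact le_rfl
  · refine absurd ⟨?_, h1.2⟩ h2
    have h3 := h1.1
    rw [quietAccepts, serverAccepts_iff] at h3
    have hm : (idealMem a (a + 1) b (z, p, M, M')).mask b = z.mask b := if_pos (min_le_right _ _)
    have h4 := h3.2.1
    rw [serverCV, hm] at h4
    exact h4
  · exact zero_le
  · exact le_rfl

/-! ### Comparison of the two rounds -/

theorem indicator_eq_of_eq_add {S : Set X} {Γ Γ₁ Γ₂ : X → Matrix ι ι ℂ} (h : Γ = Γ₁ + Γ₂)
    (h₁ : ∀ x ∉ S, Γ₁ x = 0) (h₂ : ∀ x ∈ S, Γ₂ x = 0) : S.indicator Γ = Γ₁ := by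
  classical
  funext x
  rw [Set.indicator_apply, h, Pi.add_apply]
  split_ifs with hx
  · rw [h₂ x hx, add_zero]
  · exact (h₁ x hx).symm

theorem indicator_sum {K : Type*} (J : Finset K) (S : Set X) (Ω : K → X → Matrix ι ι ℂ) :
    S.indicator (∑ k ∈ J, Ω k) = ∑ k ∈ J, S.indicator (Ω k) :=
  map_sum (Set.indicatorHom (Matrix ι ι ℂ) S) Ω J

theorem sum_ite_or_add {R V : Type*} [Fintype R] [DecidableEq R] [AddCommMonoid V] (p : R → Prop)
    [DecidablePred p] (r₀ : R) (h : ¬ p r₀) (f g : R → V) :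
    (∑ r, if p r ∨ r = r₀ then f r else g r) + g r₀ =
      (∑ r with p r, f r) + f r₀ + ∑ r with ¬ p r, g r := by
  have hf := Finset.sum_ite_eq' Finset.univ r₀ f
  have hg := Finset.sum_ite_eq' Finset.univ r₀ g
  rw [if_pos (Finset.mem_univ _)] at hf hg
  rw [add_right_comm, ← Finset.sum_ite, ← hf, ← hg, ← Finset.sum_add_distrib,
    ← Finset.sum_add_distrib]
  refine Finset.sum_congr rfl fun r _ => ?_
  by_cases hr : r = r₀
  · subst hr
    simp [h, add_comm]
  · simp [hr]

theorem clientAccepts_iff (a : Fin C.m) (s : C.Mem) (r : C.ToClient) :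
    clientAccepts a s r = true ↔ a < r.1 ∨ r = (a, s.cTag a) := by
  rw [clientAccepts, decide_eq_true_iff, Prod.ext_iff]
  exact or_congr Iff.rfl (and_congr Iff.rfl eq_comm)

open scoped Classical in
theorem round_ensemble [Fintype Y] (a : Fin C.m) (u : ℕ) (b : Fin C.m) (A : C.Strategy ι)
    (st : Y → C.Mem) {ρ : Y → Matrix ι ι ℂ} (h : ∀ y, IsPos (ρ y)) :
    round a u b A (ensemble st ρ) =
      ∑ y, (serverTerm a u b A none (st y) (st y) (A.skip ((st y).sTag b)) (ρ y) +
        ∑ r, if clientAccepts a (st y) r then acceptTerm a u b A (st y) r (ρ y)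
          else rejectTerm a u b A (st y) r (ρ y)) := by
  rw [round_eq a u b A (isPos_ensemble h)]
  rw [sum_ensemble st ρ fun s => serverTerm a u b A none s s (A.skip (s.sTag b)) +
      ∑ r, if clientAccepts a s r then acceptTerm a u b A s r else rejectTerm a u b A s r]
  refine Finset.sum_congr rfl fun y _ => ?_
  rw [LinearMap.add_apply, LinearMap.sum_apply]
  congr 1
  refine Finset.sum_congr rfl fun r _ => ?_
  split_ifs <;> rfl

/-- The round, up to an exchange of the two reactions of the client to its own check value. -/
theorem round_add_sum_rejectTerm [Fintype Y] {a : Fin C.m} {u : ℕ} (hu : u = a + 1) (b : Fin C.m)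
    (A : C.Strategy ι) (st : Y → C.Mem) {ρ : Y → Matrix ι ι ℂ} (h : ∀ y, IsPos (ρ y)) :
    round a u b A (ensemble st ρ) + ∑ y, rejectTerm a u b A (st y) (a, (st y).cTag a) (ρ y) =
      (∑ y, ∑ r : C.ToClient with a < r.1, acceptTerm a u b A (st y) r (ρ y)) +
      (∑ y, acceptTerm a u b A (st y) (a, (st y).cTag a) (ρ y)) +
      (quietSum a b A st ρ (fun _ _ => True) (quietAccepts b st) +
        ∑ y, record (soloOutcome a b, (st y).discard (a + 1) b) (soloL a A (ρ y))) := by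
  classical
  rw [round_ensemble a u b A st h, quietSum, ← Finset.sum_add_distrib, ← Finset.sum_add_distrib,
    ← Finset.sum_add_distrib, ← Finset.sum_add_distrib]
  refine Finset.sum_congr rfl fun y _ => ?_
  simp only [clientAccepts_iff, if_true]
  rw [add_assoc, sum_ite_or_add (fun r : C.ToClient => a < r.1) (a, (st y).cTag a) (lt_irrefl a),
    sum_quietData, serverTerm_skip_eq hu]
  simp only [not_lt]
  rw [sum_rejectTerm_eq hu b A (st y) (ρ y)]
  simp only [quietAccepts]
  abel

/-- The server's actual decisions are replaced by rejections, up to an exchange of the accepting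
branches outside `P` and except for the accepting branches in `P`, which are dropped. -/
theorem quietSum_add [Fintype Y] (a b : Fin C.m) (A : C.Strategy ι) (st : Y → C.Mem)
    (ρ : Y → Matrix ι ι ℂ) (f : Y → QuietData C → Bool) (P : Y → QuietData C → Prop) :
    quietSum a b A st ρ (fun _ _ => True) f +
        quietSum a b A st ρ (fun y j => f y j = true ∧ ¬ P y j) (fun _ _ => false) =
      quietSum a b A st ρ (fun y j => ¬ (f y j = true ∧ P y j)) (fun _ _ => false) +
        (quietSum a b A st ρ (fun y j => f y j = true ∧ ¬ P y j) (fun _ _ => true) +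
          quietSum a b A st ρ (fun y j => f y j = true ∧ P y j) fun _ _ => true) := by
  classical
  simp only [quietSum, ← Finset.sum_add_distrib]
  refine Finset.sum_congr rfl fun y _ => Finset.sum_congr rfl fun j _ => ?_
  by_cases hf : f y j = true <;> by_cases hP : P y j <;> simp [hf, hP, add_comm]

/-- The outcomes in which the client accepts. -/
def clientAcceptance : Set (Outcome × C.Mem) := {x | x.1.dC = some true}

/-- The outcomes in which the server accepts although the client does not. -/
def loneServerAcceptance : Set (Outcome × C.Mem) :=
  {x | x.1.dC ≠ some true ∧ x.1.fS = some true}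

theorem record_apply_of_ne {val x : X} (h : val ≠ x) (ρ : Matrix ι ι ℂ) : record val ρ x = 0 :=
  if_neg h

theorem serverTerm_apply_eq_zero (a : Fin C.m) (u : ℕ) (b : Fin C.m) (A : C.Strategy ι)
    (cl : Option (C.ToClient × C.ToServer)) (s s₁ : C.Mem) (L : Op (C.Sig × A.E₀) A.E₁)
    (ρ : Matrix ι ι ℂ) {o : Outcome × C.Mem} (ho : o.1.dC ≠ cl.map fun p => p.2.1) :
    serverTerm a u b A cl s s₁ L ρ o = 0 := by
  simp only [serverTerm, LinearMap.sum_apply, LinearMap.smul_apply, LinearMap.comp_apply,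
    recordL_apply, Finset.sum_apply, Pi.smul_apply]
  refine Finset.sum_eq_zero fun x _ => Finset.sum_eq_zero fun v _ => ?_
  rw [Finset.sum_eq_zero, smul_zero]
  exact fun d _ => record_apply_of_ne (fun h => ho (by rw [← h]; rfl)) _

theorem reactTerm_apply_eq_zero (a : Fin C.m) (u : ℕ) (b : Fin C.m) (A : C.Strategy ι)
    (r : C.ToClient) (s : C.Mem) (c : C.ToServer) (s₁ : C.Mem) (L : Op (C.Rcv × A.E₁) A.E₁)
    (ρ : Matrix ι ι ℂ) {o : Outcome × C.Mem} (ho : o.1.dC ≠ some c.1) :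
    reactTerm a u b A r s c s₁ L ρ o = 0 := by
  rw [reactTerm, LinearMap.add_apply, Pi.add_apply, serverTerm_apply_eq_zero _ _ _ _ _ _ _ _ _ ho,
    zero_add]
  exact record_apply_of_ne (fun h => ho (by rw [← h]; rfl)) _

theorem acceptTerm_apply_eq_zero (a : Fin C.m) (u : ℕ) (b : Fin C.m) (A : C.Strategy ι) (s : C.Mem)
    (r : C.ToClient) (ρ : Matrix ι ι ℂ) {o : Outcome × C.Mem} (ho : o.1.dC ≠ some true) :
    acceptTerm a u b A s r ρ o = 0 := by
  rw [acceptTerm, LinearMap.sum_apply, Finset.sum_apply]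
  exact Finset.sum_eq_zero fun k _ => reactTerm_apply_eq_zero _ _ _ _ _ _ _ _ _ _ ho

theorem rejectTerm_apply_eq_zero (a : Fin C.m) (u : ℕ) (b : Fin C.m) (A : C.Strategy ι) (s : C.Mem)
    (r : C.ToClient) (ρ : Matrix ι ι ℂ) {o : Outcome × C.Mem} (ho : o.1.dC ≠ some false) :
    rejectTerm a u b A s r ρ o = 0 := by
  rw [rejectTerm, LinearMap.sum_apply, Finset.sum_apply]
  exact Finset.sum_eq_zero fun k _ => reactTerm_apply_eq_zero _ _ _ _ _ _ _ _ _ _ ho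

/-- Where the client accepts, the simulated round agrees with the part of the given round in which
the client receives a label ahead of its own. -/
theorem indicator_round_simulate [Fintype Y] {a a' : Fin C.m} (ha : (a' : ℕ) = a + 1) (u : ℕ)
    (b : Fin C.m) (A : C.Strategy ι) (st : Y → C.Mem) {ρ : Y → Matrix ι ι ℂ}
    (h : ∀ y, IsPos (ρ y)) :
    clientAcceptance.indicator
        (round a' u b (simulate a a' A) (ensemble (fun y => advance a' b (st y)) ρ)) =
      ∑ y, ∑ r : C.ToClient with a < r.1, acceptTerm a u b A (st y) r (ρ y) := by
  classical
  have h1 : ∀ y, (∑ r : C.ToClient with a < r.1, acceptTerm a u b A (st y) r (ρ y)) =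
      ∑ r, if clientAccepts a' (advance a' b (st y)) r
        then acceptTerm a' u b (simulate a a' A) (advance a' b (st y)) r (ρ y) else 0 := by
    intro y
    have := congrArg (fun L => L (ρ y)) (sum_acceptTerm_simulate ha u b A (st y))
    simp only [LinearMap.sum_apply] at this
    rw [Finset.sum_filter]
    refine Eq.trans ?_ (this.symm.trans ?_) <;> refine Finset.sum_congr rfl fun r _ => ?_ <;>
      split_ifs <;> rfl
  have hΓ : round a' u b (simulate a a' A) (ensemble (fun y => advance a' b (st y)) ρ) =
      (∑ y, ∑ r : C.ToClient with a < r.1, acceptTerm a u b A (st y) r (ρ y)) +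
      ∑ y, (serverTerm a' u b (simulate a a' A) none (advance a' b (st y)) (advance a' b (st y))
        ((simulate a a' A).skip ((advance a' b (st y)).sTag b)) (ρ y) +
        ∑ r, if clientAccepts a' (advance a' b (st y)) r then 0
          else rejectTerm a' u b (simulate a a' A) (advance a' b (st y)) r (ρ y)) := by
    refine (round_ensemble a' u b (simulate a a' A) (fun y => advance a' b (st y)) h).trans ?_
    rw [← Finset.sum_add_distrib]
    refine Finset.sum_congr rfl fun y _ => ?_
    rw [h1, add_left_comm, ← Finset.sum_add_distrib]
    congr 1
    refine Finset.sum_congr rfl fun r _ => ?_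
    split_ifs
    · rw [add_zero]
    · rw [zero_add]
  refine indicator_eq_of_eq_add hΓ (fun o ho => ?_) fun o ho => ?_
  · rw [Finset.sum_apply]
    refine Finset.sum_eq_zero fun y _ => ?_
    rw [Finset.sum_apply]
    exact Finset.sum_eq_zero fun r _ => acceptTerm_apply_eq_zero _ _ _ _ _ _ _ ho
  · have ho : o.1.dC = some true := ho
    rw [Finset.sum_apply]
    refine Finset.sum_eq_zero fun y _ => ?_
    rw [Pi.add_apply, Finset.sum_apply,
      serverTerm_apply_eq_zero _ _ _ _ _ _ _ _ _ (by simp [ho]), zero_add]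
    refine Finset.sum_eq_zero fun r _ => ?_
    split_ifs
    · rfl
    · exact rejectTerm_apply_eq_zero _ _ _ _ _ _ _ (by simp [ho])

theorem indicator_record (S : Set X) (val : X) (ρ : Matrix ι ι ℂ) [Decidable (val ∈ S)] :
    S.indicator (record val ρ) = if val ∈ S then record val ρ else 0 := by
  classical
  funext x
  rw [Set.indicator_apply]
  by_cases hx : val = x
  · subst hx
    split_ifs <;> rfl
  · rw [record_apply_of_ne hx, ite_self]
    split_ifs
    · exact (record_apply_of_ne hx ρ).symm
    · rfl

theorem indicator_smul (S : Set X) (c : ℂ) (Ω : X → Matrix ι ι ℂ) :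
    S.indicator (c • Ω) = c • S.indicator Ω := Set.indicator_const_smul S c Ω

/-- The probability that the server accepts after the client's message `c`. -/
def acceptMass (b : Fin C.m) (A : C.Strategy ι) (c : Option C.ToServer) (sd : Bits C.lSeed)
    (s₁ : C.Mem) (L : Op (C.Sig × A.E₀) A.E₁) (ρ : Matrix ι ι ℂ) : ℝ≥0∞ :=
  ∑ x : Bits C.n, ∑ v : Fin C.n → Fin 3, ENNReal.ofReal (choiceProb C v) * ∑ d : C.ToServer,
    if serverAccepts b s₁ x v d then tr (A.final c d (L (signalL A sd x v ρ))) else 0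

theorem hasMass_indicator_serverTerm (a : Fin C.m) (u : ℕ) (b : Fin C.m) (A : C.Strategy ι)
    {cl : Option (C.ToClient × C.ToServer)} (hcl : (cl.map fun p => p.2.1) ≠ some true)
    (s s₁ : C.Mem) {L : Op (C.Sig × A.E₀) A.E₁} (hL : ∀ ρ, IsPos ρ → IsPos (L ρ))
    {ρ : Matrix ι ι ℂ} (h : IsPos ρ) :
    HasMass (loneServerAcceptance.indicator (serverTerm a u b A cl s s₁ L ρ))
      (acceptMass b A (cl.map Prod.snd) (s.sSeed b) s₁ L ρ) := by
  classical
  have hmem : ∀ (f : Bool) (l : ℕ) (s₂ : C.Mem),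
      result a u b cl (some (f, l)) s₂ ∈ loneServerAcceptance ↔ f = true := by
    intro f l s₂
    simp only [loneServerAcceptance, Set.mem_ofPred_eq, result, Option.map_some, Option.some.injEq]
    exact and_iff_right hcl
  simp only [serverTerm, LinearMap.sum_apply, LinearMap.smul_apply, LinearMap.comp_apply,
    recordL_apply, indicator_sum, indicator_smul, indicator_record, hmem]
  refine hasMass_sum _ fun x _ => hasMass_sum _ fun v _ => ?_
  refine HasMass.smul (hasMass_sum _ fun d _ => ?_) (choiceProb_nonneg v)
  split_ifs
  · exact hasMass_record _ ((A.final_cp _ _).isPos (hL _ (isPos_signalL A _ x v h))).1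
  · exact hasMass_zero

theorem hasMass_indicator_rejectTerm (a : Fin C.m) (u : ℕ) (b : Fin C.m) (A : C.Strategy ι)
    (s : C.Mem) (r : C.ToClient) {ρ : Matrix ι ι ℂ} (h : IsPos ρ) :
    HasMass (loneServerAcceptance.indicator (rejectTerm a u b A s r ρ))
      (∑ w, acceptMass b A (some (false, a, w)) (s.sSeed b) s
        (randomL C A.E₁ ∘ₗ A.call (s.sTag b) r) ρ) := by
  rw [rejectTerm, LinearMap.sum_apply, indicator_sum]
  refine hasMass_sum _ fun w _ => ?_
  have hsolo : loneServerAcceptance.indicator ((recordL (result a u b (some (r, (false, a, w))) none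
      s) ∘ₗ A.finish (false, a, w) ∘ₗ randomL C A.E₁ ∘ₗ A.solo r ∘ₗ A.start false) ρ) = 0 := by
    classical
    rw [LinearMap.comp_apply, recordL_apply, indicator_record, if_neg]
    exact fun h' => absurd h'.2 (by simp [result])
  rw [reactTerm, LinearMap.add_apply, Set.indicator_add', hsolo, add_zero]
  exact hasMass_indicator_serverTerm a u b A (by simp) s s
    (fun σ hσ => isPos_randomL ((A.call_cp _ _).isPos hσ)) h

theorem sum_simulate_call {a a' : Fin C.m} (ha : (a' : ℕ) = a + 1) (A : C.Strategy ι)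
    (tag : Bits C.lSV) {r : C.ToClient} (hr : r.1 ≤ a) :
    (simulate a a' A).call tag r = A.call tag r := by
  have hne : ∀ r₀ : C.ToClient, r₀.1 ≤ a → r₀.1 ≠ a' := by
    intro r₀ h h'
    rw [Fin.le_def, h'] at h
    omega
  have : (Finset.univ.filter fun r₀ : C.ToClient => relabel a' r₀ = r) = {r} := by
    ext r₀
    simp only [Finset.mem_filter, Finset.mem_univ, true_and, Finset.mem_singleton]
    constructor
    · intro h
      have h1 : r₀.1 ≤ a := by rw [← relabel_fst a' r₀, h]; exact hr
      rwa [relabel, if_neg (hne r₀ h1)] at h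
    · rintro rfl
      exact if_neg (hne r₀ hr)
  show ∑ r₀ with relabel a' r₀ = r, A.call tag r₀ = _
  rw [this, Finset.sum_singleton]

/-- In the simulated round, the server accepts at least as often without the client as it does in
the given round if the client rejects all labels that are not ahead. -/
theorem sum_acceptMass_le [Fintype Y] {a a' : Fin C.m} (ha : (a' : ℕ) = a + 1) (u : ℕ)
    (b : Fin C.m) (A : C.Strategy ι) (st : Y → C.Mem) {ρ : Y → Matrix ι ι ℂ}
    (h : ∀ y, IsPos (ρ y)) :
    ∑ y, (acceptMass b A none ((st y).sSeed b) (st y) (A.skip ((st y).sTag b)) (ρ y) +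
      ∑ r : C.ToClient with r.1 ≤ a, ∑ w, acceptMass b A (some (false, a, w)) ((st y).sSeed b)
        (st y) (randomL C A.E₁ ∘ₗ A.call ((st y).sTag b) r) (ρ y)) ≤
    cqTr (loneServerAcceptance.indicator
      (round a' u b (simulate a a' A) (ensemble (fun y => advance a' b (st y)) ρ))) := by
  classical
  have hacc : ∀ (s : C.Mem) (r : C.ToClient) (σ : Matrix ι ι ℂ),
      loneServerAcceptance.indicator (acceptTerm a' u b (simulate a a' A) s r σ) = 0 := by
    intro s r σ
    funext o
    rw [Set.indicator_apply]
    split_ifs with ho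
    · exact acceptTerm_apply_eq_zero _ _ _ _ _ _ _ ho.1
    · rfl
  have hm := hasMass_sum (Finset.univ : Finset Y) fun y _ =>
    (hasMass_indicator_serverTerm a' u b (simulate a a' A) (cl := none) (by simp)
      (advance a' b (st y)) (advance a' b (st y))
      (fun σ hσ => ((simulate a a' A).skip_cp ((advance a' b (st y)).sTag b)).isPos hσ)
      (h y)).add (hasMass_sum (Finset.univ.filter fun r : C.ToClient =>
        ¬ clientAccepts a' (advance a' b (st y)) r = true) fun r _ =>
        hasMass_indicator_rejectTerm a' u b (simulate a a' A) (advance a' b (st y)) r (h y))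
  refine le_trans ?_ (le_of_eq (hm.2.symm.trans (congrArg cqTr (Eq.trans ?_ (congrArg _
      (round_ensemble a' u b (simulate a a' A) (fun y => advance a' b (st y)) h).symm)))))
  swap
  · rw [indicator_sum]
    refine Finset.sum_congr rfl fun y _ => ?_
    rw [Set.indicator_add', indicator_sum]
    refine congrArg₂ (· + ·) rfl ((Finset.sum_filter _ _).trans ?_)
    refine Finset.sum_congr rfl fun r _ => ?_
    by_cases hr : clientAccepts a' (advance a' b (st y)) r = true
    · rw [if_neg (not_not.2 hr), if_pos hr, hacc]
    · rw [if_pos hr, if_neg hr]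
  have hv : ∀ s x v d, serverAccepts b (advance a' b s) x v d = serverAccepts b s x v d :=
    fun s => serverAccepts_congr rfl (if_pos (min_le_right _ _))
  have hs : ∀ s, (advance a' b s).sSeed b = s.sSeed b := fun s => if_pos le_rfl
  have ht : ∀ s, (advance a' b s).sTag b = s.sTag b := fun s => if_pos le_rfl
  refine Finset.sum_le_sum fun y _ => add_le_add (le_of_eq ?_) ?_
  · simp only [acceptMass, hv, hs, ht]
    rfl
  · refine le_trans (le_of_eq (Finset.sum_congr rfl fun r hr => ?_))
      (Finset.sum_le_sum_of_subset (s := Finset.univ.filter fun r : C.ToClient => r.1 ≤ a) ?_)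
    · rw [sum_simulate_call ha A _ (Finset.mem_filter.1 hr).2]
      simp only [acceptMass, hv, hs, ht]
      rfl
    · intro r hr
      have hr := (Finset.mem_filter.1 hr).2
      have hne : relabel a' r = r := if_neg fun h' => by
        rw [Fin.le_def, h'] at hr
        omega
      rw [Finset.mem_filter]
      refine ⟨Finset.mem_univ _, fun hacc' => ?_⟩
      rw [← hne, clientAccepts_advance ha] at hacc'
      exact absurd hr (not_le.2 hacc')

theorem quietMass_accepts_le [Fintype Y] (a b : Fin C.m) (A : C.Strategy ι) (st : Y → C.Mem)
    {ρ : Y → Matrix ι ι ℂ} (h : ∀ y, IsPos (ρ y)) (P : Y → QuietData C → Prop) :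
    quietMass a b A st ρ (fun y j => quietAccepts b st y j = true ∧ P y j) ≤
    ∑ y, (acceptMass b A none ((st y).sSeed b) (st y) (A.skip ((st y).sTag b)) (ρ y) +
      ∑ r : C.ToClient with r.1 ≤ a, ∑ w, acceptMass b A (some (false, a, w)) ((st y).sSeed b)
        (st y) (randomL C A.E₁ ∘ₗ A.call ((st y).sTag b) r) (ρ y)) := by
  classical
  refine Finset.sum_le_sum fun y _ => ?_
  have h1 : (∑ j, if quietAccepts b st y j = true ∧ P y j then
      tr (quietState a b A (st y) (ρ y) j) else 0) ≤ ∑ j, if quietAccepts b st y j = true then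
      tr (quietState a b A (st y) (ρ y) j) else 0 := by
    refine Finset.sum_le_sum fun j _ => ?_
    split_ifs with h1 h2 h2
    · exact le_rfl
    · exact absurd h1.1 h2
    · exact zero_le
    · exact le_rfl
  refine (le_of_eq ?_).trans (h1.trans (le_of_eq ?_))
  · exact Finset.sum_congr rfl fun j _ => by congr
  rw [sum_quietData]
  have htr : ∀ k x v d, tr (quietState a b A (st y) (ρ y) (k, x, v, d)) =
      ENNReal.ofReal (choiceProb C v) * tr (quietL a A k ((st y).sTag b) d
        (signalL A ((st y).sSeed b) x v (ρ y))) := fun k x v d => tr_smul (choiceProb_nonneg _) _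
  simp only [quietAccepts, htr, ← mul_ite_zero, ← Finset.mul_sum]
  congr 1
  have hq := fun x v d => tr_quietL_true a A ((st y).sTag b) d
    (isPos_signalL A ((st y).sSeed b) x v (h y))
  simp only [hq, acceptMass]
  refine Eq.trans ?_ (Finset.sum_congr rfl fun r _ => sum_rotate Finset.univ _)
  refine Eq.trans ?_ (sum_rotate _ _)
  refine Finset.sum_congr rfl fun x _ => Finset.sum_congr rfl fun v _ => ?_
  simp only [← Finset.mul_sum]
  congr 1
  rw [← Finset.sum_filter]
  rw [Finset.sum_comm]
  refine Finset.sum_congr rfl fun r _ => ?_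
  rw [Finset.sum_comm]
  refine Finset.sum_congr rfl fun w _ => ?_
  rw [Finset.sum_filter]
  rfl

/-! ### The ideal output of a round -/

theorem serverLabel_le (b : Fin C.m) (d : C.ToServer) : serverLabel b false d ≤ C.m := by
  have hb := b.2
  have hd := d.2.1.2
  simp only [serverLabel, receivedLabel, Bool.false_eq_true, if_false]
  split_ifs <;> omega

theorem add_add_eq_of_cancel {V : Type*} [AddCommGroup V] {Γ A B W Q S N K P E : V}
    (h₁ : Γ + B = W + A + (Q + S)) (h₂ : Q + N = K + (P + E)) :
    Γ + (B + N) = W + (K + S) + (A + P + E) := by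
  calc Γ + (B + N) = Γ + B + N := by abel
    _ = W + A + S + (Q + N) := by rw [h₁]; abel
    _ = W + (K + S) + (A + P + E) := by rw [h₂]; abel

/-- A family that vanishes except on ideal outcomes in which the client does not accept. -/
def IsQuiet (C : Params) (a b : ℕ) (Ω : Outcome × C.Mem → Matrix ι ι ℂ) : Prop :=
  ∀ o s, ¬ (C.Allowed a (a + 1) b o ∧ o.dC ≠ some true) → Ω (o, s) = 0

theorem isQuiet_record {a b : ℕ} {o : Outcome} (h : C.Allowed a (a + 1) b o) (h' : o.dC ≠ some true)
    (s : C.Mem) (ρ : Matrix ι ι ℂ) : IsQuiet C a b (record (o, s) ρ) := fun _ _ hn =>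
  record_apply_of_ne (fun he => hn (by cases he; exact ⟨h, h'⟩)) ρ

theorem IsQuiet.add {a b : ℕ} {Ω Ω' : Outcome × C.Mem → Matrix ι ι ℂ} (h : IsQuiet C a b Ω)
    (h' : IsQuiet C a b Ω') : IsQuiet C a b (Ω + Ω') := fun o s hn => by
  rw [Pi.add_apply, h o s hn, h' o s hn, add_zero]

theorem IsQuiet.smul {a b : ℕ} {Ω : Outcome × C.Mem → Matrix ι ι ℂ} (h : IsQuiet C a b Ω) (c : ℂ) :
    IsQuiet C a b (c • Ω) := fun o s hn => by
  rw [Pi.smul_apply, h o s hn, smul_zero]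

theorem isQuiet_sum {K : Type*} {a b : ℕ} (J : Finset K) {Ω : K → Outcome × C.Mem → Matrix ι ι ℂ}
    (h : ∀ k, IsQuiet C a b (Ω k)) : IsQuiet C a b (∑ k ∈ J, Ω k) := fun o s hn => by
  rw [Finset.sum_apply]
  exact Finset.sum_eq_zero fun k _ => h k o s hn

theorem allowed_soloOutcome (a b : ℕ) : C.Allowed a (a + 1) b (soloOutcome a b) :=
  ⟨rfl, rfl, rfl⟩

theorem isQuiet_solo [Fintype Y] (a b : ℕ) (st : Y → C.Mem) (ρ : Y → Matrix ι ι ℂ) :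
    IsQuiet C a b (∑ y, record (soloOutcome a b, st y) (ρ y)) :=
  isQuiet_sum _ fun _ => isQuiet_record (allowed_soloOutcome a b) (by simp [soloOutcome]) _ _

theorem isQuiet_quietSum [Fintype Y] (a b : Fin C.m) (A : C.Strategy ι) (st : Y → C.Mem)
    (ρ : Y → Matrix ι ι ℂ) (P : Y → QuietData C → Prop) :
    IsQuiet C a b (quietSum a b A st ρ P fun _ _ => false) := by
  classical
  refine isQuiet_sum _ fun y => isQuiet_sum _ fun j => ?_
  split_ifs
  · obtain ⟨k, x, v, d⟩ := j
    have h1 : (b : ℕ) + 1 ≤ serverLabel b false d := lt_serverLabel b d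
    cases k
    · refine isQuiet_record ?_ (by simp [quietOutcome]) _ _
      exact ⟨rfl, rfl, h1, serverLabel_le b d⟩
    · refine isQuiet_record ?_ (by simp [quietOutcome]) _ _
      exact ⟨rfl, rfl, h1, serverLabel_le b d⟩
  · exact fun _ _ _ => rfl

theorem allowed_of_allowed_succ {a b : ℕ} {o : Outcome} (h : C.Allowed (a + 1) (a + 1) b o)
    (ho : o.dC = some true) : C.Allowed a (a + 1) b o := by
  obtain ⟨dC, fS, α, αU, α'⟩ := o
  subst ho
  rcases fS with _ | _ | _ <;> simp only [Allowed] at h ⊢ <;> omega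

theorem not_allowed_of_fS {a u b : ℕ} {o : Outcome} (h : o.dC ≠ some true) (h' : o.fS = some true) :
    ¬ C.Allowed a u b o := by
  obtain ⟨dC, fS, α, αU, α'⟩ := o
  subst h'
  rcases dC with _ | _ | _ <;> simp_all [Allowed]

theorem IsIdealPart.isPos {a u b : ℕ} {ω : C.Mem → Matrix ι ι ℂ} (h : IsIdealPart a u b ω)
    (s : C.Mem) : IsPos (ω s) := by
  obtain ⟨σ, hσ, rfl⟩ := h.exists_ensemble
  exact isPos_ensemble (fun y => (hσ _ _ _ _).smul (by positivity)) s

theorem IsIdealOutput.isPos {a u b : ℕ} {Ω : Outcome × C.Mem → Matrix ι ι ℂ}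
    (h : IsIdealOutput a u b Ω) (x : Outcome × C.Mem) : IsPos (Ω x) := by
  obtain ⟨o, s⟩ := x
  by_cases ho : C.Allowed a u b o
  · exact (h.1 o ho).isPos s
  · rw [h.2.1 o ho]
    exact isPos_zero

/-- Some ideal state of trace one in which the server does not take part and the client rejects. -/
theorem exists_solo {a a' : Fin C.m} (ha : (a' : ℕ) = a + 1) (b : Fin C.m) {ρ₀ : Matrix ι ι ℂ}
    (h : IsPos ρ₀) (h0 : tr ρ₀ ≠ 0) : ∃ R₀ : Outcome × C.Mem → Matrix ι ι ℂ,
      IsIdealFamily R₀ ∧ IsQuiet C a b R₀ ∧ HasMass R₀ 1 := by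
  set σ : C.Lost → (Fin C.m → HashMsg C.n C.Syn) → (Fin C.m → Bits C.lCV) → PAMsg C.n →
    Matrix ι ι ℂ := fun _ _ _ _ => ρ₀
  have hσ : ∀ p M t M', IsPos (σ p M t M') := fun _ _ _ _ => h
  set st : Branch C → C.Mem := fun y => advance a' b (idealMem a (a + 1) b y)
  set R : Outcome × C.Mem → Matrix ι ι ℂ := ∑ y, record (soloOutcome a b, st y)
    (idealState a (a + 1) b σ y)
  have hR : IsIdealFamily R := isIdealFamily_record _ _ _ (isIdealPart_advance hσ ha b)
  have hm : HasMass R (∑ y : Branch C, tr (idealState a (a + 1) b σ y)) :=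
    hasMass_sum _ fun y _ => hasMass_record _ (isPos_idealState hσ a (a + 1) b y).1
  set T := ∑ y : Branch C, tr (idealState a (a + 1) b σ y) with hT
  have hTf : T ≠ ∞ := ENNReal.sum_ne_top.2 fun y _ => (isPos_idealState hσ a (a + 1) b y).2
  have hS : Nonempty C.Secrets := ⟨⟨Classical.arbitrary _, Classical.arbitrary _, 0, 0⟩⟩
  have hT0 : T ≠ 0 := by
    have hy : Nonempty (Branch C) := ⟨hS.some, ⟨0, 0, 0, 0⟩,
      fun _ => ⟨∅, ∅, 0, 0, C.fsyn ∅ 0⟩, ⟨∅, 0⟩⟩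
    rw [hT, ne_eq, Finset.sum_eq_zero_iff]
    intro h'
    have h1 := h' hy.some (Finset.mem_univ _)
    rw [tr_idealState, mul_eq_zero, ENNReal.ofReal_eq_zero] at h1
    rcases h1 with h1 | h1
    · have : (0 : ℝ) < (Fintype.card C.Secrets : ℝ)⁻¹ :=
        inv_pos.2 (Nat.cast_pos.2 Fintype.card_pos)
      linarith
    · exact h0 h1
  refine ⟨((T.toReal⁻¹ : ℝ) : ℂ) • R, hR.smul (by positivity),
    (isQuiet_solo _ _ _ _).smul _, (hm.smul (by positivity)).congr ?_⟩
  rw [ENNReal.ofReal_inv_of_pos (ENNReal.toReal_pos hT0 hTf), ENNReal.ofReal_toReal hTf,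
    ENNReal.inv_mul_cancel hT0 hTf]

/-- The ideal output for the simulated round where the client accepts, combined with ideal parts in
which it does not, is an ideal output for the given round. -/
theorem isIdealOutput_indicator_add {a b : ℕ} {Ω' R : Outcome × C.Mem → Matrix ι ι ℂ}
    (hΩ' : IsIdealOutput (a + 1) (a + 1) b Ω') (hR : IsIdealFamily R) (hR' : IsQuiet C a b R)
    (hm : HasMass (clientAcceptance.indicator Ω' + R) 1) :
    IsIdealOutput a (a + 1) b (clientAcceptance.indicator Ω' + R) := by
  classical
  refine ⟨fun o _ => ?_, fun o ho s => ?_, hm.2⟩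
  · by_cases hC : o.dC = some true
    · have : (fun s => (clientAcceptance.indicator Ω' + R) (o, s)) = fun s => Ω' (o, s) := by
        funext s
        rw [Pi.add_apply, hR' o s fun h => h.2 hC, add_zero]
        exact Set.indicator_of_mem (show (o, s) ∈ clientAcceptance from hC) Ω'
      rw [this]
      by_cases h' : C.Allowed (a + 1) (a + 1) b o
      · exact hΩ'.1 o h'
      · rw [show (fun s => Ω' (o, s)) = 0 from funext (hΩ'.2.1 o h')]
        exact isIdealPart_zero _ _ _
    · have : (fun s => (clientAcceptance.indicator Ω' + R) (o, s)) = fun s => R (o, s) := by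
        funext s
        rw [Pi.add_apply, Set.indicator_of_notMem (show (o, s) ∉ clientAcceptance from hC),
          zero_add]
      rw [this]
      exact hR o
  · rw [Pi.add_apply, hR' o s fun h => ho h.1, add_zero, Set.indicator_apply]
    split_ifs with hC
    · exact hΩ'.2.1 o (fun h => ho (allowed_of_allowed_succ h hC)) s
    · rfl

/-- Security for the next client label implies security for the given one. -/
theorem secureFor_of_succ {a a' b : Fin C.m} (ha : (a' : ℕ) = a + 1) {εMAC ε : ℝ}
    (hMAC : IsAlmostXORUniversal εMAC C.h₁) (hMAC0 : 0 ≤ εMAC)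
    (hPA : IsUniformHash fun R M => (C.hPA R M).1) (hε : 0 ≤ ε)
    (hsec : C.SecureFor a' (a + 1) b ε) :
    C.SecureFor a (a + 1) b (ε + (1 / 2 ^ C.lSV + (1 / 2 ^ C.lCV + εMAC))) := by
  classical
  intro ι ω hω A
  obtain ⟨σ, hσ, hens⟩ := hω.1.exists_ensemble
  have hρ := fun y => isPos_idealState hσ a (a + 1) b y
  have hens : ω = ensemble (idealMem a (a + 1) b) (idealState a (a + 1) b σ) := hens
  have hmass : ∑ y, tr (idealState a (a + 1) b σ y) = 1 := by
    rw [← cqTr_ensemble (st := idealMem a (a + 1) b) hρ, ← hens]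
    exact hω.2
  have hin : IsInput a' (a + 1) b (ensemble (fun y => advance a' b (idealMem a (a + 1) b y))
      (idealState a (a + 1) b σ)) := by
    refine ⟨?_, (cqTr_ensemble hρ).trans hmass⟩
    rw [ha]
    exact isIdealPart_advance hσ ha b
  obtain ⟨Ω', hΩ', hdist⟩ : ∃ Ω' : Outcome × C.Mem → Matrix A.E₂ A.E₂ ℂ,
      IsIdealOutput a' (a + 1) b Ω' ∧ traceDist (round a' (a + 1) b (simulate a a' A)
        (ensemble (fun y => advance a' b (idealMem a (a + 1) b y))
          (idealState a (a + 1) b σ))) Ω' ≤ ENNReal.ofReal ε :=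
    hsec ι _ hin (simulate a a' A)
  rw [ha] at hΩ'
  set st := idealMem (C := C) a (a + 1) b
  set ρ := idealState a (a + 1) b σ
  set rep : Branch C → QuietData C → Prop := fun y j =>
    IsReplay a (a + 1) b y.2.2.1 (reply a (a + 1) b y.1 y.2.2.1) j.2.1 j.2.2.2.2.2
  set R := quietSum a b A st ρ (fun y j => ¬ (quietAccepts b st y j = true ∧ rep y j))
      (fun _ _ => false) +
    ∑ y, record (soloOutcome a b, (st y).discard (a + 1) b) (soloL a A (ρ y))
  have hRideal : IsIdealFamily R := by
    refine IsIdealFamily.add ?_ (isIdealFamily_solo hσ a b A)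
    have : (fun (y : Branch C) (j : QuietData C) => ¬ (quietAccepts b st y j = true ∧ rep y j)) =
        fun y j => ¬ IsReplayAccepted a (a + 1) b y.2.2.1 (reply a (a + 1) b y.1 y.2.2.1) j :=
      funext fun y => funext fun j => by rw [isReplayAccepted_iff]
    rw [this]
    exact isIdealFamily_quietSum hσ a b A
  have hRquiet : IsQuiet C a b R := (isQuiet_quietSum a b A st ρ _).add (isQuiet_solo _ _ _ _)
  have hRm : HasMass R _ := (hasMass_quietSum a b A st hρ _ _).add (hasMass_sum Finset.univ
    fun y _ => hasMass_record _ (isPos_soloL a A (hρ y)).1)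
  -- The state `R₀` is only needed to make up for missing trace.
  obtain ⟨x₀, hx₀⟩ : ∃ x, tr (Ω' x) ≠ 0 := by
    by_contra! h
    have := hΩ'.2.2
    rw [cqTr, ENNReal.tsum_eq_zero.2 h] at this
    exact zero_ne_one this
  obtain ⟨R₀, hR₀ideal, hR₀quiet, hR₀m⟩ := exists_solo ha b (hΩ'.isPos x₀) hx₀
  have hΓm : HasMass (round a (a + 1) b A ω) 1 :=
    (hasMass_round a (a + 1) b A fun s => hω.1.isPos s).congr hω.2
  have hΓm' : HasMass (round a' (a + 1) b (simulate a a' A)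
      (ensemble (fun y => advance a' b (st y)) ρ)) 1 :=
    (hasMass_round a' (a + 1) b (simulate a a' A) (isPos_ensemble hρ)).congr hin.2
  have hacc := hasMass_sum Finset.univ fun y (_ : y ∈ Finset.univ) =>
    hasMass_acceptTerm a (a + 1) b A (st y) (a, (st y).cTag a) (hρ y)
  have hrej := hasMass_sum Finset.univ fun y (_ : y ∈ Finset.univ) =>
    hasMass_rejectTerm a (a + 1) b A (st y) (a, (st y).cTag a) (hρ y)
  have hD₁ := hacc.add (hasMass_quietSum a b A st hρ
    (fun y j => quietAccepts b st y j = true ∧ ¬ rep y j) fun _ _ => true)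
  have hD₂ := hrej.add (hasMass_quietSum a b A st hρ
    (fun y j => quietAccepts b st y j = true ∧ ¬ rep y j) fun _ _ => false)
  have hE := hasMass_quietSum a b A st hρ (fun y j => quietAccepts b st y j = true ∧ rep y j)
    fun _ _ => true
  have hp := add_le_add (sum_callMass_le hPA hσ a b A) (quietMass_forge_le hMAC hMAC0 hσ a b A)
  rw [hmass, mul_one, mul_one, ← ENNReal.ofReal_add (by positivity) (by positivity)] at hp
  have h1 := round_add_sum_rejectTerm (a := a) rfl b A st hρ
  have h2 := quietSum_add a b A st ρ (quietAccepts b st) rep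
  rw [← hens] at h1
  have hE₂ := (quietMass_accepts_le a b A st hρ rep).trans (sum_acceptMass_le ha (a + 1) b A st hρ)
  have hΩ₂ : loneServerAcceptance.indicator Ω' = 0 := by
    funext x
    rw [Set.indicator_apply]
    split_ifs with hx
    · exact hΩ'.2.1 x.1 (not_allowed_of_fS hx.1 hx.2) x.2
    · rfl
  have hdisj : Disjoint (clientAcceptance (C := C)) loneServerAcceptance :=
    Set.disjoint_left.2 fun x hx hx' => hx'.1 hx
  have hΩm : HasMass Ω' 1 := ⟨fun x => (hΩ'.isPos x).1, hΩ'.2.2⟩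
  obtain ⟨c, d, hc, hd, hm, hdist'⟩ := exists_traceDist_le_of_simulation hdisj hε hΓm hΓm' hΩm
    (indicator_round_simulate ha (a + 1) b A st hρ) hE₂ hΩ₂ hD₁ hD₂ hE hRm hR₀m
    (ne_top_of_le_ne_top ENNReal.ofReal_ne_top hp) (add_add_eq_of_cancel h1 h2) hdist
  refine ⟨_, isIdealOutput_indicator_add hΩ' ((hRideal.smul hc).add (hR₀ideal.smul hd))
    ((hRquiet.smul _).add (hR₀quiet.smul _)) hm, hdist'.trans ?_⟩
  rw [ENNReal.ofReal_add hε (by positivity)]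
  exact add_le_add le_rfl hp

end Params

end ClientAuth

end

theorem mainTheorem10 (C : ClientAuth.Params) (εMAC εsec : ℝ)
    (hMAC : ClientAuth.IsAlmostXORUniversal εMAC C.h₁) (hMAC0 : 0 ≤ εMAC)
    (hPA : ClientAuth.IsUniformHash fun R M => (C.hPA R M).1) (hsec0 : 0 ≤ εsec)
    (j j' : ℕ) (hj : j + 1 < C.m) (hj' : j' < C.m)
    (hsec : C.SecureFor ⟨j + 1, hj⟩ (j + 1) ⟨j', hj'⟩ εsec) :
    C.SecureFor ⟨j, by omega⟩ (j + 1) ⟨j', hj'⟩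
      (εsec + 2 / (2 ^ C.lCV : ℝ) + 1 / (2 ^ C.lSV : ℝ) + 2 * εMAC + 2 * C.εmatch) := by
  intro ι ω hω A
  obtain ⟨Ω, hΩ, hdist⟩ := ClientAuth.Params.secureFor_of_succ (a := ⟨j, by omega⟩)
    (a' := ⟨j + 1, hj⟩) rfl hMAC hMAC0 hPA hsec0 hsec ι ω hω A
  refine ⟨Ω, hΩ, hdist.trans (ENNReal.ofReal_le_ofReal ?_)⟩
  have h1 : (0 : ℝ) ≤ 1 / 2 ^ C.lCV := by positivity
  have h2 : 0 ≤ C.εmatch := Real.rpow_nonneg (by norm_num) _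
  have h3 : (2 : ℝ) / 2 ^ C.lCV = 1 / 2 ^ C.lCV + 1 / 2 ^ C.lCV := by ring
  linarith
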